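/- **Setting.** A causal model consists of a finite directed acyclic graph whose nodes are observed binary variables $X_1,\dots,X_n$, a binary reward variable $Y$ without outgoing edges, and hidden variables with values in arbitrary measurable spaces, together with a conditional distribution $P(V\mid \mathrm{Pa}(V))$ for each node $V$. Under $do(S=s)$, with $S\subseteq\{X_1,\dots,X_n\}$ and $s\in\{0,1\}^S$, the variables in $S$ are set to $s$ and every other node follows its conditional distribution; $do()$ is the null intervention and $P$ is the distribution under it. Let $A$ be a finite set of such interventions (arms) with $do()\in A$ and $N=|A|\ge 2$, let $\mu_a=\mathbb E[Y\mid a]$, and let $a^*\in A$ be an arm of maximal $\mu_a$. Playing an arm reveals the values of $X_1,\dots,X_n$ and $Y$; different plays are independent. An *admissible sequence* for $a=do(S=s)$ is an enumeration $S=\{X_{1},\dots,X_{k}\}$ (renumbering the variables) in which $X_i$ is not a descendant of $X_j$ for $i<j$, with sets $Z_1,\dots,Z_k$ of observed variables (other than $Y$) such that for each $i$: (1) no element of $Z_i$ is a descendant of any of $X_i,\dots,X_k$ (a node counts as its own descendant); (2) $Y$ and $X_i$ are d-separated by $\{X_1,\dots,X_{i-1}\}\cup Z_1\cup\dots\cup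 Z_i$ in the graph obtained by deleting the edges out of $X_i$ and the edges into $X_{i+1},\dots,X_k$. For $do()$ the empty sequence is given; for each other arm, either an admissible sequence is given or none is (in particular if none exists). If one is given put $Z_a=\bigcup_i Z_i$, $I_a=2^{|Z_a|}$ and $q_a=\min_{z\in\{0,1\}^{Z_a}}P(S=s,Z_a=z)$; otherwise $I_a=1$, $q_a=0$. (So $q_{do()}=1$.) Let $I=\max_{a\in A}I_a$. **Algorithm (Causal Successive Reject)** with budget $T\in\mathbb N$. Let $\overline{\log}N=\frac12+\sum_{i=2}^N\frac1i$, $n_0=0$ and $n_k=\frac{T/2-N}{\overline{\log}N\,(N+1-k)}$ for $1\le k\le N-1$. * Play $do()$ for $\lfloor T/2\rfloor$ rounds. If arm $a$ has a given sequence, let $T_{a,z}$ be the number of these rounds with $S=s$, $Z_a=z$, let $T_a=\min_zT_{a,z}$, and $\hat\mu_{O,a}=\sum_{z}r_{a,z}\prod_{l=1}^kp_{a,z,l}$, where $r_{a,z}$ and $p_{a,z,l}$ are the empirical frequencies, in these rounds, of $Y=1$ given $S=s,Z_a=z$ and of $Z_l=z_l$ given $Z_i=z_i,X_i=x_i$ $(i<l)$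 (here $z_i$ is the restriction of $z$ to $Z_i$, $x_i$ is the value of $X_i$ in $s$, and $0/0=0$). Otherwise $T_a=0$. * Put $A_0=A$ and $N_a=0$ for all $a$. For $k=1,\dots,N-1$: for $\lceil (N+1-k)(n_k-n_{k-1})\rceil$ rounds (none if this is negative), play an arm of $A_{k-1}$ with the least $T_a+N_a$ and increase its $N_a$ by $1$. Let $\hat\mu_a$ be the mean reward of the $N_a$ plays of $a$ in these phases if $N_a\ge T_a$ (with value $0$ if $N_a=0$), and $\hat\mu_{O,a}$ otherwise. Put $A_k=A_{k-1}\setminus\{a_k\}$ with $a_k\in\arg\min_{a\in A_{k-1}}\hat\mu_a$. * Return the only element $a^o$ of $A_{N-1}$. Ties are broken by an arbitrary rule. **Complexity.** Let $m=\min\{\tau\in\{1,\dots,N\}:|\{a\in A:q_a<1/\tau\}|\le\tau\}$. Let $\Delta_a=\mu_{a^*}-\mu_a$ for $a\ne a^*$, let $\Delta_{a^*}=\mu_{a^*}-\max_{a\in A\setminus\{a^*\}}\mu_a$, and let $\Delta^{(1)}\le\dots\le\Delta^{(N)}$ be the sorted gaps. For $1\le k\le N$ let $$\alpha_k=\frac{1+\sum_{i=k+1}^N\frac1i}{m}\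 \text{ if }k>m,\qquad \alpha_k=\frac1k+\frac{\sum_{i=m+1}^N\frac1i}{m}\ \text{ if }k\le m,$$ and for $\varepsilon\in[0,1)$ let $H_3=\max_{1\le k\le N}\alpha_k^{-1}\max\{\Delta^{(k)},\varepsilon\}^{-2}\in(0,\infty]$. **Theorem.** The algorithm uses at most $T$ rounds, always returns exactly one arm $a^o\in A$, and $$P\big(\mu_{a^o}<\mu_{a^*}-\varepsilon\big)\le 4\,I\,N^2\exp\left(-\frac{\frac T2-N}{128\,\overline{\log}N\;H_3}\right),$$ where the exponent is $0$ if $H_3=\infty$. -/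

import Mathlib

open MeasureTheory ProbabilityTheory

noncomputable section

namespace CausalBandit

/-! ### Causal models -/

/-- The nodes of a causal graph: observed variables, the reward variable, hidden variables. -/
inductive Node (X U : Type) : Type
  | obs (x : X)
  | reward
  | hidden (u : U)

/-- The observed variables and the reward are binary; a hidden variable `u` takes values in an
arbitrary measurable space `H u`. -/
abbrev Val {X U : Type} (H : U → Type) : Node X U → Type
  | .obs _ => Bool
  | .reward => Bool
  | .hidden u => H u

instance instMeasurableSpaceVal {X U : Type} (H : U → Type) [h : ∀ u, MeasurableSpace (H u)] :
    ∀ v : Node X U, MeasurableSpace (Val H v)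
  | .obs _ => inferInstanceAs (MeasurableSpace Bool)
  | .reward => inferInstanceAs (MeasurableSpace Bool)
  | .hidden u => h u

instance instNonemptyVal {X U : Type} (H : U → Type) [h : ∀ u, Nonempty (H u)] :
    ∀ v : Node X U, Nonempty (Val H v)
  | .obs _ => inferInstanceAs (Nonempty Bool)
  | .reward => inferInstanceAs (Nonempty Bool)
  | .hidden u => h u

/-- A causal model: a finite directed acyclic graph on the nodes in which the reward has no outgoing
edge, together with, for every node `v`, the conditional distribution `P(v | Pa(v))` as a Markov
kernel. Finiteness and acyclicity are given by a list of all nodes in a topological order. -/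
structure CausalModel (X U : Type) (H : U → Type) [∀ u, MeasurableSpace (H u)] where
  /-- `edge v w`: there is an edge from `v` to `w`, that is, `v` is a parent of `w`. -/
  edge : Node X U → Node X U → Prop
  order : List (Node X U)
  order_nodup : order.Nodup
  mem_order : ∀ v, v ∈ order
  order_edge : order.Pairwise (fun v w => ¬ edge w v)
  edge_irrefl : ∀ v, ¬ edge v v
  reward_sink : ∀ v, ¬ edge .reward v
  mech : ∀ v, Kernel (∀ p : {p // edge p v}, Val H p.1) (Val H v)
  mech_markov : ∀ v, IsMarkovKernel (mech v)

/-- The intervention `do(S = s)`: `a x = some b` if `x ∈ S` is set to `b`, and `a x = none` if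
`x ∉ S`. -/
abbrev Intervention (X : Type) : Type := X → Option Bool

/-- The null intervention `do()`. -/
def nullDo (X : Type) : Intervention X := fun _ => none

/-- What the agent sees in one round: the values of the observed variables and the reward. -/
abbrev Obs (X : Type) : Type := (X → Bool) × Bool

/-- The value to which the intervention sets a node, if any. -/
def forced {X U : Type} (H : U → Type) (a : Intervention X) : ∀ v : Node X U, Option (Val H v)
  | .obs x => a x
  | .reward => none
  | .hidden _ => none

namespace CausalModel

variable {X U : Type} {H : U → Type} [∀ u, MeasurableSpace (H u)]

/-- The distribution of node `v` given the values of the other nodes, under the intervention `a`. -/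
def nodeKernel (M : CausalModel X U H) (a : Intervention X) (v : Node X U) :
    Kernel (∀ w : Node X U, Val H w) (Val H v) :=
  match forced H a v with
  | some b => Kernel.const _ (Measure.dirac b)
  | none => (M.mech v).comap (fun ω p => ω p.1) (by fun_prop)

instance isMarkovKernel_nodeKernel (M : CausalModel X U H) (a : Intervention X) (v : Node X U) :
    IsMarkovKernel (M.nodeKernel a v) := by
  have := M.mech_markov v
  unfold nodeKernel
  split <;> infer_instance

open scoped Classical in
/-- Resample node `v` from its distribution under the intervention `a`. -/
def stepKernel (M : CausalModel X U H) (a : Intervention X) (v : Node X U) :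
    Kernel (∀ w : Node X U, Val H w) (∀ w : Node X U, Val H w) :=
  (Kernel.id ×ₖ M.nodeKernel a v).map (fun q => Function.update q.1 v q.2)

instance isMarkovKernel_stepKernel (M : CausalModel X U H) (a : Intervention X) (v : Node X U) :
    IsMarkovKernel (M.stepKernel a v) := by
  classical
  exact Kernel.IsMarkovKernel.map _ measurable_update'

/-- The joint distribution of all nodes under the intervention `a`: start from an arbitrary
configuration and sample the nodes one after the other in topological order. -/
def law [∀ u, Nonempty (H u)] (M : CausalModel X U H) (a : Intervention X) :
    Measure (∀ w : Node X U, Val H w) :=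
  M.order.foldl (fun μ v => μ.bind (M.stepKernel a v))
    (Measure.dirac (fun _ => Classical.arbitrary _))

instance isProbabilityMeasure_law [∀ u, Nonempty (H u)] (M : CausalModel X U H)
    (a : Intervention X) : IsProbabilityMeasure (M.law a) := by
  have key : ∀ (l : List (Node X U)) (μ : Measure (∀ w : Node X U, Val H w)),
      IsProbabilityMeasure μ →
      IsProbabilityMeasure (l.foldl (fun μ v => μ.bind (M.stepKernel a v)) μ) := by
    intro l
    induction l with
    | nil => intro μ h; exact h
    | cons v l ih => intro μ h; exact ih _ inferInstance
  exact key _ _ inferInstance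

/-- The values of the observed variables and of the reward. -/
def observe (ω : ∀ w : Node X U, Val H w) : Obs X := (fun x => ω (.obs x), ω .reward)

lemma measurable_observe : Measurable (observe : (∀ w : Node X U, Val H w) → Obs X) :=
  (measurable_pi_lambda _ fun x => measurable_pi_apply (Node.obs x)).prodMk
    (measurable_pi_apply Node.reward)

/-- The distribution of the feedback in one round in which the intervention `a` is played. -/
def obsLaw [∀ u, Nonempty (H u)] (M : CausalModel X U H) (a : Intervention X) :
    Measure (Obs X) := (M.law a).map observe

instance isProbabilityMeasure_obsLaw [∀ u, Nonempty (H u)] (M : CausalModel X U H)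
    (a : Intervention X) : IsProbabilityMeasure (M.obsLaw a) :=
  Measure.isProbabilityMeasure_map measurable_observe.aemeasurable

end CausalModel

/-- The reward `Y ∈ {0, 1}` of one round. -/
def rewardOf {X : Type} (o : Obs X) : ℝ := if o.2 = true then 1 else 0

/-- The expected reward `μ_a = E[Y | a]`. -/
def mean {X U : Type} {H : U → Type} [∀ u, MeasurableSpace (H u)] [∀ u, Nonempty (H u)]
    (M : CausalModel X U H) (a : Intervention X) : ℝ :=
  ∫ o, rewardOf o ∂(M.obsLaw a)

/-! ### d-separation and admissible sequences -/

/-- The list `p` of nodes is blocked by `C`: it passes through a collider that has no descendant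
(itself included) in `C`, or through a non-collider that lies in `C`. -/
def Blocked {V : Type} (E : V → V → Prop) (C : Set V) (p : List V) : Prop :=
  ∃ u v w, [u, v, w] <:+: p ∧
    (((E u v ∧ E w v) ∧ ∀ d, Relation.ReflTransGen E v d → d ∉ C) ∨
      (¬ (E u v ∧ E w v) ∧ v ∈ C))

/-- `x` and `y` are d-separated by `C`: every path (of edges of any direction, without repeated
nodes) from `x` to `y` is blocked by `C`. -/
def DSep {V : Type} (E : V → V → Prop) (x y : V) (C : Set V) : Prop :=
  ∀ p : List V, p.Nodup → p.IsChain (fun u v => E u v ∨ E v u) →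
    p.head? = some x → p.getLast? = some y → Blocked E C p

/-- A sequence `(X₁, Z₁), …, (X_k, Z_k)`. -/
abbrev AdmSeq (X : Type) : Type := List (X × Finset X)

/-- The set `Z_a = Z₁ ∪ ⋯ ∪ Z_k`. -/
def zUnion {X : Type} [DecidableEq X] (s : AdmSeq X) : Finset X :=
  s.foldr (fun p Z => p.2 ∪ Z) ∅

/-- The graph without the edges out of `x` and without the edges into the variables of `l`. -/
def mutilate {X U : Type} (E : Node X U → Node X U → Prop) (x : X) (l : AdmSeq X)
    (v w : Node X U) : Prop :=
  E v w ∧ v ≠ .obs x ∧ ∀ p ∈ l, w ≠ .obs p.1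

/-- `s = [(X₁, Z₁), …, (X_k, Z_k)]` is an admissible sequence with respect to the reward and the
set `S = {X₁, …, X_k}` of variables on which the intervention `a` acts, listed in an order
compatible with the graph. -/
structure IsAdmissible {X U : Type} {H : U → Type} [∀ u, MeasurableSpace (H u)]
    (M : CausalModel X U H) (a : Intervention X) (s : AdmSeq X) : Prop where
  nodup : (s.map Prod.fst).Nodup
  support : ∀ x, x ∈ s.map Prod.fst ↔ (a x).isSome
  /-- `X_i` is not a descendant of `X_j` for `i < j`. -/
  topological : s.Pairwise (fun p q => ¬ Relation.ReflTransGen M.edge (.obs q.1) (.obs p.1))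
  /-- `Z_i` consists of nondescendants of `X_i, …, X_k`. -/
  nondescendant : ∀ pre x Z post, s = pre ++ (x, Z) :: post → ∀ z ∈ Z,
    ∀ p ∈ (x, Z) :: post, ¬ Relation.ReflTransGen M.edge (.obs p.1) (.obs z)
  /-- In the graph without the edges out of `X_i` and those into `X_{i+1}, …, X_k`, the reward and
  `X_i` are d-separated by `X₁, …, X_{i-1}, Z₁, …, Z_i`. -/
  dsep : ∀ pre x Z post, s = pre ++ (x, Z) :: post →
    DSep (mutilate M.edge x post) .reward (.obs x)
      {v | (∃ p ∈ pre, v = .obs p.1 ∨ ∃ z ∈ p.2, v = .obs z) ∨ ∃ z ∈ Z, v = .obs z}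

section Observational

variable {X : Type} [Fintype X] [DecidableEq X]

/-- A value `z` of the variables in `Z_a`. -/
abbrev ZVal (s : AdmSeq X) : Type := {x // x ∈ zUnion s} → Bool

/-- The event `Z = z` for a subset `Z` of `Z_a`. -/
def zMatch (s : AdmSeq X) (z : ZVal s) (Z : Finset X) (o : Obs X) : Prop :=
  ∀ x (h : x ∈ zUnion s), x ∈ Z → o.1 x = z ⟨x, h⟩

/-- The event `X_i = x_i` and `Z_i = z_i` for all `(X_i, Z_i)` in the list `l`, where `a` is
`do(X₁ = x₁, …, X_k = x_k)`. -/
def histMatch (a : Intervention X) (s : AdmSeq X) (z : ZVal s) (l : AdmSeq X) (o : Obs X) : Prop :=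
  ∀ p ∈ l, a p.1 = some (o.1 p.1) ∧ zMatch s z p.2 o

/-- `q_a = min_z P(S = s, Z_a = z)` for an arm with an admissible sequence, and `q_a = 0` for an arm
without one. -/
def qObs {U : Type} {H : U → Type} [∀ u, MeasurableSpace (H u)] [∀ u, Nonempty (H u)]
    (M : CausalModel X U H) (a : Intervention X) : Option (AdmSeq X) → ℝ
  | none => 0
  | some s => ⨅ z : ZVal s, (M.obsLaw (nullDo X)).real {o | histMatch a s z s o}

/-- `I_a = 2 ^ |Z_a|`. -/
def iCard : Option (AdmSeq X) → ℕ
  | none => 1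
  | some s => 2 ^ (zUnion s).card

open scoped Classical in
/-- The number of the first `t` observations `O 0, …, O (t - 1)` that satisfy `Q`. -/
def countObs (O : ℕ → Obs X) (t : ℕ) (Q : Obs X → Prop) : ℕ :=
  ((Finset.range t).filter (fun j => Q (O j))).card

/-- `T_a = min_z T_{a,z}`, the number of times the arm has been observed. -/
def tObs (a : Intervention X) (O : ℕ → Obs X) (t : ℕ) : Option (AdmSeq X) → ℕ
  | none => 0
  | some s => ⨅ z : ZVal s, countObs O t (histMatch a s z s)

/-- `r_{a,z}`, the empirical mean of `P(Y = 1 | S = s, Z_a = z)`. -/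
def rHat (a : Intervention X) (s : AdmSeq X) (z : ZVal s) (O : ℕ → Obs X) (t : ℕ) : ℝ :=
  (countObs O t (fun o => histMatch a s z s o ∧ o.2 = true) : ℝ) /
    (countObs O t (histMatch a s z s) : ℝ)

/-- `p_{a,z,l}`, the empirical mean of `P(Z_l = z_l | Z_i = z_i, X_i = x_i, i ≤ l - 1)`, where
`l = i + 1` (here `i` counts from `0`). -/
def pHat (a : Intervention X) (s : AdmSeq X) (z : ZVal s) (i : Fin s.length) (O : ℕ → Obs X)
    (t : ℕ) : ℝ :=
  (countObs O t (fun o => histMatch a s z (s.take i) o ∧ zMatch s z (s.get i).2 o) : ℝ) /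
    (countObs O t (histMatch a s z (s.take i)) : ℝ)

/-- The observational estimate `∑_z r_{a,z} ∏_l p_{a,z,l}` of `μ_a`. -/
def muObs (a : Intervention X) (O : ℕ → Obs X) (t : ℕ) : Option (AdmSeq X) → ℝ
  | none => 0
  | some s => ∑ z : ZVal s, rHat a s z O t * ∏ i : Fin s.length, pHat a s z i O t

end Observational

/-! ### The algorithm -/

section Algorithm

variable {X : Type} [Fintype X] [DecidableEq X]

/-- The outcomes of all possible plays: `ω (a, j)` is the feedback of the `j`-th play of the
arm `a` (counted from `0`). -/
abbrev Outcomes (X : Type) : Type := Intervention X × ℕ → Obs X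

/-- The plays are independent, and each play of `a` has the distribution of the model under `a`. -/
def playLaw {U : Type} {H : U → Type} [∀ u, MeasurableSpace (H u)] [∀ u, Nonempty (H u)]
    (M : CausalModel X U H) : Measure (Outcomes X) :=
  Measure.infinitePi (fun i : Intervention X × ℕ => M.obsLaw i.1)

/-- The usual normalization `1/2 + ∑_{i = 2}^N 1/i` of successive rejects. -/
def logBar (N : ℕ) : ℝ := 1 / 2 + ∑ i ∈ Finset.Icc 2 N, (1 : ℝ) / i

/-- `n_0 = 0` and `n_k = (T/2 - N) / (logBar N * (N + 1 - k))`. -/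
def nPhase (T N k : ℕ) : ℝ :=
  if k = 0 then 0 else ((T : ℝ) / 2 - N) / (logBar N * ((N : ℝ) + 1 - k))

/-- The number `⌈(N + 1 - k) (n_k - n_{k-1})⌉` of plays in phase `k ≥ 1` (none if negative). -/
def pulls (T N k : ℕ) : ℕ := ⌈((N : ℝ) + 1 - k) * (nPhase T N k - nPhase T N (k - 1))⌉₊

/-- The elements of `A` at which `f` is minimal. -/
def argminSet {α β : Type} [LinearOrder β] (A : Finset α) (f : α → β) : Finset α :=
  A.filter (fun a => ∀ b ∈ A, f a ≤ f b)

/-- The observations made by playing `do()` for `⌊T/2⌋` rounds are the first `⌊T/2⌋` plays of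
`do()`. -/
def observations (ω : Outcomes X) (j : ℕ) : Obs X := ω (nullDo X, j)

/-- The `j`-th play of `a` in the phases after the observation rounds. -/
def interventionOutcome (T : ℕ) (ω : Outcomes X) (a : Intervention X) (j : ℕ) : Obs X :=
  ω (a, if a = nullDo X then T / 2 + j else j)

/-- The interventional estimate of `μ_a`: the mean reward of the `n` plays of `a`. -/
def muInt (T : ℕ) (ω : Outcomes X) (a : Intervention X) (n : ℕ) : ℝ :=
  (∑ j ∈ Finset.range n, rewardOf (interventionOutcome T ω a j)) / n

/-- The estimate of `μ_a` when `a` has been played `n` times in the phases: the interventional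
estimate if `n ≥ T_a`, and the observational estimate otherwise. -/
def muHat (adm : Intervention X → Option (AdmSeq X)) (T : ℕ) (ω : Outcomes X)
    (a : Intervention X) (n : ℕ) : ℝ :=
  if tObs a (observations ω) (T / 2) (adm a) ≤ n then muInt T ω a n
  else muObs a (observations ω) (T / 2) (adm a)

/-- A tie-breaking rule chooses an element of a set of minimizers. It may depend on the outcomes and
on the current numbers of plays. -/
abbrev TieRule (X : Type) : Type :=
  Outcomes X → (Intervention X → ℕ) → Finset (Intervention X) → Intervention X

/-- One play in a phase with remaining arms `A`: play an arm of `A` with the least `T_a + N_a`. -/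
def pullStep (adm : Intervention X → Option (AdmSeq X)) (tie : TieRule X) (T : ℕ) (ω : Outcomes X)
    (A : Finset (Intervention X)) (n : Intervention X → ℕ) : Intervention X → ℕ :=
  let b := tie ω n (argminSet A fun a => tObs a (observations ω) (T / 2) (adm a) + n a)
  Function.update n b (n b + 1)

/-- The remaining arms `A_k` and the counts `N_a` after phase `k`. -/
def state (arms : Finset (Intervention X)) (adm : Intervention X → Option (AdmSeq X))
    (tie : TieRule X) (T : ℕ) (ω : Outcomes X) :
    ℕ → Finset (Intervention X) × (Intervention X → ℕ)
  | 0 => (arms, fun _ => 0)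
  | k + 1 =>
    let A := (state arms adm tie T ω k).1
    let n := (pullStep adm tie T ω A)^[pulls T arms.card (k + 1)] (state arms adm tie T ω k).2
    (A.erase (tie ω n (argminSet A fun a => muHat adm T ω a (n a))), n)

/-- The set of arms that remain after the last phase `N - 1`. -/
def returned (arms : Finset (Intervention X)) (adm : Intervention X → Option (AdmSeq X))
    (tie : TieRule X) (T : ℕ) (ω : Outcomes X) : Finset (Intervention X) :=
  (state arms adm tie T ω (arms.card - 1)).1

/-- The total number of rounds: the observations and the plays in the phases `1, …, N - 1`. -/
def rounds (T N : ℕ) : ℕ := T / 2 + ∑ k ∈ Finset.Icc 1 (N - 1), pulls T N k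

end Algorithm

/-! ### The complexity measure -/

section Complexity

variable {X : Type} [Fintype X] [DecidableEq X]

/-- The observation threshold `m = min {τ ∈ [N] : |{a : q_a < 1/τ}| ≤ τ}`. -/
def obsThreshold (arms : Finset (Intervention X)) (q : Intervention X → ℝ) : ℕ :=
  sInf {τ : ℕ | 1 ≤ τ ∧ τ ≤ arms.card ∧ (arms.filter (fun a => q a < 1 / (τ : ℝ))).card ≤ τ}

/-- The gap of the arm `a`, with respect to the optimal arm `best`. -/
def gap (arms : Finset (Intervention X)) (μ : Intervention X → ℝ) (best a : Intervention X) : ℝ :=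
  if a = best then μ best - sSup (μ '' {b | b ∈ arms ∧ b ≠ best}) else μ best - μ a

/-- The `k`-th smallest gap `Δ^{(k)}`, for `1 ≤ k ≤ N`. -/
def sortedGap (arms : Finset (Intervention X)) (μ : Intervention X → ℝ) (best : Intervention X)
    (k : ℕ) : ℝ :=
  ((arms.val.map (gap arms μ best)).sort (· ≤ ·)).getD (k - 1) 0

/-- The weight `α_k`. -/
def alpha (N m k : ℕ) : ℝ :=
  if m < k then (1 + ∑ i ∈ Finset.Icc (k + 1) N, (1 : ℝ) / i) / m
  else 1 / (k : ℝ) + (∑ i ∈ Finset.Icc (m + 1) N, (1 : ℝ) / i) / m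

/-- `H₃ = max_{1 ≤ k ≤ N} α_k⁻¹ max(Δ^{(k)}, ε)⁻²`, which is `∞` if `max(Δ^{(k)}, ε) = 0` for
some `k`. -/
def H3 (arms : Finset (Intervention X)) (μ q : Intervention X → ℝ) (best : Intervention X)
    (ε : ℝ) : ENNReal :=
  (Finset.Icc 1 arms.card).sup fun k =>
    (ENNReal.ofReal (alpha arms.card (obsThreshold arms q) k))⁻¹ *
      (ENNReal.ofReal (max (sortedGap arms μ best k) ε) ^ 2)⁻¹

end Complexity

end CausalBandit

end

namespace CausalBandit

/-! ### The separating partition given by d-separation -/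

section Graph

variable {V : Type} {E : V → V → Prop} {C : Set V}

/-! The bound joins an identification formula, a deviation inequality for its plug-in estimate, and
a count of samples that survives random, adaptive allocation.

Identification. Along an admissible sequence let V_i be the conditional probability of Y = 1 given
the history of the first i pairs (X, Z), the later variables being set by the intervention
(`condReward`). Then V_0 = μ_a, V_k is purely observational, and, when all histories have positive
probability, V_i is the observational average of V_{i+1} over the next Z
(`IsAdmissible.setIntegral_condReward`). Turning the action on one variable into an observation is
`CausalModel.law_exchange`. Its proof uses a split model, in which X_i is sampled as usual but every
node reading it receives the fixed value t: on events inside X_i = t this is the law without the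
action, and on events not involving X_i it is the law with the action. In the split model
d-separation becomes a partition of the relevant nodes (`exists_partition_of_dSep`), and integrating
out the nodes in reverse topological order gives conditional independence (`resampleList_mul_comm`).

Estimation. The estimate is an iterated empirical average with the same tower property
(`zAvg_succ`), so its error telescopes into one deviation per level. A history that leaves r
variables of Z_a open occurs at least 2^r T_a times, so its level may be charged a deviation δ
(5/7)^r at no loss in the exponent, as 2 (5/7)^2 ≥ 1. The charges sum to less than 5δ/2, the reward
adds δ, and the union bound costs 2^{|Z_a|} up to a factor 2 instead of a power growing with the
length of the sequence (`IsAdmissible.playLaw_muObs_le`). All deviations come from Ville's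
inequality for exponential products, which is uniform in the number of plays, so adaptive sample
sizes need no further argument.

Allocation. Up to rare events, all but at most m arms are observed at least ⌊T/2⌋/(2m) times. While
at least m arms remain, either every remaining arm has reached that level or all plays went to at
most m arms (`Balanced.le_or_le`). Afterwards a fractional water level is followed through
eliminations and plays (`LevelGe`). Together, an arm remaining in the phase with k arms has T_a +
N_a + 1 at least 2/5 of budget · α_k once this product is at least 30
(`budget_mul_alpha_le_tObs_add`).

If a bad arm is returned, then in the phase that eliminates the best arm some estimate is off by
half of max(Δ^{(k)}, ε) (`exists_devSign_mul_le`). A union bound over phases and arms finishes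
(`playLaw_returned_le_of_forall_le`). -/

lemma Blocked.mono {p q : List V} (h : p <:+: q) : Blocked E C p → Blocked E C q := by
  rintro ⟨u, v, w, hp, H⟩
  exact ⟨u, v, w, hp.trans h, H⟩

lemma not_blocked_singleton (v : V) : ¬ Blocked E C [v] := by
  rintro ⟨a, b, c, h, -⟩
  have := h.length_le
  simp at this

lemma not_blocked_pair (v w : V) : ¬ Blocked E C [v, w] := by
  rintro ⟨a, b, c, h, -⟩
  have := h.length_le
  simp at this

lemma not_blocked_cons {w v u : V} {l : List V} (h : ¬ Blocked E C (v :: u :: l))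
    (hcol : E w v ∧ E u v → ∃ d, Relation.ReflTransGen E v d ∧ d ∈ C)
    (hnon : ¬ (E w v ∧ E u v) → v ∉ C) : ¬ Blocked E C (w :: v :: u :: l) := by
  rintro ⟨a, b, c, hi, H⟩
  rcases List.infix_cons_iff.1 hi with hp | hi
  · simp only [List.cons_prefix_cons] at hp
    obtain ⟨rfl, rfl, rfl, -⟩ := hp
    rcases H with ⟨h1, h2⟩ | ⟨h1, h2⟩
    · obtain ⟨d, hd, hdC⟩ := hcol h1
      exact h2 d hd hdC
    · exact hnon h1 h2
  · exact h ⟨a, b, c, hi, H⟩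

/-- The list `p` is an unblocked path from `v` to `x`. -/
structure IsOpenPath (E : V → V → Prop) (C : Set V) (x v : V) (p : List V) : Prop where
  nodup : p.Nodup
  chain : p.IsChain (fun u v => E u v ∨ E v u)
  head : p.head? = some v
  last : p.getLast? = some x
  unblocked : ¬ Blocked E C p

/-- There is an unblocked path between `v` and `x`. -/
def OpenTo (E : V → V → Prop) (C : Set V) (x v : V) : Prop := ∃ p, IsOpenPath E C x v p

lemma dSep_iff_not_openTo {x y : V} : DSep E y x C ↔ ¬ OpenTo E C x y := by
  constructor
  · rintro h ⟨p, hp⟩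
    exact hp.unblocked (h p hp.nodup hp.chain hp.head hp.last)
  · intro h p h1 h2 h3 h4
    by_contra hb
    exact h ⟨p, h1, h2, h3, h4, hb⟩

lemma IsOpenPath.exists_eq_cons {x v : V} {p : List V} (h : IsOpenPath E C x v p) :
    ∃ l, p = v :: l := by
  cases p with
  | nil => simpa using h.head
  | cons a l =>
    have := h.head
    simp only [List.head?_cons, Option.some.injEq] at this
    exact ⟨l, by rw [this]⟩

lemma IsOpenPath.suffix {x v w : V} {p : List V} (h : IsOpenPath E C x v p) (hw : w ∈ p) :
    ∃ l, IsOpenPath E C x w (w :: l) ∧ (w :: l) <:+ p := by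
  obtain ⟨l₁, l₂, rfl⟩ := List.append_of_mem hw
  have hs : (w :: l₂) <:+ (l₁ ++ w :: l₂) := List.suffix_append _ _
  refine ⟨l₂, ⟨h.nodup.sublist hs.sublist, h.chain.suffix hs, rfl, ?_, ?_⟩, hs⟩
  · have := h.last
    rw [List.getLast?_append] at this
    cases hl : (w :: l₂).getLast? with
    | none => simp at hl
    | some a => rw [hl] at this; simpa using this
  · exact fun hb => h.unblocked (hb.mono hs.isInfix)

lemma OpenTo.of_mem {x v w : V} {p : List V} (h : IsOpenPath E C x v p) (hw : w ∈ p) :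
    OpenTo E C x w := by
  obtain ⟨l, hl, -⟩ := h.suffix hw
  exact ⟨_, hl⟩

lemma IsOpenPath.cons {x v w : V} {p : List V} (h : IsOpenPath E C x v p) (hw : w ∉ p)
    (hE : E w v ∨ E v w)
    (hcol : ∀ u l, p = v :: u :: l → E w v ∧ E u v → ∃ d, Relation.ReflTransGen E v d ∧ d ∈ C)
    (hnon : ∀ u l, p = v :: u :: l → ¬ (E w v ∧ E u v) → v ∉ C) :
    IsOpenPath E C x w (w :: p) := by
  obtain ⟨l, rfl⟩ := h.exists_eq_cons
  refine ⟨List.nodup_cons.2 ⟨hw, h.nodup⟩, List.isChain_cons_cons.2 ⟨hE, h.chain⟩, rfl, ?_, ?_⟩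
  · rw [List.getLast?_cons_cons]; exact h.last
  · cases l with
    | nil => exact not_blocked_pair _ _
    | cons u l => exact not_blocked_cons h.unblocked (hcol u l rfl) (hnon u l rfl)

lemma openTo_refl (x : V) : OpenTo E C x x :=
  ⟨[x], by simp, by simp, rfl, rfl, not_blocked_singleton x⟩

/-- Extending the path by the child w makes v a tail of the new edge, hence a non-collider by
acyclicity, and v is outside C. -/
lemma OpenTo.child (hac : ∀ v w, E v w → ¬ Relation.ReflTransGen E w v) {x v w : V}
    (h : OpenTo E C x v) (hv : v ∉ C) (hE : E v w) : OpenTo E C x w := by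
  obtain ⟨p, hp⟩ := h
  by_cases hw : w ∈ p
  · exact OpenTo.of_mem hp hw
  · refine ⟨_, hp.cons hw (Or.inr hE) (fun u l _ h => ?_) (fun _ _ _ _ => hv)⟩
    exact absurd (Relation.ReflTransGen.single h.1) (hac _ _ hE)

/-- A directed path to `x` outside `C` is unblocked. -/
lemma openTo_of_directed (hac : ∀ v w, E v w → ¬ Relation.ReflTransGen E w v) {x v : V}
    (h : Relation.ReflTransGen E v x)
    (hC : ∀ d, Relation.ReflTransGen E v d → d ∉ C) : 
    ∃ p, IsOpenPath E C x v p ∧ (∀ u ∈ p, Relation.ReflTransGen E v u) ∧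
      (∀ u l, p = v :: u :: l → E v u) := by
  induction h using Relation.ReflTransGen.head_induction_on with
  | refl =>
    exact ⟨[x], ⟨by simp, by simp, rfl, rfl, not_blocked_singleton x⟩, by simp; rfl, by simp⟩
  | @head a b hab hbx ih =>
    obtain ⟨p, hp, hdesc, hfst⟩ := ih (fun d hd => hC d (hd.head hab))
    refine ⟨a :: p, hp.cons (fun ha => hac _ _ hab (hdesc a ha)) (Or.inl hab) ?_ ?_, ?_, ?_⟩
    · intro u l hpl hcol
      exact absurd (Relation.ReflTransGen.single hcol.2) (hac _ _ (hfst u l hpl))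
    · exact fun _ _ _ _ => hC b (.single hab)
    · intro u hu
      rcases List.mem_cons.1 hu with rfl | hu
      · exact .refl
      · exact (hdesc u hu).head hab
    · intro u l hl
      obtain ⟨l', rfl⟩ := hp.exists_eq_cons
      simp only [List.cons.injEq, true_and] at hl
      rw [← hl.1]; exact hab

lemma OpenTo.of_directed_out (hac : ∀ v w, E v w → ¬ Relation.ReflTransGen E w v) {x v y : V}
    (h : OpenTo E C x v) (hvy : Relation.ReflTransGen E v y)
    (hC : ∀ d, Relation.ReflTransGen E v d → d ∉ C) : OpenTo E C x y := by
  induction hvy using Relation.ReflTransGen.head_induction_on with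
  | refl => exact h
  | head hab _ ih => exact ih (h.child hac (hC _ .refl) hab) (fun d hd => hC d (hd.head hab))

/-- If `x` and `y` are d-separated by `C`, then the relevant nodes outside `C` split into two parts,
one with `x` and one with `y`, such that parents of a node of one part are in this part or in `C`,
and the parents outside `C` of a node of `C` are all in the same part. -/
theorem exists_partition_of_dSep (hac : ∀ v w, E v w → ¬ Relation.ReflTransGen E w v) {x y : V}
    (hx : x ∉ C) (hy : y ∉ C) (hsep : DSep E y x C) :
    ∃ A B : Set V, x ∈ A ∧ y ∈ B ∧ Disjoint A B ∧
      (∀ v ∈ A, ∀ p, E p v → p ∈ A ∪ C) ∧ (∀ v ∈ B, ∀ p, E p v → p ∈ B ∪ C) ∧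
      (∀ v ∈ C, (∀ p, E p v → p ∈ A ∪ C) ∨ (∀ p, E p v → p ∈ B ∪ C)) := by
  rw [dSep_iff_not_openTo] at hsep
  -- Only ancestors of x, y and C matter. Outside C they are sorted by whether an open path joins
  -- them to x.
  let N : Set V := {v | ∃ d, (d = x ∨ d = y ∨ d ∈ C) ∧ Relation.ReflTransGen E v d}
  have hN : ∀ v ∈ N, ∀ p, E p v → p ∈ N := by
    rintro v ⟨d, hd, hvd⟩ p hp
    exact ⟨d, hd, hvd.head hp⟩
  have hCN : ∀ v ∈ C, v ∈ N := fun v hv => ⟨v, Or.inr (Or.inr hv), .refl⟩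
  refine ⟨{v | v ∈ N ∧ v ∉ C ∧ OpenTo E C x v}, {v | v ∈ N ∧ v ∉ C ∧ ¬ OpenTo E C x v},
    ⟨⟨x, Or.inl rfl, .refl⟩, hx, openTo_refl x⟩, ⟨⟨y, Or.inr (Or.inl rfl), .refl⟩, hy, hsep⟩,
    ?_, ?_, ?_, ?_⟩
  · exact Set.disjoint_left.2 fun v h1 h2 => h2.2.2 h1.2.2
  · rintro v ⟨hvN, hvC, hv⟩ p hp
    by_cases hpC : p ∈ C
    · exact Or.inr hpC
    refine Or.inl ⟨hN v hvN p hp, hpC, ?_⟩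
    -- Prepending p may turn v into a collider. A descendant of v in C opens it. Without one, v is
    -- an ancestor of x or of y: a directed path to x can be used instead, and a directed path to y
    -- would connect x with y.
    by_cases hanc : ∃ d, Relation.ReflTransGen E v d ∧ d ∈ C
    · obtain ⟨π, hπ⟩ := hv
      by_cases hpπ : p ∈ π
      · exact OpenTo.of_mem hπ hpπ
      · exact ⟨_, hπ.cons hpπ (Or.inl hp) (fun _ _ _ _ => hanc) (fun _ _ _ _ => hvC)⟩
    · push Not at hanc
      obtain ⟨d, hd, hvd⟩ := hvN
      rcases hd with rfl | rfl | hd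
      · obtain ⟨π, hπ, hdesc, hfst⟩ := openTo_of_directed hac hvd hanc
        refine ⟨_, hπ.cons (fun h => hac _ _ hp (hdesc p h)) (Or.inl hp) (fun u l hl h => ?_)
          (fun _ _ _ _ => hvC)⟩
        exact absurd (Relation.ReflTransGen.single h.2) (hac _ _ (hfst u l hl))
      · exact absurd (hv.of_directed_out hac hvd hanc) hsep
      · exact absurd hd (hanc d hvd)
  · rintro v ⟨hvN, hvC, hv⟩ p hp
    by_cases hpC : p ∈ C
    · exact Or.inr hpC
    exact Or.inl ⟨hN v hvN p hp, hpC, fun h => hv (h.child hac hpC hp)⟩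
  · intro v hv
    by_contra hcon
    push Not at hcon
    -- An open path from p₁ to x would extend to p₂ through the collider p₂ → v ← p₁, which is open
    -- because v ∈ C. The rest of the proof keeps the path free of repeated nodes.
    obtain ⟨⟨p₂, hp₂, h₂⟩, ⟨p₁, hp₁, h₁⟩⟩ := hcon
    have hp₁C : p₁ ∉ C := fun h => h₁ (Or.inr h)
    have hp₂C : p₂ ∉ C := fun h => h₂ (Or.inr h)
    have ho₁ : OpenTo E C x p₁ := by
      by_contra h
      exact h₁ (Or.inl ⟨hN v (hCN v hv) _ hp₁, hp₁C, h⟩)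
    refine h₂ (Or.inl ⟨hN v (hCN v hv) _ hp₂, hp₂C, ?_⟩)
    obtain ⟨π, hπ⟩ := ho₁
    by_cases h2π : p₂ ∈ π
    · exact OpenTo.of_mem hπ h2π
    by_cases hvπ : v ∈ π
    · obtain ⟨l, hl, hsuf⟩ := hπ.suffix hvπ
      have h2l : p₂ ∉ v :: l := fun h => h2π (hsuf.subset h)
      cases l with
      | nil =>
        have := hl.last
        simp only [List.getLast?_singleton, Option.some.injEq] at this
        exact absurd (this ▸ hv) hx
      | cons u l =>
        -- Here v already lies on the path and u follows it. If u → v, then p₂ → v ← u is an open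
        -- collider. Otherwise v is an inner non-collider in C, and the path was blocked from the
        -- start.
        by_cases huv : E u v
        · refine ⟨_, hl.cons h2l (Or.inl hp₂) (fun _ _ _ _ => ⟨v, .refl, hv⟩) ?_⟩
          intro u' l' h hn
          simp only [List.cons.injEq, true_and] at h
          exact absurd ⟨hp₂, h.1 ▸ huv⟩ hn
        · exfalso
          obtain ⟨l₀, hl₀⟩ := hsuf
          obtain ⟨l₁, rfl⟩ := hπ.exists_eq_cons
          rcases List.eq_nil_or_concat l₀ with rfl | ⟨l₂, a, rfl⟩
          · simp only [List.nil_append, List.cons.injEq] at hl₀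
            exact hp₁C (hl₀.1 ▸ hv)
          · refine hπ.unblocked ⟨a, v, u, ⟨l₂, l, ?_⟩, Or.inr ⟨fun h => huv h.2, hv⟩⟩
            rw [← hl₀]; simp
    · have h1 : IsOpenPath E C x v (v :: π) :=
        hπ.cons hvπ (Or.inr hp₁) (fun _ _ _ h => absurd (Relation.ReflTransGen.single h.1)
          (hac _ _ hp₁)) (fun _ _ _ _ => hp₁C)
      have h2v : p₂ ≠ v := fun h => hp₂C (h ▸ hv)
      refine ⟨_, h1.cons (by simp [h2v, h2π]) (Or.inl hp₂) (fun _ _ _ _ => ⟨v, .refl, hv⟩) ?_⟩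
      intro u l h hn
      obtain ⟨l', rfl⟩ := hπ.exists_eq_cons
      simp only [List.cons.injEq, true_and] at h
      exact absurd ⟨hp₂, h.1 ▸ hp₁⟩ hn

end Graph

/-! ### Sequential sampling and its Markov property -/

section Resample

open scoped Classical ENNReal

variable {ι : Type} {Ω : ι → Type} [∀ i, MeasurableSpace (Ω i)]

/-- The conditional expectation of `F` when the coordinate `v` is resampled. -/
noncomputable def resample (κ : ∀ v, Kernel (∀ i, Ω i) (Ω v)) (v : ι) (F : (∀ i, Ω i) → ℝ≥0∞) :
    (∀ i, Ω i) → ℝ≥0∞ :=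
  fun ω => ∫⁻ t, F (Function.update ω v t) ∂(κ v ω)

/-- The conditional expectation of `F` when the coordinates in `l` are resampled in this order. -/
noncomputable def resampleList (κ : ∀ v, Kernel (∀ i, Ω i) (Ω v)) (l : List ι)
    (F : (∀ i, Ω i) → ℝ≥0∞) : (∀ i, Ω i) → ℝ≥0∞ :=
  l.foldr (resample κ) F

variable {κ κ' : ∀ v, Kernel (∀ i, Ω i) (Ω v)} {F G : (∀ i, Ω i) → ℝ≥0∞} {v : ι} {l : List ι}

@[simp] lemma resampleList_nil : resampleList κ [] F = F := rfl

@[simp] lemma resampleList_cons :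
    resampleList κ (v :: l) F = resample κ v (resampleList κ l F) := rfl

lemma resampleList_append (l' : List ι) :
    resampleList κ (l ++ l') F = resampleList κ l (resampleList κ l' F) := by
  simp [resampleList, List.foldr_append]

lemma measurable_resample [∀ v, IsMarkovKernel (κ v)] (hF : Measurable F) :
    Measurable (resample κ v F) :=
  Measurable.lintegral_kernel_prod_right' (κ := κ v) (hF.comp measurable_update')

lemma measurable_resampleList [∀ v, IsMarkovKernel (κ v)] (hF : Measurable F) (l : List ι) :
    Measurable (resampleList κ l F) := by
  induction l with
  | nil => exact hF
  | cons v l ih => exact measurable_resample ih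

lemma resample_eq_self [∀ v, IsMarkovKernel (κ v)]
    (h : ∀ ω t, F (Function.update ω v t) = F ω) : resample κ v F = F := by
  ext ω
  simp [resample, h]

lemma DependsOn.resample {s : Set ι} (hF : DependsOn F s)
    (hκ : ∀ ω ω' : ∀ i, Ω i, (∀ i ∈ s, ω i = ω' i) → κ v ω = κ v ω') :
    DependsOn (resample κ v F) s := by
  intro ω ω' h
  unfold CausalBandit.resample
  rw [hκ ω ω' h]
  congr 1
  ext t
  apply hF
  intro i hi
  by_cases hiv : i = v
  · subst hiv; simp
  · simp [hiv, h i hi]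

omit [∀ i, MeasurableSpace (Ω i)] in
lemma DependsOn.update_eq {β : Type*} {f : (∀ i, Ω i) → β} {s : Set ι} (h : DependsOn f s)
    (hv : v ∉ s) (ω : ∀ i, Ω i) (t : Ω v) : f (Function.update ω v t) = f ω :=
  h fun i hi => Function.update_of_ne (fun e : i = v => hv (e ▸ hi)) _ _

omit [∀ i, MeasurableSpace (Ω i)] in
lemma DependsOn.comp_update {β : Type*} {f : (∀ i, Ω i) → β} {s : Set ι} (h : DependsOn f s)
    (t : Ω v) : DependsOn (fun ω => f (Function.update ω v t)) s := by
  intro ω ω' hω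
  apply h
  intro i hi
  by_cases hiv : i = v
  · subst hiv; simp
  · simp [hiv, hω i hi]

/-- The functions that depend on the coordinates in `s` and vanish unless the coordinates in `S`
are those of `c`. -/
structure IsLocal (s : Set ι) (c : ∀ i, Ω i) (S : Set ι) (f : (∀ i, Ω i) → ℝ≥0∞) : Prop where
  meas : Measurable f
  dep : DependsOn f s
  supp : ∀ ω, f ω ≠ 0 → ∀ w ∈ S, ω w = c w

variable {A B C S S' s : Set ι} {c : ∀ i, Ω i}

lemma IsLocal.mono {f : (∀ i, Ω i) → ℝ≥0∞} (hf : IsLocal s c S' f) (hS : S ⊆ S') :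
    IsLocal s c S f :=
  ⟨hf.meas, hf.dep, fun ω hω w hw => hf.supp ω hω w (hS hw)⟩

/-- Resampling v averages over its values, so only the support condition at v is lost. A wrong value
at another coordinate of S persists under the integral and keeps it zero. -/
lemma IsLocal.resample [∀ v, IsMarkovKernel (κ v)] {f : (∀ i, Ω i) → ℝ≥0∞}
    (hf : IsLocal s c S' f) (hS : S ⊆ S') (hv : v ∉ S)
    (hκ : ∀ ω ω' : ∀ i, Ω i, (∀ i ∈ s, ω i = ω' i) → κ v ω = κ v ω') :
    IsLocal s c S (resample κ v f) where
  meas := measurable_resample hf.meas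
  dep := DependsOn.resample hf.dep hκ
  supp := by
    intro ω hω w hw
    by_contra hne
    apply hω
    have : ∀ t, f (Function.update ω v t) = 0 := by
      intro t
      by_contra h0
      have := hf.supp _ h0 w (hS hw)
      rw [Function.update_of_ne (fun e : w = v => hv (e ▸ hw))] at this
      exact hne this
    simp [CausalBandit.resample, this]

lemma IsLocal.comp_update {f : (∀ i, Ω i) → ℝ≥0∞}
    (hf : IsLocal s c S' f) (hS : S ⊆ S') (hv : v ∉ S) :
    IsLocal s c S (fun ω => f (Function.update ω v (c v))) where
  meas := hf.meas.comp (measurable_update'.comp (measurable_id.prodMk measurable_const))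
  dep := DependsOn.comp_update hf.dep _
  supp := by
    intro ω hω w hw
    have := hf.supp _ hω w (hS hw)
    rwa [Function.update_of_ne (fun e : w = v => hv (e ▸ hw))] at this

/-- Either g does not see v, or f forces the value c v. In both cases g may be evaluated at v = c v
and taken out of the integral. -/
lemma resample_mul {f g : (∀ i, Ω i) → ℝ≥0∞}
    (hf : Measurable f) (hg : DependsOn g s)
    (hsupp : v ∈ s → ∀ ω, f ω ≠ 0 → ω v = c v) :
    resample κ v (fun ω => f ω * g ω) =
      fun ω => resample κ v f ω * g (Function.update ω v (c v)) := by
  ext ω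
  unfold resample
  have hm : Measurable (fun t => f (Function.update ω v t)) := hf.comp (measurable_update ω)
  rw [← lintegral_mul_const _ hm]
  congr 1
  ext t
  by_cases hv : v ∈ s
  · by_cases h0 : f (Function.update ω v t) = 0
    · simp [h0]
    · have := hsupp hv _ h0
      rw [Function.update_self] at this
      rw [this]
  · simp only [DependsOn.update_eq hg hv]

/-- The kernel of `v` is determined by the coordinates in `s`. -/
def KernelDependsOn (κ : ∀ v, Kernel (∀ i, Ω i) (Ω v)) (v : ι) (s : Set ι) : Prop :=
  ∀ ω ω' : ∀ i, Ω i, (∀ i ∈ s, ω i = ω' i) → κ v ω = κ v ω'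

/-- One resampling step preserves products of local functions. -/
lemma exists_resample_mul [∀ v, IsMarkovKernel (κ v)] (hAB : Disjoint A B) (hS : S ⊆ S') (hv : v ∉ S) (hSC : v ∈ C → v ∈ S')
    (hκA : v ∈ A → KernelDependsOn κ v (A ∪ C)) (hκB : v ∈ B → KernelDependsOn κ v (B ∪ C))
    (hκC : v ∈ C → KernelDependsOn κ v (A ∪ C) ∨ KernelDependsOn κ v (B ∪ C)) :
    ∃ TA TB : ((∀ i, Ω i) → ℝ≥0∞) → ((∀ i, Ω i) → ℝ≥0∞),
      (∀ f, IsLocal (A ∪ C) c S' f → IsLocal (A ∪ C) c S (TA f)) ∧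
      (∀ g, IsLocal (B ∪ C) c S' g → IsLocal (B ∪ C) c S (TB g)) ∧
      ∀ f g, IsLocal (A ∪ C) c S' f → IsLocal (B ∪ C) c S' g →
        resample κ v (fun ω => f ω * g ω) = fun ω => TA f ω * TB g ω := by
  by_cases h1 : v ∉ B ∧ KernelDependsOn κ v (A ∪ C)
  · refine ⟨resample κ v, fun g ω => g (Function.update ω v (c v)),
      fun f hf => hf.resample hS hv h1.2, fun g hg => hg.comp_update hS hv, fun f g hf hg => ?_⟩
    refine resample_mul hf.meas hg.dep fun h ω h0 => hf.supp ω h0 v (hSC ?_)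
    exact h.resolve_left h1.1
  by_cases h2 : v ∉ A ∧ KernelDependsOn κ v (B ∪ C)
  · refine ⟨fun g ω => g (Function.update ω v (c v)), resample κ v,
      fun f hf => hf.comp_update hS hv, fun g hg => hg.resample hS hv h2.2, fun f g hf hg => ?_⟩
    simp only [mul_comm (f _)]
    refine resample_mul hg.meas hf.dep fun h ω h0 => hg.supp ω h0 v (hSC ?_)
    exact h.resolve_left h2.1
  -- What remains is a node outside A, B and C. Neither factor sees it, and a Markov kernel
  -- integrates it out to 1.
  have hA : v ∉ A := fun h => h1 ⟨fun h' => Set.disjoint_left.1 hAB h h', hκA h⟩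
  have hB : v ∉ B := fun h => h2 ⟨hA, hκB h⟩
  have hC : v ∉ C := fun h => (hκC h).elim (fun h => h1 ⟨hB, h⟩) (fun h => h2 ⟨hA, h⟩)
  refine ⟨id, id, fun f hf => hf.mono hS, fun g hg => hg.mono hS, fun f g hf hg => ?_⟩
  refine resample_eq_self fun ω t => ?_
  rw [DependsOn.update_eq hf.dep (by simp [hA, hC]), DependsOn.update_eq hg.dep (by simp [hB, hC])]

/-- The Markov property: for every value of the coordinates in `C`, the coordinates in `A` and those
in `B` are conditionally independent. -/
theorem resampleList_mul_comm [∀ v, IsMarkovKernel (κ v)] (hAB : Disjoint A B)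
    (hκA : ∀ v ∈ A, KernelDependsOn κ v (A ∪ C)) (hκB : ∀ v ∈ B, KernelDependsOn κ v (B ∪ C))
    (hκC : ∀ v ∈ C, KernelDependsOn κ v (A ∪ C) ∨ KernelDependsOn κ v (B ∪ C))
    (l : List ι) (hl : l.Nodup) (f₁ f₂ g₁ g₂ : (∀ i, Ω i) → ℝ≥0∞)
    (hf₁ : IsLocal (A ∪ C) c (C ∩ {w | w ∈ l}) f₁) (hf₂ : IsLocal (A ∪ C) c (C ∩ {w | w ∈ l}) f₂)
    (hg₁ : IsLocal (B ∪ C) c (C ∩ {w | w ∈ l}) g₁) (hg₂ : IsLocal (B ∪ C) c (C ∩ {w | w ∈ l}) g₂)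
    (ω : ∀ i, Ω i) :
    resampleList κ l (fun ω => f₁ ω * g₁ ω) ω * resampleList κ l (fun ω => f₂ ω * g₂ ω) ω =
      resampleList κ l (fun ω => f₁ ω * g₂ ω) ω * resampleList κ l (fun ω => f₂ ω * g₁ ω) ω := by
  -- The last node of the list is integrated first. The crosswise products avoid dividing by the
  -- probability of the value on C, and reduce to commutativity when no node is left.
  induction l using List.reverseRecOn generalizing f₁ f₂ g₁ g₂ with
  | nil => simp only [resampleList_nil]; ring
  | append_singleton l v ih =>
    rw [List.nodup_append] at hl
    have hvl : v ∉ l := fun h => hl.2.2 v h v (by simp) rfl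
    obtain ⟨TA, TB, hTA, hTB, hT⟩ := exists_resample_mul (κ := κ) (c := c) (v := v) (A := A)
      (B := B) (C := C) (S := C ∩ {w | w ∈ l}) (S' := C ∩ {w | w ∈ l ++ [v]}) hAB
      (fun w hw => ⟨hw.1, List.mem_append_left _ hw.2⟩) (fun h => hvl h.2)
      (fun h => ⟨h, by simp⟩) (hκA v) (hκB v) (hκC v)
    simp only [resampleList_append, resampleList_cons, resampleList_nil]
    rw [hT _ _ hf₁ hg₁, hT _ _ hf₂ hg₂, hT _ _ hf₁ hg₂, hT _ _ hf₂ hg₁]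
    exact ih hl.1 _ _ _ _ (hTA _ hf₁) (hTA _ hf₂) (hTB _ hg₁) (hTB _ hg₂)

/-- The expectations of a function of coordinates for which two families of kernels agree. -/
lemma resampleList_congr_of_dependsOn [∀ v, IsMarkovKernel (κ v)] [∀ v, IsMarkovKernel (κ' v)]
    (hκ : ∀ v ∈ s, κ v = κ' v) (hs : ∀ v ∈ s, KernelDependsOn κ v s) (hF : DependsOn F s)
    (l : List ι) :
    resampleList κ l F = resampleList κ' l F ∧ DependsOn (resampleList κ l F) s := by
  induction l with
  | nil => exact ⟨rfl, hF⟩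
  | cons v l ih =>
    simp only [resampleList_cons]
    by_cases hv : v ∈ s
    · refine ⟨?_, DependsOn.resample ih.2 (hs v hv)⟩
      rw [ih.1]
      unfold resample
      rw [hκ v hv]
    · have h := DependsOn.update_eq ih.2 hv
      rw [resample_eq_self h, resample_eq_self (ih.1 ▸ h)]
      exact ih

/-- Replace the value of the coordinate `x` by `t` in the arguments of all kernels. -/
noncomputable def splitKernel (κ : ∀ v, Kernel (∀ i, Ω i) (Ω v)) (x : ι) (t : Ω x) (v : ι) :
    Kernel (∀ i, Ω i) (Ω v) :=
  (κ v).comap (fun ω => Function.update ω x t)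
    (measurable_update'.comp (measurable_id.prodMk measurable_const))

instance [∀ v, IsMarkovKernel (κ v)] (x : ι) (t : Ω x) (v : ι) :
    IsMarkovKernel (splitKernel κ x t v) := by
  unfold splitKernel; infer_instance

lemma splitKernel_apply (x : ι) (t : Ω x) (v : ι) (ω : ∀ i, Ω i) :
    splitKernel κ x t v ω = κ v (Function.update ω x t) := rfl

lemma resample_splitKernel_of_dependsOn {x : ι} {t : Ω x} (h : KernelDependsOn κ v {x}ᶜ) :
    resample (splitKernel κ x t) v F = resample κ v F := by
  ext ω
  unfold resample
  rw [splitKernel_apply, h (Function.update ω x t) ω fun i hi => Function.update_of_ne hi _ _]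

lemma resampleList_splitKernel_of_dependsOn {x : ι} {t : Ω x} {l : List ι}
    (h : ∀ v ∈ l, KernelDependsOn κ v {x}ᶜ) :
    resampleList (splitKernel κ x t) l F = resampleList κ l F := by
  induction l with
  | nil => rfl
  | cons v l ih =>
    simp only [resampleList_cons]
    rw [ih fun w hw => h w (List.mem_cons_of_mem _ hw),
      resample_splitKernel_of_dependsOn (h v List.mem_cons_self)]

/-- Where the coordinate `x` has the value `t`, the law of the split kernels is the original one. -/
lemma resampleList_splitKernel_of_supp {x : ι} {t : Ω x} {l₁ l₂ : List ι}
    (h₁ : ∀ v ∈ l₁, KernelDependsOn κ v {x}ᶜ) (hx : KernelDependsOn κ x {x}ᶜ) (h₂ : x ∉ l₂)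
    (hF : ∀ ω, F ω ≠ 0 → ω x = t) :
    resampleList (splitKernel κ x t) (l₁ ++ x :: l₂) F = resampleList κ (l₁ ++ x :: l₂) F := by
  -- The nodes after x leave x unchanged, so the partial integrals still vanish unless x has the
  -- value t, where splitting does nothing.
  have key : resampleList (splitKernel κ x t) l₂ F = resampleList κ l₂ F ∧
      ∀ ω, resampleList κ l₂ F ω ≠ 0 → ω x = t := by
    induction l₂ with
    | nil => exact ⟨rfl, hF⟩
    | cons v l ih =>
      have hv : x ≠ v := fun h => h₂ (by simp [h])
      obtain ⟨ih1, ih2⟩ := ih fun h => h₂ (List.mem_cons_of_mem _ h)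
      have hz : ∀ ω : ∀ i, Ω i, ω x ≠ t → ∀ u,
          resampleList κ l F (Function.update ω v u) = 0 := by
        intro ω hω u
        by_contra h0
        have := ih2 _ h0
        rw [Function.update_of_ne hv] at this
        exact hω this
      simp only [resampleList_cons]
      rw [ih1]
      constructor
      · ext ω
        by_cases hω : ω x = t
        · unfold resample
          rw [splitKernel_apply, ← hω, Function.update_eq_self]
        · simp [resample, hz ω hω]
      · intro ω h0
        by_contra hω
        exact h0 (by simp [resample, hz ω hω])
  simp only [resampleList_append, resampleList_cons]
  rw [key.1, resample_splitKernel_of_dependsOn hx, resampleList_splitKernel_of_dependsOn h₁]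

/-- Off the coordinate `x`, the law of the split kernels is that in which `x` is set to `t`. -/
lemma resampleList_splitKernel_of_forced [∀ v, IsMarkovKernel (κ v)] {x : ι} {t : Ω x}
    {l₁ l₂ : List ι} (h₁ : ∀ v ∈ l₁, KernelDependsOn κ v {x}ᶜ) (hx₁ : x ∉ l₁) (hx₂ : x ∉ l₂)
    (hκ : ∀ v, v ≠ x → κ' v = κ v) (hκx : ∀ ω, κ' x ω = Measure.dirac t) (hF : Measurable F)
    (hFx : DependsOn F {x}ᶜ) [∀ v, IsMarkovKernel (κ' v)] :
    resampleList (splitKernel κ x t) (l₁ ++ x :: l₂) F = resampleList κ' (l₁ ++ x :: l₂) F := by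
  -- The nodes after x see only t, so the partial integral of the split model is that of the forced
  -- model evaluated at x = t.
  have key : ∀ ω, resampleList (splitKernel κ x t) l₂ F ω =
      resampleList κ' l₂ F (Function.update ω x t) := by
    induction l₂ with
    | nil => intro ω; exact (DependsOn.update_eq hFx (by simp) ω t).symm
    | cons v l ih =>
      have hv : v ≠ x := fun h => hx₂ (by simp [h])
      intro ω
      simp only [resampleList_cons]
      unfold resample
      rw [splitKernel_apply, hκ v hv]
      congr 1
      ext u
      rw [ih (fun h => hx₂ (List.mem_cons_of_mem _ h)), Function.update_comm hv]
  have hcongr : ∀ G, resampleList κ' l₁ G = resampleList κ l₁ G := by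
    intro G
    induction l₁ with
    | nil => rfl
    | cons v l ih =>
      simp only [resampleList_cons]
      rw [ih (fun w hw => h₁ w (List.mem_cons_of_mem _ hw))
        (fun h => hx₁ (List.mem_cons_of_mem _ h))]
      unfold resample
      rw [hκ v fun h => hx₁ (by simp [h])]
  simp only [resampleList_append, resampleList_cons]
  rw [resampleList_splitKernel_of_dependsOn h₁, hcongr]
  congr 1
  -- This partial integral is constant in x, so sampling x has no effect. The Dirac kernel of `κ'`
  -- evaluates the other side at t.
  rw [resample_eq_self]
  · ext ω
    rw [key]
    have hm : Measurable (fun u => resampleList κ' l₂ F (Function.update ω x u)) :=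
      (measurable_resampleList hF l₂).comp (measurable_update ω)
    unfold resample
    rw [hκx, lintegral_dirac' _ hm]
  · intro ω u
    rw [key, key, Function.update_idem]

end Resample

/-! ### Interventional distributions of a causal model -/

section Model

open scoped ENNReal

variable {X U : Type} {H : U → Type} [∀ u, MeasurableSpace (H u)]

namespace CausalModel

variable (M : CausalModel X U H)

lemma lintegral_foldl_bind (a : Intervention X) (l : List (Node X U))
    (μ : Measure (∀ w : Node X U, Val H w)) {F : (∀ w : Node X U, Val H w) → ℝ≥0∞}
    (hF : Measurable F) :
    ∫⁻ ω, F ω ∂(l.foldl (fun μ v => μ.bind (M.stepKernel a v)) μ) =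
      ∫⁻ ω, resampleList (M.nodeKernel a) l F ω ∂μ := by
  classical
  induction l generalizing μ with
  | nil => rfl
  | cons v l ih =>
    rw [List.foldl_cons, ih, Measure.lintegral_bind (Kernel.aemeasurable _)
      (measurable_resampleList hF l).aemeasurable]
    congr 1
    ext ω
    have hm := measurable_resampleList (κ := M.nodeKernel a) hF l
    unfold stepKernel
    rw [Kernel.lintegral_map _ measurable_update' _ hm, Kernel.lintegral_prod]
    · simp only [Kernel.id_apply]
      rw [lintegral_dirac']
      · rfl
      · exact Measurable.lintegral_prod_right' (hm.comp measurable_update')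
    · exact hm.comp measurable_update'

lemma lintegral_law [∀ u, Nonempty (H u)] (a : Intervention X)
    {F : (∀ w : Node X U, Val H w) → ℝ≥0∞} (hF : Measurable F) :
    ∫⁻ ω, F ω ∂(M.law a) =
      resampleList (M.nodeKernel a) M.order F (fun _ => Classical.arbitrary _) := by
  rw [law, lintegral_foldl_bind M a _ _ hF, lintegral_dirac' _ (measurable_resampleList hF _)]

/-- Every edge strictly increases the index in the topological order. -/
lemma edge_acyclic (v w : Node X U) (h : M.edge v w) : ¬ Relation.ReflTransGen M.edge w v := by
  classical
  have key : ∀ v w, M.edge v w → M.order.idxOf v < M.order.idxOf w := by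
    intro v w h
    by_contra hle
    have hv := List.idxOf_lt_length_of_mem (M.mem_order v)
    have hw := List.idxOf_lt_length_of_mem (M.mem_order w)
    rcases (not_lt.1 hle).lt_or_eq with hlt | heq
    · have := List.pairwise_iff_getElem.1 M.order_edge _ _ hw hv hlt
      simp only [List.getElem_idxOf] at this
      exact this h
    · have := (List.idxOf_inj (M.mem_order w)).1 heq
      exact M.edge_irrefl v (this ▸ h)
  intro hr
  have : M.order.idxOf w ≤ M.order.idxOf v := by
    clear h
    induction hr with
    | refl => exact le_rfl
    | tail _ h ih => exact ih.trans (key _ _ h).le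
  exact absurd (key v w h) (not_lt.2 this)

lemma nodeKernel_eq_of_forced_eq {a a' : Intervention X} {v : Node X U}
    (h : forced H a v = forced H a' v) : M.nodeKernel a v = M.nodeKernel a' v := by
  unfold nodeKernel
  rw [h]

lemma kernelDependsOn_of_forced {a : Intervention X} {v : Node X U} {b : Val H v}
    (h : forced H a v = some b) (s : Set (Node X U)) : KernelDependsOn (M.nodeKernel a) v s := by
  intro ω ω' _
  unfold nodeKernel
  rw [h]
  simp

lemma kernelDependsOn_parents (a : Intervention X) {v : Node X U} {s : Set (Node X U)}
    (hs : ∀ p, M.edge p v → p ∈ s) : KernelDependsOn (M.nodeKernel a) v s := by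
  intro ω ω' h
  unfold nodeKernel
  split
  · simp
  · simp only [Kernel.comap_apply]
    congr 1
    ext p
    exact h _ (hs _ p.2)

/-- Nodes without intervened ancestors have the same joint distribution under two interventions. -/
lemma law_congr [∀ u, Nonempty (H u)] {a a' : Intervention X} {s : Set (Node X U)}
    (hs : ∀ v ∈ s, ∀ p, M.edge p v → p ∈ s) (ha : ∀ v ∈ s, forced H a v = forced H a' v)
    {S : Set (∀ w : Node X U, Val H w)} (hS : MeasurableSet S) (hdep : DependsOn (· ∈ S) s) :
    M.law a S = M.law a' S := by
  have hm : Measurable (S.indicator (1 : (∀ w : Node X U, Val H w) → ℝ≥0∞)) :=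
    measurable_one.indicator hS
  rw [← lintegral_indicator_one hS, ← lintegral_indicator_one hS, lintegral_law M a hm,
    lintegral_law M a' hm]
  refine congrFun (resampleList_congr_of_dependsOn (s := s)
    (fun v hv => M.nodeKernel_eq_of_forced_eq (ha v hv))
    (fun v hv => M.kernelDependsOn_parents a (hs v hv)) ?_ _).1 _
  intro ω ω' h
  have : ω ∈ S ↔ ω' ∈ S := iff_of_eq (hdep h)
  classical
  simp only [Set.indicator_apply, this]
  rfl

/-- Exchange of an action and an observation, on the values of all nodes. -/
lemma law_exchange [∀ u, Nonempty (H u)] {b b' : Intervention X} {x : X} {t : Bool}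
    (hb' : b' x = some t) (hbb' : ∀ y, y ≠ x → b' y = b y)
    {E : Node X U → Node X U → Prop} (hE : ∀ v w, E v w → M.edge v w)
    (hE' : ∀ v w, M.edge v w → v ≠ .obs x → (forced H b w).isNone → E v w)
    {C : Set (Node X U)} (hxC : Node.obs x ∉ C) (hyC : Node.reward ∉ C)
    (hsep : DSep E .reward (.obs x) C) {S : Set (∀ w : Node X U, Val H w)}
    (hS : MeasurableSet S) (c : ∀ w : Node X U, Val H w) (hSc : ∀ ω, ω ∈ S ↔ ∀ v ∈ C, ω v = c v) :
    M.law b' (S ∩ {ω | ω .reward = true}) * M.law b (S ∩ {ω | ω (.obs x) = t}) =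
      M.law b (S ∩ {ω | ω (.obs x) = t} ∩ {ω | ω .reward = true}) * M.law b' S := by
  classical
  obtain ⟨A, B, hxA, hyB, hAB, hA, hB, hC⟩ := exists_partition_of_dSep
    (fun v w h hr => M.edge_acyclic v w (hE v w h) (Relation.ReflTransGen.mono hE _ _ hr)) hxC hyC hsep
  have hxB : Node.obs x ∉ B := fun h => Set.disjoint_left.1 hAB hxA h
  have hyne : (Node.reward : Node X U) ≠ .obs x := by simp
  set κ := M.nodeKernel b
  -- In the split model no kernel depends on x and a forced node depends on nothing. So its kernels
  -- follow the smaller graph `E`, although those of the model follow `M.edge`.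
  have hdep : ∀ v (s : Set (Node X U)), (∀ p, E p v → p ∈ s) →
      KernelDependsOn (splitKernel κ (.obs x) t) v s := by
    intro v s hs ω ω' h
    rw [splitKernel_apply, splitKernel_apply]
    cases hf : forced H b v with
    | some u => exact M.kernelDependsOn_of_forced hf ∅ _ _ (by simp)
    | none =>
      refine M.kernelDependsOn_parents b (v := v) (s := {p | M.edge p v}) (fun p hp => hp) _ _ ?_
      intro p hp
      by_cases hpx : p = .obs x
      · subst hpx; simp
      · rw [Function.update_of_ne hpx, Function.update_of_ne hpx]
        exact h p (hs p (hE' p v hp hpx (by simp [hf])))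
  obtain ⟨l₁, l₂, hl⟩ := List.append_of_mem (M.mem_order (.obs x))
  have hnd := M.order_nodup
  have hoe := M.order_edge
  rw [hl, List.nodup_append, List.nodup_cons] at hnd
  rw [hl, List.pairwise_append] at hoe
  have hx₁ : Node.obs x ∉ l₁ := fun h => hnd.2.2 _ h _ List.mem_cons_self rfl
  have hpar₁ : ∀ v ∈ l₁, KernelDependsOn κ v {Node.obs x}ᶜ := fun v hv =>
    M.kernelDependsOn_parents b fun p hp h =>
      hoe.2.2 v hv _ List.mem_cons_self ((Set.mem_singleton_iff.1 h) ▸ hp)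
  have hparx : KernelDependsOn κ (.obs x) {Node.obs x}ᶜ :=
    M.kernelDependsOn_parents b fun p hp h => M.edge_irrefl _ ((Set.mem_singleton_iff.1 h) ▸ hp)
  have hforced : ∀ v, v ≠ .obs x → forced H b' v = forced H b v := by
    intro v hv
    cases v with
    | obs y => exact hbb' y fun h => hv (by rw [h])
    | reward => rfl
    | hidden u => rfl
  let ω₀ : ∀ w : Node X U, Val H w := fun _ => Classical.arbitrary _
  -- The law of the split model. `hnat` and `hdo` identify it with the laws under `b` and `b'` on
  -- the two kinds of events that occur.
  let I : Set (∀ w : Node X U, Val H w) → ℝ≥0∞ := fun S =>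
    resampleList (splitKernel κ (.obs x) t) M.order (S.indicator 1) ω₀
  have hm : ∀ {S : Set (∀ w : Node X U, Val H w)}, MeasurableSet S →
      Measurable (S.indicator (1 : (∀ w : Node X U, Val H w) → ℝ≥0∞)) :=
    fun hS => measurable_one.indicator hS
  have hnat : ∀ S : Set (∀ w : Node X U, Val H w), MeasurableSet S →
      (∀ ω ∈ S, ω (.obs x) = t) → M.law b S = I S := by
    intro S hS hSx
    rw [← lintegral_indicator_one hS, lintegral_law M b (hm hS)]
    simp only [I]
    rw [hl, resampleList_splitKernel_of_supp hpar₁ hparx hnd.2.1.1]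
    intro ω hω
    exact hSx ω (Set.mem_of_indicator_ne_zero hω)
  have hdo : ∀ S : Set (∀ w : Node X U, Val H w), MeasurableSet S →
      DependsOn (· ∈ S) {Node.obs x}ᶜ → M.law b' S = I S := by
    intro S hS hSx
    rw [← lintegral_indicator_one hS, lintegral_law M b' (hm hS)]
    simp only [I]
    rw [hl, resampleList_splitKernel_of_forced (κ' := M.nodeKernel b') hpar₁ hx₁ hnd.2.1.1
      (fun v hv => M.nodeKernel_eq_of_forced_eq (hforced v hv)) ?_ (hm hS)]
    · intro ω ω' h
      have := hSx h
      simp only [eq_iff_iff] at this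
      simp [Set.indicator_apply, this]
    · intro ω
      have : forced H b' (.obs x : Node X U) = some t := hb'
      unfold nodeKernel
      rw [this]
      simp
  have hXm : MeasurableSet {ω : ∀ w : Node X U, Val H w | ω (.obs x) = t} :=
    measurableSet_eq_fun (β := Bool) (measurable_pi_apply (Node.obs x)) measurable_const
  have hYm : MeasurableSet {ω : ∀ w : Node X U, Val H w | ω .reward = true} :=
    measurableSet_eq_fun (β := Bool) (measurable_pi_apply Node.reward) measurable_const
  have hSdep : DependsOn (· ∈ S) C := by
    intro ω ω' h
    simp only [eq_iff_iff, hSc]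
    exact forall₂_congr fun v hv => by rw [h v hv]
  have hSx : DependsOn (· ∈ S) {Node.obs x}ᶜ :=
    hSdep.mono fun v hv h => hxC ((Set.mem_singleton_iff.1 h) ▸ hv)
  have hSYx : DependsOn (· ∈ S ∩ {ω : ∀ w : Node X U, Val H w | ω .reward = true})
      {Node.obs x}ᶜ := by
    intro ω ω' h
    have h1 := hSx h
    have h2 := h .reward (by simp)
    simp only [eq_iff_iff] at h1
    simp only [Set.mem_inter_iff, Set.mem_ofPred_eq, h1, h2]
  have hloc : ∀ (s : Set (Node X U)) (S' : Set (∀ w : Node X U, Val H w)), MeasurableSet S' →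
      S' ⊆ S → DependsOn (· ∈ S') s →
      IsLocal s c (C ∩ {w | w ∈ M.order}) (S'.indicator (1 : (∀ w : Node X U, Val H w) → ℝ≥0∞)) := by
    intro s S' hS' hsub hd
    refine ⟨hm hS', ?_, ?_⟩
    · intro ω ω' h
      have := hd h
      simp only [eq_iff_iff] at this
      simp [Set.indicator_apply, this]
    · intro ω hω w hw
      exact (hSc ω).1 (hsub (Set.mem_of_indicator_ne_zero hω)) w hw.1
  have hdX : DependsOn (· ∈ S ∩ {ω : ∀ w : Node X U, Val H w | ω (.obs x) = t}) (A ∪ C) := by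
    intro ω ω' h
    have h1 := hSdep fun i hi => h i (Or.inr hi)
    have h2 := h (.obs x) (Or.inl hxA)
    simp only [eq_iff_iff] at h1
    simp only [Set.mem_inter_iff, Set.mem_ofPred_eq, h1, h2]
  have hdY : DependsOn (· ∈ S ∩ {ω : ∀ w : Node X U, Val H w | ω .reward = true}) (B ∪ C) := by
    intro ω ω' h
    have h1 := hSdep fun i hi => h i (Or.inr hi)
    have h2 := h .reward (Or.inl hyB)
    simp only [eq_iff_iff] at h1
    simp only [Set.mem_inter_iff, Set.mem_ofPred_eq, h1, h2]
  -- Conditional independence of x = t and Y = 1 given S, in the split model: I(S, x = t, Y = 1)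
  -- I(S) = I(S, x = t) I(S, Y = 1).
  have hcomm := resampleList_mul_comm (κ := splitKernel κ (.obs x) t) hAB
    (fun v hv => hdep v _ (hA v hv)) (fun v hv => hdep v _ (hB v hv))
    (fun v hv => (hC v hv).imp (hdep v _) (hdep v _)) M.order M.order_nodup
    _ _ _ _ (hloc _ _ (hS.inter hXm) Set.inter_subset_left hdX)
    (hloc _ S hS subset_rfl (hSdep.mono Set.subset_union_right))
    (hloc _ _ (hS.inter hYm) Set.inter_subset_left hdY)
    (hloc _ S hS subset_rfl (hSdep.mono Set.subset_union_right)) ω₀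
  have hmul : ∀ S₁ S₂ : Set (∀ w : Node X U, Val H w),
      (fun ω => S₁.indicator (1 : (∀ w : Node X U, Val H w) → ℝ≥0∞) ω * S₂.indicator (1 : (∀ w : Node X U, Val H w) → ℝ≥0∞) ω) =
        (S₁ ∩ S₂).indicator 1 := by
    intro S₁ S₂
    rw [Set.inter_indicator_one]; rfl
  simp only [hmul] at hcomm
  change I _ * I _ = I _ * I _ at hcomm
  have e1 : S ∩ {ω : ∀ w : Node X U, Val H w | ω (.obs x) = t} ∩
      (S ∩ {ω : ∀ w : Node X U, Val H w | ω .reward = true}) =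
      S ∩ {ω : ∀ w : Node X U, Val H w | ω (.obs x) = t} ∩ {ω | ω .reward = true} := by
    ext ω; simp only [Set.mem_inter_iff]; tauto
  have e2 : S ∩ {ω : ∀ w : Node X U, Val H w | ω (.obs x) = t} ∩ S =
      S ∩ {ω : ∀ w : Node X U, Val H w | ω (.obs x) = t} := by
    ext ω; simp only [Set.mem_inter_iff]; tauto
  have e3 : S ∩ (S ∩ {ω : ∀ w : Node X U, Val H w | ω .reward = true}) =
      S ∩ {ω : ∀ w : Node X U, Val H w | ω .reward = true} := by
    ext ω; simp only [Set.mem_inter_iff]; tauto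
  rw [e1, e2, e3, Set.inter_self] at hcomm
  rw [hnat _ (hS.inter hXm) (fun ω h => h.2), hnat _ ((hS.inter hXm).inter hYm) (fun ω h => h.1.2),
    hdo _ (hS.inter hYm) hSYx, hdo _ hS hSx, hcomm, mul_comm]

end CausalModel

end Model

/-! ### Identification of the expected reward by an admissible sequence -/

section Identification

set_option linter.unusedSectionVars false

open scoped ENNReal

variable {X U : Type} [Fintype X] [DecidableEq X] {H : U → Type} [∀ u, MeasurableSpace (H u)]
  [∀ u, Nonempty (H u)] {M : CausalModel X U H}

lemma measurableSet_obs (S : Set (Obs X)) : MeasurableSet S := S.toFinite.measurableSet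

lemma obsLaw_apply (a : Intervention X) (S : Set (Obs X)) :
    M.obsLaw a S = M.law a (CausalModel.observe ⁻¹' S) :=
  Measure.map_apply CausalModel.measurable_observe (measurableSet_obs S)

/-- The part of the intervention `a` on the variables listed in `l`. -/
def doOn (a : Intervention X) (l : AdmSeq X) : Intervention X :=
  fun x => if x ∈ l.map Prod.fst then a x else none

lemma doOn_nil (a : Intervention X) : doOn a [] = nullDo X := by
  ext x; simp [doOn, nullDo]

lemma IsAdmissible.doOn_self {a : Intervention X} {s : AdmSeq X} (h : IsAdmissible M a s) :
    doOn a s = a := by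
  funext x
  unfold doOn
  split_ifs with hx
  · rfl
  · rw [h.support x] at hx
    simpa using Eq.symm (by simpa using hx)

lemma mem_zUnion {s : AdmSeq X} {p : X × Finset X} (hp : p ∈ s) : p.2 ⊆ zUnion s := by
  induction s with
  | nil => simp at hp
  | cons q s ih =>
    change p.2 ⊆ q.2 ∪ zUnion s
    rcases List.mem_cons.1 hp with rfl | hp
    · exact Finset.subset_union_left
    · exact (ih hp).trans Finset.subset_union_right

lemma IsAdmissible.not_descendant {a : Intervention X} {s pre post : AdmSeq X}
    (h : IsAdmissible M a s) (hs : s = pre ++ post) {p q : X × Finset X} (hp : p ∈ pre)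
    (hq : q ∈ post) : ¬ Relation.ReflTransGen M.edge (.obs q.1) (.obs p.1) ∧
      ∀ z ∈ p.2, ¬ Relation.ReflTransGen M.edge (.obs q.1) (.obs z) := by
  constructor
  · have := h.topological
    rw [hs, List.pairwise_append] at this
    exact this.2.2 p hp q hq
  · intro z hz
    obtain ⟨l₁, l₂, rfl⟩ := List.append_of_mem hp
    exact h.nondescendant l₁ p.1 p.2 (l₂ ++ post) (by rw [hs]; simp) z hz q
      (List.mem_cons_of_mem _ (List.mem_append_right _ hq))

/-- Variables without intervened ancestors have their observational distribution. -/
lemma obsLaw_doOn_of_not_descendant (a : Intervention X) (l : AdmSeq X) (W : Set X)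
    (hW : ∀ w ∈ W, ∀ p ∈ l, ¬ Relation.ReflTransGen M.edge (.obs p.1) (.obs w))
    {E : Obs X → Prop} (hE : ∀ o o' : Obs X, (∀ w ∈ W, o.1 w = o'.1 w) → (E o ↔ E o')) :
    M.obsLaw (doOn a l) {o | E o} = M.obsLaw (nullDo X) {o | E o} := by
  rw [obsLaw_apply, obsLaw_apply]
  refine M.law_congr (s := {v | ∀ p ∈ l, ¬ Relation.ReflTransGen M.edge (.obs p.1) v}) ?_ ?_
    (CausalModel.measurable_observe (measurableSet_obs _)) ?_
  · intro v hv p hp q hq hr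
    exact hv q hq (hr.tail hp)
  · intro v hv
    cases v with
    | obs x =>
      change doOn a l x = none
      unfold doOn
      rw [if_neg]
      intro hx
      obtain ⟨p, hp, rfl⟩ := List.mem_map.1 hx
      exact hv p hp .refl
    | reward => rfl
    | hidden u => rfl
  · intro ω ω' h
    exact propext (hE _ _ fun w hw => h (.obs w) (hW w hw))

/-- Exchange of the action and the observation of one variable of an admissible sequence. -/
lemma IsAdmissible.obsLaw_exchange {a : Intervention X} {s pre post : AdmSeq X} {x : X}
    {Z : Finset X} (h : IsAdmissible M a s) (hs : s = pre ++ (x, Z) :: post) (z : ZVal s) {t : Bool}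
    (ht : a x = some t) :
    M.obsLaw (doOn a ((x, Z) :: post))
        {o | (histMatch a s z pre o ∧ zMatch s z Z o) ∧ o.2 = true} *
      M.obsLaw (doOn a post) {o | (histMatch a s z pre o ∧ zMatch s z Z o) ∧ o.1 x = t} =
    M.obsLaw (doOn a post)
        {o | ((histMatch a s z pre o ∧ zMatch s z Z o) ∧ o.1 x = t) ∧ o.2 = true} *
      M.obsLaw (doOn a ((x, Z) :: post)) {o | histMatch a s z pre o ∧ zMatch s z Z o} := by
  let C : Set (Node X U) :=
    {v | (∃ p ∈ pre, v = .obs p.1 ∨ ∃ z ∈ p.2, v = .obs z) ∨ ∃ z ∈ Z, v = .obs z}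
  let S : Set (∀ w : Node X U, Val H w) :=
    CausalModel.observe ⁻¹' {o | histMatch a s z pre o ∧ zMatch s z Z o}
  have hZ : Z ⊆ zUnion s := mem_zUnion (p := (x, Z)) (by rw [hs]; simp)
  have hpre : ∀ p ∈ pre, p.2 ⊆ zUnion s := fun p hp =>
    mem_zUnion (by rw [hs]; exact List.mem_append_left _ hp)
  have hSm : MeasurableSet S := CausalModel.measurable_observe (measurableSet_obs _)
  simp only [obsLaw_apply]
  -- `law_exchange` describes the event by a reference configuration. An empty event has none, but
  -- then both sides vanish. (A history is contradictory only through the type of `histMatch`, not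
  -- by assumption.)
  rcases S.eq_empty_or_nonempty with hS | ⟨c, hc⟩
  · have h1 : CausalModel.observe ⁻¹' {o | (histMatch a s z pre o ∧ zMatch s z Z o) ∧
        o.2 = true} ⊆ S := fun ω hω => hω.1
    rw [hS] at h1
    change _ = _ * M.law _ S
    rw [Set.subset_empty_iff.1 h1, hS]
    simp
  · have hSc : ∀ ω, ω ∈ S ↔ ∀ v ∈ C, ω v = c v := by
      intro ω
      constructor
      · rintro ⟨h1, h2⟩ v (⟨p, hp, rfl | ⟨y, hy, rfl⟩⟩ | ⟨y, hy, rfl⟩)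
        · have e1 := (h1 p hp).1
          have e2 := (hc.1 p hp).1
          rw [e1] at e2
          exact Option.some.inj e2
        · exact ((h1 p hp).2 y (hpre p hp hy) hy).trans ((hc.1 p hp).2 y (hpre p hp hy) hy).symm
        · exact (h2 y (hZ hy) hy).trans (hc.2 y (hZ hy) hy).symm
      · intro hω
        refine ⟨fun p hp => ⟨?_, fun y hyz hy => ?_⟩, fun y hyz hy => ?_⟩
        · refine (hc.1 p hp).1.trans (congrArg some ?_)
          exact (hω (.obs p.1) (Or.inl ⟨p, hp, Or.inl rfl⟩)).symm
        · exact (hω (.obs y) (Or.inl ⟨p, hp, Or.inr ⟨y, hy, rfl⟩⟩)).trans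
            ((hc.1 p hp).2 y hyz hy)
        · exact (hω (.obs y) (Or.inr ⟨y, hy, rfl⟩)).trans (hc.2 y hyz hy)
    have hxC : Node.obs x ∉ C := by
      rintro (⟨p, hp, hx | ⟨y, hy, hx⟩⟩ | ⟨y, hy, hx⟩)
      · have := (h.not_descendant hs hp List.mem_cons_self).1
        exact this (by rw [← hx])
      · have := (h.not_descendant hs hp List.mem_cons_self).2 y hy
        exact this (by rw [← hx])
      · have := h.nondescendant pre x Z post hs y hy (x, Z) List.mem_cons_self
        exact this (by rw [← hx])
    have hyC : Node.reward ∉ C := by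
      rintro (⟨p, hp, hx | ⟨y, hy, hx⟩⟩ | ⟨y, hy, hx⟩) <;> simp at hx
    have hforced : ∀ p ∈ post, (forced H (doOn a post) (.obs p.1 : Node X U)).isSome := by
      intro p hp
      change (doOn a post p.1).isSome
      unfold doOn
      rw [if_pos (List.mem_map_of_mem hp), ← h.support]
      exact List.mem_map_of_mem (by rw [hs]; simp [hp])
    exact M.law_exchange (b := doOn a post) (b' := doOn a ((x, Z) :: post)) (x := x) (t := t)
      (by simp [doOn, ht]) (fun y hy => by simp [doOn, hy])
      (E := mutilate M.edge x post) (fun v w hvw => hvw.1)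
      (fun v w hvw hv hw => ⟨hvw, hv, fun p hp hwp => by
        have := hforced p hp
        rw [← hwp] at this
        rw [Option.isNone_iff_eq_none] at hw
        simp [hw] at this⟩)
      hxC hyC (h.dsep pre x Z post hs) hSm c hSc

/-- The events whose probabilities appear in the identification formula. -/
lemma histMatch_congr {a : Intervention X} {s l : AdmSeq X} {z : ZVal s} (W : Set X)
    (hW : ∀ p ∈ l, p.1 ∈ W ∧ ∀ y ∈ p.2, y ∈ W) {o o' : Obs X} (h : ∀ w ∈ W, o.1 w = o'.1 w) :
    histMatch a s z l o ↔ histMatch a s z l o' := by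
  refine forall₂_congr fun p hp => ?_
  rw [h _ (hW p hp).1]
  refine and_congr_right fun _ => forall_congr' fun y => forall₂_congr fun _ hy => ?_
  rw [h _ ((hW p hp).2 y hy)]

variable (M) in
/-- The probability of the reward given the history of the first `i` variables, when the others are
set by the intervention. -/
noncomputable def condReward (a : Intervention X) (s : AdmSeq X) (i : ℕ) (z : ZVal s) : ℝ :=
  (M.obsLaw (doOn a (s.drop i))).real {o | histMatch a s z (s.take i) o ∧ o.2 = true} /
    (M.obsLaw (nullDo X)).real {o | histMatch a s z (s.take i) o}

/-- The history contains no descendant of a later variable of the sequence, so acting on the later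
variables does not change its probability. Hence the observational denominator in `condReward` is
also the interventional one. -/
lemma IsAdmissible.obsLaw_histMatch {a : Intervention X} {s : AdmSeq X} (h : IsAdmissible M a s)
    (i : ℕ) (z : ZVal s) :
    M.obsLaw (doOn a (s.drop i)) {o | histMatch a s z (s.take i) o} =
      M.obsLaw (nullDo X) {o | histMatch a s z (s.take i) o} := by
  refine obsLaw_doOn_of_not_descendant a _ {w | ∃ p ∈ s.take i, w = p.1 ∨ w ∈ p.2} ?_ ?_
  · rintro w ⟨p, hp, rfl | hw⟩ q hq
    · exact (h.not_descendant (List.take_append_drop i s).symm hp hq).1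
    · exact (h.not_descendant (List.take_append_drop i s).symm hp hq).2 w hw
  · intro o o' hoo
    exact histMatch_congr {w | ∃ p ∈ s.take i, w = p.1 ∨ w ∈ p.2} (fun p hp => ⟨⟨p, hp, Or.inl rfl⟩, fun y hy => ⟨p, hp, Or.inr hy⟩⟩) hoo

lemma IsAdmissible.obsLaw_histMatch_zMatch {a : Intervention X} {s : AdmSeq X}
    (h : IsAdmissible M a s) (i : Fin s.length) (z : ZVal s) :
    M.obsLaw (doOn a (s.drop i)) {o | histMatch a s z (s.take i) o ∧ zMatch s z (s.get i).2 o} =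
      M.obsLaw (nullDo X) {o | histMatch a s z (s.take i) o ∧ zMatch s z (s.get i).2 o} := by
  have hs : s = s.take i ++ ((s.get i).1, (s.get i).2) :: s.drop (i + 1) := by
    conv_lhs => rw [← List.take_append_drop i s, List.drop_eq_getElem_cons i.2]
    rfl
  have hd : s.drop i = ((s.get i).1, (s.get i).2) :: s.drop (i + 1) :=
    List.drop_eq_getElem_cons i.2
  refine obsLaw_doOn_of_not_descendant a _
    {w | (∃ p ∈ s.take i, w = p.1 ∨ w ∈ p.2) ∨ w ∈ (s.get i).2} ?_ ?_
  · rintro w (⟨p, hp, rfl | hw⟩ | hw) q hq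
    · exact (h.not_descendant (List.take_append_drop i s).symm hp hq).1
    · exact (h.not_descendant (List.take_append_drop i s).symm hp hq).2 w hw
    · rw [hd] at hq
      exact h.nondescendant _ _ _ _ hs w hw q hq
  · intro o o' hoo
    refine and_congr (histMatch_congr
      {w | (∃ p ∈ s.take i, w = p.1 ∨ w ∈ p.2) ∨ w ∈ (s.get i).2} (fun p hp => ⟨Or.inl ⟨p, hp, Or.inl rfl⟩,
      fun y hy => Or.inl ⟨p, hp, Or.inr hy⟩⟩) hoo) ?_
    refine forall_congr' fun y => forall₂_congr fun _ hy => ?_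
    rw [hoo y (Or.inr hy)]

lemma histMatch_take_succ {a : Intervention X} {s : AdmSeq X} {z : ZVal s} (i : Fin s.length)
    {o : Obs X} : histMatch a s z (s.take (i + 1)) o ↔
      (histMatch a s z (s.take i) o ∧ zMatch s z (s.get i).2 o) ∧
        a (s.get i).1 = some (o.1 (s.get i).1) := by
  unfold histMatch
  rw [List.take_succ_eq_append_getElem i.2]
  simp only [List.mem_append, List.mem_singleton, or_imp, forall_and, forall_eq, List.get_eq_getElem]
  tauto

/-- One step of the identification formula. -/
lemma IsAdmissible.condReward_succ_mul {a : Intervention X} {s : AdmSeq X} (h : IsAdmissible M a s)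
    (i : Fin s.length) (z : ZVal s)
    (hpos : (M.obsLaw (nullDo X)).real {o | histMatch a s z (s.take (i + 1)) o} ≠ 0) :
    condReward M a s (i + 1) z * (M.obsLaw (nullDo X)).real
        {o | histMatch a s z (s.take i) o ∧ zMatch s z (s.get i).2 o} =
      (M.obsLaw (doOn a (s.drop i))).real
        {o | (histMatch a s z (s.take i) o ∧ zMatch s z (s.get i).2 o) ∧ o.2 = true} := by
  have hs : s = s.take i ++ ((s.get i).1, (s.get i).2) :: s.drop (i + 1) := by
    conv_lhs => rw [← List.take_append_drop i s, List.drop_eq_getElem_cons i.2]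
    rfl
  have hd : s.drop i = ((s.get i).1, (s.get i).2) :: s.drop (i + 1) :=
    List.drop_eq_getElem_cons i.2
  obtain ⟨t, ht⟩ := Option.isSome_iff_exists.1
    ((h.support (s.get i).1).1 (List.mem_map_of_mem (s.get_mem i)))
  have hex := h.obsLaw_exchange hs z ht
  rw [← hd, h.obsLaw_histMatch_zMatch i z] at hex
  have e1 : {o | histMatch a s z (s.take (i + 1)) o} =
      {o | (histMatch a s z (s.take i) o ∧ zMatch s z (s.get i).2 o) ∧ o.1 (s.get i).1 = t} := by
    ext o
    simp only [Set.mem_ofPred_eq, histMatch_take_succ i, ht, Option.some.injEq]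
    rw [eq_comm (a := t)]
  have e2 : {o | histMatch a s z (s.take (i + 1)) o ∧ o.2 = true} =
      {o | ((histMatch a s z (s.take i) o ∧ zMatch s z (s.get i).2 o) ∧ o.1 (s.get i).1 = t) ∧
        o.2 = true} := by
    ext o
    have := Set.ext_iff.1 e1 o
    simp only [Set.mem_ofPred_eq] at this ⊢
    rw [this]
  rw [← e1, ← e2, h.obsLaw_histMatch] at hex
  unfold condReward
  rw [div_mul_eq_mul_div, div_eq_iff hpos]
  simp only [measureReal_def, ← ENNReal.toReal_mul]
  rw [hex]

end Identification

/-! ### Concentration -/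

section Concentration

open scoped ENNReal Classical

/-- Ville's inequality for products of independent variables with expectation at most one. -/
theorem measure_exists_le_prod_le {Ω : Type*} {mΩ : MeasurableSpace Ω} {μ : Measure Ω}
    [IsProbabilityMeasure μ] {Y : ℕ → Ω → ℝ≥0∞} (hY : ∀ n, Measurable (Y n)) (hind : iIndepFun Y μ)
    (hmean : ∀ n, ∫⁻ ω, Y n ω ∂μ ≤ 1) (K : ℝ≥0∞) :
    K * μ {ω | ∃ n, K ≤ ∏ j ∈ Finset.range n, Y j ω} ≤ 1 := by
  let hit : ℕ → Set Ω := fun n => {ω | ∃ m ≤ n, K ≤ ∏ j ∈ Finset.range m, Y j ω}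
  let R : ℕ → Ω → ℝ≥0∞ := fun n ω => if ω ∈ hit n then 0 else ∏ j ∈ Finset.range n, Y j ω
  let 𝒢 : ℕ → MeasurableSpace Ω := fun n =>
    ⨆ j ∈ Set.Iio n, MeasurableSpace.comap (Y j) inferInstance
  have h𝒢 : ∀ n, 𝒢 n ≤ mΩ := fun n => iSup₂_le fun j _ => (hY j).comap_le
  have hprod : ∀ n, ∀ m ≤ n, Measurable[𝒢 n] fun ω => ∏ j ∈ Finset.range m, Y j ω := by
    intro n m hm
    refine Finset.measurable_fun_prod _ fun j hj => ?_
    exact (comap_measurable (Y j)).mono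
      (le_iSup₂_of_le j (Set.mem_Iio.2 ((Finset.mem_range.1 hj).trans_le hm)) le_rfl) le_rfl
  have h_hit : ∀ n, MeasurableSet[𝒢 n] (hit n) := by
    intro n
    have : hit n = ⋃ m ∈ Set.Iic n, {ω | K ≤ ∏ j ∈ Finset.range m, Y j ω} := by
      ext ω; simp [hit]
    rw [this]
    refine MeasurableSet.biUnion (Set.to_countable _) fun m hm => ?_
    exact hprod n m hm measurableSet_Ici
  have hR : ∀ n, Measurable[𝒢 n] (R n) := fun n =>
    Measurable.ite (h_hit n) measurable_const (hprod n n le_rfl)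
  have hstep : ∀ n, ∫⁻ ω, R n ω * Y n ω ∂μ ≤ ∫⁻ ω, R n ω ∂μ := by
    intro n
    have hI : Indep (𝒢 n) (MeasurableSpace.comap (Y n) inferInstance) μ := by
      have := indep_iSup_of_disjoint (fun j => (hY j).comap_le)
        ((iIndepFun_iff_iIndep _ Y μ).1 hind) (S := Set.Iio n) (T := {n}) (by simp)
      rwa [iSup_singleton] at this
    rw [lintegral_mul_eq_lintegral_mul_lintegral_of_independent_measurableSpace (h𝒢 n)
      (hY n).comap_le hI (hR n) (comap_measurable _)]
    exact mul_le_of_le_one_right' (hmean n)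
  -- `R` is the product, killed once it has reached K. Pointwise K·1_{hit (n+1)} + R (n+1) ≤
  -- K·1_{hit n} + R n · Y n, so with `hstep` the left side does not increase in n.
  have hsub : ∀ n, K * μ (hit n) + ∫⁻ ω, R n ω ∂μ ≤ 1 := by
    intro n
    induction n with
    | zero =>
      by_cases hK : K ≤ 1
      · have h1 : hit 0 = Set.univ := by ext ω; simp [hit, hK]
        have h2 : R 0 = fun _ => 0 := by ext ω; simp [R, h1]
        simp [h1, h2, hK]
      · have h1 : hit 0 = ∅ := by ext ω; simp [hit, hK]
        have h2 : R 0 = fun _ => 1 := by ext ω; simp [R, h1]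
        simp [h1, h2]
    | succ n ih =>
      refine le_trans ?_ (le_trans (add_le_add_right (hstep n) _) ih)
      have hms : ∀ n, MeasurableSet (hit n) := fun n => h𝒢 n _ (h_hit n)
      rw [← lintegral_indicator_const (hms _), ← lintegral_indicator_const (hms _),
        ← lintegral_add_left (measurable_const.indicator (hms _)),
        ← lintegral_add_left (measurable_const.indicator (hms _))]
      refine lintegral_mono fun ω => ?_
      have hmono : ω ∈ hit n → ω ∈ hit (n + 1) := by
        rintro ⟨m, hm, h⟩; exact ⟨m, hm.trans n.le_succ, h⟩
      by_cases h1 : ω ∈ hit n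
      · simp [R, h1, hmono h1]
      · by_cases h2 : ω ∈ hit (n + 1)
        · simp only [R, h1, h2, Set.indicator_of_mem, Set.indicator_of_notMem, if_true, if_false,
            not_false_eq_true, add_zero, zero_add]
          obtain ⟨m, hm, h⟩ := h2
          rcases hm.lt_or_eq with hm | rfl
          · exact absurd ⟨m, Nat.lt_succ_iff.1 hm, h⟩ h1
          · rwa [Finset.prod_range_succ] at h
        · simp [R, h1, h2, Finset.prod_range_succ]
  have hU : {ω | ∃ n, K ≤ ∏ j ∈ Finset.range n, Y j ω} = ⋃ n, hit n := by
    ext ω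
    simp only [Set.mem_ofPred_eq, Set.mem_iUnion, hit]
    exact ⟨fun ⟨n, h⟩ => ⟨n, n, le_rfl, h⟩, fun ⟨n, m, _, h⟩ => ⟨m, h⟩⟩
  rw [hU, Monotone.measure_iUnion, ENNReal.mul_iSup]
  · exact iSup_le fun n => le_trans (le_add_right le_rfl) (hsub n)
  · rintro a b hab ω ⟨m, hm, h⟩
    exact ⟨m, hm.trans hab, h⟩

variable {X U : Type} [Fintype X] [DecidableEq X] {H : U → Type} [∀ u, MeasurableSpace (H u)]
  [∀ u, Nonempty (H u)]

set_option linter.unusedSectionVars false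

instance (M : CausalModel X U H) : IsProbabilityMeasure (playLaw M) := by
  unfold playLaw; infer_instance

/-- Ville's inequality for exponentials along a sequence of plays of the arm `a`. -/
lemma playLaw_exists_le_sum (M : CausalModel X U H) (a : Intervention X) {e : ℕ → ℕ}
    (he : Function.Injective e) (W : Obs X → ℝ) (hW : ∫ o, Real.exp (W o) ∂(M.obsLaw a) ≤ 1)
    (K : ℝ) :
    (playLaw M).real {ω | ∃ n, K ≤ ∑ j ∈ Finset.range n, W (ω (a, e j))} ≤ Real.exp (-K) := by
  have hWm : Measurable fun o => ENNReal.ofReal (Real.exp (W o)) := measurable_of_finite _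
  have hind : iIndepFun (fun j (ω : Outcomes X) => ENNReal.ofReal (Real.exp (W (ω (a, e j)))))
      (playLaw M) := by
    have h1 := iIndepFun_infinitePi (P := fun i : Intervention X × ℕ => M.obsLaw i.1)
      (X := fun _ o => ENNReal.ofReal (Real.exp (W o))) (fun _ => hWm)
    exact h1.precomp (g := fun j => (a, e j)) fun i j hij => he (Prod.ext_iff.1 hij).2
  have h := measure_exists_le_prod_le (μ := playLaw M)
    (Y := fun j ω => ENNReal.ofReal (Real.exp (W (ω (a, e j)))))
    (fun j => hWm.comp (measurable_pi_apply _)) hind ?_ (ENNReal.ofReal (Real.exp K))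
  · have hset : {ω : Outcomes X | ∃ n, K ≤ ∑ j ∈ Finset.range n, W (ω (a, e j))} =
        {ω | ∃ n, ENNReal.ofReal (Real.exp K) ≤
          ∏ j ∈ Finset.range n, ENNReal.ofReal (Real.exp (W (ω (a, e j))))} := by
      ext ω
      refine exists_congr fun n => ?_
      rw [← ENNReal.ofReal_prod_of_nonneg fun _ _ => (Real.exp_pos _).le, ← Real.exp_sum,
        ENNReal.ofReal_le_ofReal_iff (Real.exp_pos _).le, Real.exp_le_exp]
    rw [← hset] at h
    have h2 := ENNReal.toReal_mono ENNReal.one_ne_top h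
    rw [ENNReal.toReal_mul, ENNReal.toReal_ofReal (Real.exp_pos _).le, ENNReal.toReal_one] at h2
    rw [Real.exp_neg, ← one_div, le_div_iff₀ (Real.exp_pos _), mul_comm]
    exact h2
  · intro n
    have hmp := measurePreserving_eval_infinitePi
      (fun i : Intervention X × ℕ => M.obsLaw i.1) (a, e n)
    have := hmp.lintegral_comp hWm
    change ∫⁻ ω, _ ∂(playLaw M) = _ at this
    refine this.trans_le ?_
    rw [← ofReal_integral_eq_lintegral_ofReal Integrable.of_finite
      (Filter.Eventually.of_forall fun _ => (Real.exp_pos _).le)]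
    exact ENNReal.ofReal_le_one.2 hW

/-- Hoeffding's lemma on an event. -/
lemma integral_exp_ite_le_one {ν : Measure (Obs X)} [IsProbabilityMeasure ν] (Q : Obs X → Prop)
    {f : Obs X → ℝ} (hf : ∀ o, f o ∈ Set.Icc (0 : ℝ) 1) {v : ℝ}
    (hv : ∫ o in {o | Q o}, f o ∂ν = v * ν.real {o | Q o}) (t : ℝ) :
    ∫ o, Real.exp (if Q o then t * (f o - v) - t ^ 2 / 8 else 0) ∂ν ≤ 1 := by
  have hQm := measurableSet_obs {o : Obs X | Q o}
  rw [← integral_add_compl hQm Integrable.of_finite]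
  have h2 : ∫ o in {o | Q o}ᶜ, Real.exp (if Q o then t * (f o - v) - t ^ 2 / 8 else 0) ∂ν =
      ν.real {o | Q o}ᶜ := by
    rw [setIntegral_congr_fun (g := fun _ => (1 : ℝ)) hQm.compl]
    · simp
    · intro o ho
      have : ¬ Q o := ho
      simp [this]
  have h1 : ∫ o in {o | Q o}, Real.exp (if Q o then t * (f o - v) - t ^ 2 / 8 else 0) ∂ν ≤
      ν.real {o | Q o} := by
    -- On Q this is Hoeffding's lemma for the conditional law given Q, unless Q is null.
    by_cases h0 : ν {o | Q o} = 0
    · rw [Measure.restrict_eq_zero.2 h0]; simp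
    have hne : ν.real {o | Q o} ≠ 0 := (measureReal_ne_zero_iff (by simp)).2 h0
    have := cond_isProbabilityMeasure h0
    have hc : ∀ g : Obs X → ℝ, ∫ o, g o ∂ν[|{o | Q o}] =
        (ν.real {o | Q o})⁻¹ * ∫ o in {o | Q o}, g o ∂ν := by
      intro g
      rw [ProbabilityTheory.cond, integral_smul_measure, ENNReal.toReal_inv]
      rfl
    have hsub := hasSubgaussianMGF_of_mem_Icc (μ := ν[|{o | Q o}]) (X := f) (a := 0) (b := 1)
      (measurable_of_finite f).aemeasurable (Filter.Eventually.of_forall hf)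
    have hmean : ∫ o, f o ∂ν[|{o | Q o}] = v := by
      rw [hc, hv]; field_simp
    have h3 := hsub.mgf_le t
    rw [hmean, mgf, hc] at h3
    have e1 : ∫ o in {o | Q o}, Real.exp (if Q o then t * (f o - v) - t ^ 2 / 8 else 0) ∂ν =
        Real.exp (-(t ^ 2 / 8)) * ∫ o in {o | Q o}, Real.exp (t * (f o - v)) ∂ν := by
      rw [← integral_const_mul]
      refine setIntegral_congr_fun hQm fun o ho => ?_
      have : Q o := ho
      simp only [this, if_true]
      rw [← Real.exp_add]; congr 1; ring
    rw [e1]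
    have h4 : (((‖(1 : ℝ) - 0‖₊ / 2) ^ 2 : NNReal) : ℝ) * t ^ 2 / 2 = t ^ 2 / 8 := by
      simp; ring
    rw [h4, inv_mul_le_iff₀ (lt_of_le_of_ne measureReal_nonneg hne.symm)] at h3
    calc _ ≤ Real.exp (-(t ^ 2 / 8)) * (ν.real {o | Q o} * Real.exp (t ^ 2 / 8)) := by gcongr
      _ = ν.real {o | Q o} := by rw [mul_left_comm, ← Real.exp_add]; simp
  rw [h2]
  calc _ ≤ ν.real {o | Q o} + ν.real {o | Q o}ᶜ := by gcongr
    _ = 1 := by rw [measureReal_add_measureReal_compl hQm]; simp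

lemma countObs_eq_sum (O : ℕ → Obs X) (t : ℕ) (Q : Obs X → Prop) :
    (countObs O t Q : ℝ) = ∑ j ∈ Finset.range t, if Q (O j) then (1 : ℝ) else 0 := by
  unfold countObs
  rw [Finset.card_filter]
  push_cast
  rfl

/-- Hoeffding's inequality for the rounds in which `Q` holds, uniformly in their number. -/
theorem playLaw_hoeffding (M : CausalModel X U H) (a : Intervention X) {e : ℕ → ℕ}
    (he : Function.Injective e) (Q : Obs X → Prop) {f : Obs X → ℝ}
    (hf : ∀ o, f o ∈ Set.Icc (0 : ℝ) 1) {v : ℝ}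
    (hv : ∫ o in {o | Q o}, f o ∂(M.obsLaw a) = v * (M.obsLaw a).real {o | Q o}) {δ n₀ : ℝ}
    (hδ : 0 ≤ δ) :
    (playLaw M).real {ω | ∃ n, n₀ ≤ countObs (fun j => ω (a, e j)) n Q ∧
      δ * countObs (fun j => ω (a, e j)) n Q ≤
        ∑ j ∈ Finset.range n, if Q (ω (a, e j)) then f (ω (a, e j)) - v else 0} ≤
      Real.exp (-(2 * n₀ * δ ^ 2)) := by
  -- The parameter 4δ maximizes tδ - t²/8, with value 2δ² per round in which Q holds. A larger count
  -- only helps.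
  refine le_trans (measureReal_mono ?_ (by simp)) (playLaw_exists_le_sum M a he
    (fun o => if Q o then 4 * δ * (f o - v) - (4 * δ) ^ 2 / 8 else 0)
    (integral_exp_ite_le_one Q hf hv (4 * δ)) (2 * n₀ * δ ^ 2))
  rintro ω ⟨n, h1, h2⟩
  refine ⟨n, ?_⟩
  have e1 : ∑ j ∈ Finset.range n, (if Q (ω (a, e j)) then
        4 * δ * (f (ω (a, e j)) - v) - (4 * δ) ^ 2 / 8 else 0) =
      4 * δ * (∑ j ∈ Finset.range n, if Q (ω (a, e j)) then f (ω (a, e j)) - v else 0) -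
        2 * δ ^ 2 * countObs (fun j => ω (a, e j)) n Q := by
    rw [countObs_eq_sum, Finset.mul_sum, Finset.mul_sum, ← Finset.sum_sub_distrib]
    refine Finset.sum_congr rfl fun j _ => ?_
    split_ifs <;> ring
  rw [e1]
  nlinarith [mul_le_mul_of_nonneg_left h2 (by positivity : 0 ≤ 4 * δ),
    mul_le_mul_of_nonneg_left h1 (by positivity : 0 ≤ 2 * δ ^ 2)]

/-- A lower tail bound for the number of rounds in which `Q` holds. -/
theorem playLaw_countObs_le (M : CausalModel X U H) (a : Intervention X) {e : ℕ → ℕ}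
    (he : Function.Injective e) (Q : Obs X → Prop) {q : ℝ} (hq0 : 0 ≤ q)
    (hq : q ≤ (M.obsLaw a).real {o | Q o}) (t : ℕ) :
    (playLaw M).real {ω | (countObs (fun j => ω (a, e j)) t Q : ℝ) ≤ t * q / 2} ≤
      Real.exp (-(t * q / 8)) := by
  have hexp : Real.exp (-1) ≤ 3 / 8 := by
    have := Real.exp_neg_one_lt_d9; linarith
  -- For q ≤ P(Q), E exp(-1_Q) = 1 - r P(Q) ≤ exp(-rq). If the count is at most tq/2, the exponents
  -- sum to at least tq(r - 1/2), and r ≥ 5/8 leaves tq/8.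
  set r : ℝ := 1 - Real.exp (-1) with hr
  have hr0 : 0 ≤ r := by rw [hr]; linarith
  refine le_trans (measureReal_mono ?_ (by simp)) (playLaw_exists_le_sum M a he
    (fun o => (if Q o then -1 else 0) + q * r) ?_ (t * q / 8))
  · intro ω hω
    refine ⟨t, ?_⟩
    have hω' : (countObs (fun j => ω (a, e j)) t Q : ℝ) ≤ t * q / 2 := hω
    have e1 : ∑ j ∈ Finset.range t, ((if Q (ω (a, e j)) then -1 else 0) + q * r) =
        -(countObs (fun j => ω (a, e j)) t Q : ℝ) + t * (q * r) := by
      rw [countObs_eq_sum, Finset.sum_add_distrib, ← Finset.sum_neg_distrib]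
      simp only [Finset.sum_const, Finset.card_range, nsmul_eq_mul]
      congr 1
      refine Finset.sum_congr rfl fun j _ => ?_
      split_ifs <;> simp
    rw [e1]
    have : (t : ℝ) * q * (5 / 8) ≤ t * q * r := by
      apply mul_le_mul_of_nonneg_left _ (by positivity)
      rw [hr]; linarith
    linarith
  · have hQm := measurableSet_obs {o : Obs X | Q o}
    have e1 : ∀ o, Real.exp ((if Q o then -1 else 0) + q * r) =
        Real.exp (q * r) * (1 - r * {o | Q o}.indicator (fun _ => (1 : ℝ)) o) := by
      intro o
      rw [add_comm, Real.exp_add]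
      congr 1
      by_cases h : Q o
      · simp [h, hr]
      · simp [h]
    simp only [e1]
    rw [integral_const_mul, integral_sub (integrable_const _) Integrable.of_finite,
      integral_const_mul, integral_indicator_const _ hQm]
    simp only [integral_const, probReal_univ, smul_eq_mul, mul_one]
    calc _ ≤ Real.exp (q * r) * (1 - r * q) := by gcongr
      _ ≤ Real.exp (q * r) * Real.exp (-(r * q)) := by
        gcongr; linarith [Real.add_one_le_exp (-(r * q))]
      _ = 1 := by rw [← Real.exp_add]; simp [mul_comm]

end Concentration

/-! ### The plug-in estimate as an iterated average -/

section PlugIn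

open scoped Classical

set_option linter.unusedSectionVars false

variable {X : Type} [Fintype X] [DecidableEq X]

/-- The variables `Z₁ ∪ ⋯ ∪ Z_i`. -/
def zPrefix (s : AdmSeq X) (i : ℕ) : Finset X := zUnion (s.take i)

/-- The function `F` depends on the values of the variables in `P` only. -/
def ZDep {s : AdmSeq X} {β : Type*} (P : Finset X) (F : ZVal s → β) : Prop :=
  ∀ z z' : ZVal s, (∀ x, x.1 ∈ P → z x = z' x) → F z = F z'

/-- The observed value of the variables in `Z_a`. -/
def zOf (s : AdmSeq X) (o : Obs X) : ZVal s := fun x => o.1 x.1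

variable {a : Intervention X} {s : AdmSeq X} {z z' : ZVal s} {o : Obs X} {i : ℕ}

lemma mem_zUnion_iff {l : AdmSeq X} {x : X} : x ∈ zUnion l ↔ ∃ p ∈ l, x ∈ p.2 := by
  induction l with
  | nil => simp [zUnion]
  | cons q l ih =>
    change x ∈ q.2 ∪ zUnion l ↔ _
    simp [ih]

lemma zPrefix_subset (s : AdmSeq X) (i : ℕ) : zPrefix s i ⊆ zUnion s := by
  intro x hx
  obtain ⟨p, hp, hx⟩ := mem_zUnion_iff.1 hx
  exact mem_zUnion_iff.2 ⟨p, List.mem_of_mem_take hp, hx⟩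

lemma zPrefix_succ (i : Fin s.length) : zPrefix s (i + 1) = zPrefix s i ∪ (s.get i).2 := by
  ext x
  simp only [zPrefix, mem_zUnion_iff, Finset.mem_union, List.take_succ_eq_append_getElem i.2,
    List.mem_append, List.mem_singleton, or_and_right, exists_or, exists_eq_left,
    List.get_eq_getElem]

lemma zPrefix_length : zPrefix s s.length = zUnion s := by simp [zPrefix]

lemma zPrefix_mono_succ (i : Fin s.length) : zPrefix s i ⊆ zPrefix s (i + 1) := by
  rw [zPrefix_succ]; exact Finset.subset_union_left

lemma ZDep.mono {β : Type*} {P P' : Finset X} {F : ZVal s → β} (h : ZDep P F) (hP : P ⊆ P') :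
    ZDep P' F := fun z z' hz => h z z' fun x hx => hz x (hP hx)

lemma zMatch_iff {P : Finset X} : zMatch s z P o ↔ ∀ x, x.1 ∈ P → z x = zOf s o x :=
  ⟨fun h x hx => (h x.1 x.2 hx).symm, fun h x hx hP => (h ⟨x, hx⟩ hP).symm⟩

lemma zMatch_union {P P' : Finset X} :
    zMatch s z (P ∪ P') o ↔ zMatch s z P o ∧ zMatch s z P' o := by
  simp only [zMatch, Finset.mem_union, or_imp, forall_and]

/-- The event that the first `i` variables of the sequence have the values set by `a`. -/
def xMatch (a : Intervention X) (s : AdmSeq X) (i : ℕ) (o : Obs X) : Prop :=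
  ∀ p ∈ s.take i, a p.1 = some (o.1 p.1)

lemma histMatch_iff :
    histMatch a s z (s.take i) o ↔ xMatch a s i o ∧ zMatch s z (zPrefix s i) o := by
  constructor
  · intro h
    refine ⟨fun p hp => (h p hp).1, fun x hx hP => ?_⟩
    obtain ⟨p, hp, hxp⟩ := mem_zUnion_iff.1 hP
    exact (h p hp).2 x hx hxp
  · rintro ⟨h1, h2⟩ p hp
    exact ⟨h1 p hp, fun x hx hxp => h2 x hx (mem_zUnion_iff.2 ⟨p, hp, hxp⟩)⟩

lemma histMatch_and_zMatch_iff (i : Fin s.length) :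
    histMatch a s z (s.take i) o ∧ zMatch s z (s.get i).2 o ↔
      xMatch a s i o ∧ zMatch s z (zPrefix s (i + 1)) o := by
  rw [histMatch_iff, zPrefix_succ, zMatch_union, and_assoc]

lemma zDep_zMatch {P : Finset X} : ZDep P fun z : ZVal s => zMatch s z P := by
  intro z z' h
  ext o
  simp only [zMatch_iff]
  exact forall₂_congr fun x hx => by rw [h x hx]

lemma zDep_histMatch (a : Intervention X) (s : AdmSeq X) (i : ℕ) :
    ZDep (zPrefix s i) fun z : ZVal s => histMatch a s z (s.take i) := by
  intro z z' h
  ext o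
  have := congrFun (zDep_zMatch z z' h) o
  simp only [histMatch_iff, this]

lemma zDep_histMatch_and_zMatch (a : Intervention X) (i : Fin s.length) :
    ZDep (zPrefix s (i + 1))
      fun (z : ZVal s) o => histMatch a s z (s.take i) o ∧ zMatch s z (s.get i).2 o := by
  intro z z' h
  ext o
  have := congrFun (zDep_zMatch z z' h) o
  simp only [histMatch_and_zMatch_iff, this]

lemma card_filter_eq_on {P : Finset X} (hP : P ⊆ zUnion s) (w : ZVal s) :
    (Finset.univ.filter fun z : ZVal s => ∀ x, x.1 ∈ P → z x = w x).card =
      2 ^ ((zUnion s).card - P.card) := by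
  have h1 : (Finset.univ.filter fun z : ZVal s => ∀ x, x.1 ∈ P → z x = w x) =
      Fintype.piFinset fun x : {x // x ∈ zUnion s} => if x.1 ∈ P then {w x} else Finset.univ := by
    ext z
    simp only [Finset.mem_filter, Finset.mem_univ, true_and, Fintype.mem_piFinset]
    refine forall_congr' fun x => ?_
    by_cases h : x.1 ∈ P <;> simp [h]
  rw [h1, Fintype.card_piFinset]
  have h2 : ∀ x : {x // x ∈ zUnion s},
      (if x.1 ∈ P then ({w x} : Finset Bool) else Finset.univ).card =
        if x.1 ∈ P then 1 else 2 := by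
    intro x; by_cases h : x.1 ∈ P <;> simp [h]
  simp only [h2]
  rw [Finset.prod_coe_sort (zUnion s) (fun x => if x ∈ P then 1 else 2), Finset.prod_ite]
  simp only [Finset.prod_const_one, one_mul, Finset.prod_const]
  congr 1
  rw [← Finset.card_sdiff_of_subset hP]
  congr 1
  ext x; simp

/-- The weight by which sums over all `z` are sums over the values of the variables in `P`. -/
noncomputable def zWeight (s : AdmSeq X) (i : ℕ) : ℝ :=
  ((2 : ℝ) ^ ((zUnion s).card - (zPrefix s i).card))⁻¹

/-- The observation o fixes z on the prefix only. Its extensions to all of Z_a all give F the same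
value, and the weight divides by their number. This lets functions of every level share the type
`ZVal s`. -/
lemma zWeight_mul_sum {F : ZVal s → ℝ} (hF : ZDep (zPrefix s i) F) (o : Obs X) :
    zWeight s i * ∑ z : ZVal s, (if zMatch s z (zPrefix s i) o then F z else 0) = F (zOf s o) := by
  have h1 : ∀ z : ZVal s, (if zMatch s z (zPrefix s i) o then F z else 0) =
      if ∀ x, x.1 ∈ zPrefix s i → z x = zOf s o x then F (zOf s o) else 0 := by
    intro z
    simp only [zMatch_iff]
    split_ifs with h
    · exact hF _ _ h
    · rfl
  simp only [h1]
  rw [← Finset.sum_filter, Finset.sum_const, card_filter_eq_on (zPrefix_subset s i), nsmul_eq_mul,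
    ← mul_assoc, zWeight]
  push_cast
  rw [inv_mul_cancel₀ (by positivity), one_mul]

/-- The sum over the values of the next variables. -/
lemma zWeight_mul_sum_histMatch {G : ZVal s → ℝ} (i : Fin s.length)
    (hG : ZDep (zPrefix s (i + 1)) G) (z : ZVal s) (o : Obs X) :
    zWeight s (i + 1) * ∑ z' : ZVal s, (if ∀ x, x.1 ∈ zPrefix s i → z' x = z x then
      (if histMatch a s z' (s.take i) o ∧ zMatch s z' (s.get i).2 o then G z' else 0) else 0) =
      if histMatch a s z (s.take i) o then G (zOf s o) else 0 := by
  have hdep : ZDep (zPrefix s (i + 1))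
      fun z' : ZVal s => if ∀ x, x.1 ∈ zPrefix s i → z' x = z x then G z' else 0 := by
    intro z₁ z₂ h
    have h' : (∀ x, x.1 ∈ zPrefix s i → z₁ x = z x) ↔ ∀ x, x.1 ∈ zPrefix s i → z₂ x = z x :=
      forall₂_congr fun x hx => by rw [h x (zPrefix_mono_succ i hx)]
    simp only [h', hG z₁ z₂ h]
  have key := zWeight_mul_sum hdep o
  by_cases hx : xMatch a s i o
  · have e : (histMatch a s z (s.take i) o) ↔ ∀ x, x.1 ∈ zPrefix s i → zOf s o x = z x := by
      rw [histMatch_iff, zMatch_iff]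
      simp only [hx, true_and]
      exact forall₂_congr fun x _ => eq_comm
    simp only [e]
    rw [← key]
    congr 1
    refine Finset.sum_congr rfl fun z' _ => ?_
    simp only [histMatch_and_zMatch_iff, hx, true_and]
    split_ifs <;> rfl
  · simp [histMatch_iff, hx]

/-! ### Empirical averages along an admissible sequence -/

section Empirical

variable (O : ℕ → Obs X) (t : ℕ)

/-- The product of the first `i` empirical conditional frequencies. -/
noncomputable def pProd (a : Intervention X) (s : AdmSeq X) (i : ℕ) (z : ZVal s) : ℝ :=
  ∏ j ∈ Finset.range i, if h : j < s.length then pHat a s z ⟨j, h⟩ O t else 1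

/-- The average of `G` with respect to the first `i` empirical conditional frequencies. -/
noncomputable def zAvg (a : Intervention X) (s : AdmSeq X) (i : ℕ) (G : ZVal s → ℝ) : ℝ :=
  zWeight s i * ∑ z : ZVal s, pProd O t a s i z * G z

/-- The empirical mean of `g` over the rounds with history `z` up to `i`. -/
noncomputable def empMean (a : Intervention X) (s : AdmSeq X) (i : ℕ) (g : Obs X → ℝ)
    (z : ZVal s) : ℝ :=
  (∑ j ∈ Finset.range t, if histMatch a s z (s.take i) (O j) then g (O j) else 0) /
    countObs O t (histMatch a s z (s.take i))

variable {O t}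

lemma pProd_succ (i : Fin s.length) (z : ZVal s) :
    pProd O t a s (i + 1) z = pProd O t a s i z * pHat a s z i O t := by
  unfold pProd
  rw [Finset.prod_range_succ, dif_pos i.2]

lemma pProd_nonneg : 0 ≤ pProd O t a s i z := by
  refine Finset.prod_nonneg fun j _ => ?_
  split_ifs
  · unfold pHat; positivity
  · exact zero_le_one

lemma zDep_pProd (hi : i ≤ s.length) : ZDep (zPrefix s i) (pProd O t a s i) := by
  induction i with
  | zero => intro z z' _; simp [pProd]
  | succ i ih =>
    intro z z' h
    have hm := zPrefix_mono_succ (s := s) ⟨i, hi⟩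
    have e1 := ih (Nat.le_of_succ_le hi) z z' fun x hx => h x (hm hx)
    rw [pProd_succ ⟨i, hi⟩ z, pProd_succ ⟨i, hi⟩ z']
    simp only [e1]
    have e2 := zDep_histMatch a s i z z' fun x hx => h x (hm hx)
    have e3 := zDep_histMatch_and_zMatch a ⟨i, hi⟩ z z' h
    simp only [pHat]
    simp only at e2 e3
    rw [e3, e2]

lemma zAvg_mono {F G : ZVal s → ℝ} (h : ∀ z, F z ≤ G z) : zAvg O t a s i F ≤ zAvg O t a s i G := by
  unfold zAvg zWeight
  gcongr with z
  · exact pProd_nonneg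
  · exact h z

lemma zAvg_sub (F G : ZVal s → ℝ) :
    zAvg O t a s i F - zAvg O t a s i G = zAvg O t a s i fun z => F z - G z := by
  simp only [zAvg, ← mul_sub, ← Finset.sum_sub_distrib]

lemma zAvg_const_mul (c : ℝ) (G : ZVal s → ℝ) :
    zAvg O t a s i (fun z => c * G z) = c * zAvg O t a s i G := by
  simp only [zAvg, Finset.mul_sum]
  refine Finset.sum_congr rfl fun z _ => by ring

/-- The tower property of the empirical averages. -/
lemma zAvg_succ (i : Fin s.length) {G : ZVal s → ℝ} (hG : ZDep (zPrefix s (i + 1)) G) :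
    zAvg O t a s (i + 1) G =
      zAvg O t a s i (empMean O t a s i fun o => G (zOf s o)) := by
  -- Both sides become the sum over rounds j of β · G at the values observed in round j. The factor
  -- β collects the earlier frequencies and the denominator shared by `pHat` and `empMean`.
  set β : ZVal s → ℝ := fun z => pProd O t a s i z / countObs O t (histMatch a s z (s.take i))
    with hβ
  have hβd : ZDep (zPrefix s i) β := by
    intro z z' h
    have e := zDep_histMatch a s i z z' h
    simp only at e
    simp only [hβ]
    rw [e, zDep_pProd i.2.le z z' h]
  have hβG : ZDep (zPrefix s (i + 1)) fun z => β z * G z := by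
    intro z z' h
    simp only [hβd.mono (zPrefix_mono_succ i) z z' h, hG z z' h]
  have h1 : zAvg O t a s (i + 1) G = ∑ j ∈ Finset.range t,
      if xMatch a s i (O j) then β (zOf s (O j)) * G (zOf s (O j)) else 0 := by
    have e1 : ∀ z : ZVal s, pProd O t a s (i + 1) z * G z = ∑ j ∈ Finset.range t,
        if xMatch a s i (O j) then
          (if zMatch s z (zPrefix s (i + 1)) (O j) then β z * G z else 0) else 0 := by
      intro z
      rw [pProd_succ, pHat, countObs_eq_sum O t fun o => _ ∧ _]
      simp only [histMatch_and_zMatch_iff, ite_and]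
      rw [Finset.sum_div, Finset.mul_sum, Finset.sum_mul]
      refine Finset.sum_congr rfl fun j _ => ?_
      simp only [hβ]
      split_ifs <;> ring
    unfold zAvg
    simp only [e1]
    rw [Finset.sum_comm, Finset.mul_sum]
    refine Finset.sum_congr rfl fun j _ => ?_
    split_ifs with hx
    · exact zWeight_mul_sum hβG (O j)
    · simp
  have h2 : zAvg O t a s i (empMean O t a s i fun o => G (zOf s o)) = ∑ j ∈ Finset.range t,
      if xMatch a s i (O j) then β (zOf s (O j)) * G (zOf s (O j)) else 0 := by
    have e1 : ∀ z : ZVal s, pProd O t a s i z * empMean O t a s i (fun o => G (zOf s o)) z =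
        ∑ j ∈ Finset.range t, if xMatch a s i (O j) then
          (if zMatch s z (zPrefix s i) (O j) then β z else 0) * G (zOf s (O j)) else 0 := by
      intro z
      unfold empMean
      simp only [histMatch_iff (i := i), ite_and]
      rw [Finset.sum_div, Finset.mul_sum]
      refine Finset.sum_congr rfl fun j _ => ?_
      simp only [hβ]
      split_ifs <;> ring
    unfold zAvg
    simp only [e1]
    rw [Finset.sum_comm, Finset.mul_sum]
    refine Finset.sum_congr rfl fun j _ => ?_
    split_ifs with hx
    · rw [← Finset.sum_mul, ← mul_assoc, zWeight_mul_sum hβd]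
    · simp
  rw [h1, h2]

lemma zAvg_zero (c : ℝ) : zAvg O t a s 0 (fun _ => c) = c := by
  have : zPrefix s 0 = ∅ := by simp [zPrefix, zUnion]
  simp [zAvg, zWeight, this, pProd]

/-- The empirical weights have total mass one only if no history is empty, because of the convention
0/0 = 0. -/
lemma zAvg_one (hi : i ≤ s.length)
    (hpos : ∀ j ≤ s.length, ∀ z : ZVal s, countObs O t (histMatch a s z (s.take j)) ≠ 0) :
    zAvg O t a s i (fun _ => 1) = 1 := by
  induction i with
  | zero => exact zAvg_zero 1
  | succ i ih =>
    have hi' : i ≤ s.length := Nat.le_of_succ_le hi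
    have := zAvg_succ (O := O) (t := t) (a := a) ⟨i, hi⟩ (G := fun _ => 1) (fun _ _ _ => rfl)
    simp only at this
    rw [this]
    refine Eq.trans (congrArg (zAvg O t a s i) ?_) (ih hi')
    ext z
    unfold empMean
    rw [← countObs_eq_sum, div_self]
    exact_mod_cast hpos i hi' z

/-- Puts the estimate at the end of the chain of empirical averages, where the telescoping starts.
-/
lemma muObs_some : muObs a O t (some s) =
    zAvg O t a s s.length (empMean O t a s s.length fun o => if o.2 = true then 1 else 0) := by
  unfold muObs zAvg zWeight
  rw [zPrefix_length]
  simp only [Nat.sub_self, pow_zero, inv_one, one_mul]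
  refine Finset.sum_congr rfl fun z _ => ?_
  rw [mul_comm]
  congr 1
  · unfold pProd
    rw [Finset.prod_range]
    refine Finset.prod_congr rfl fun j _ => ?_
    rw [dif_pos j.2]
  · unfold rHat empMean
    rw [List.take_length, countObs_eq_sum O t fun o => _ ∧ _]
    congr 1
    refine Finset.sum_congr rfl fun j _ => ?_
    by_cases h1 : histMatch a s z s (O j) <;> by_cases h2 : (O j).2 = true <;> simp [h1, h2]

lemma tObs_le (z : ZVal s) : tObs a O t (some s) ≤ countObs O t (histMatch a s z s) :=
  ciInf_le' _ z

/-- A history of length `i` has been observed at least `2 ^ (|Z_a| - |Z₁ ∪ ⋯ ∪ Z_i|) T_a` times. -/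
lemma pow_mul_tObs_le (i : ℕ) (z : ZVal s) :
    2 ^ ((zUnion s).card - (zPrefix s i).card) * tObs a O t (some s) ≤
      countObs O t (histMatch a s z (s.take i)) := by
  -- Each full value z' extending the prefix of z is seen at least T_a times, and different z' are
  -- seen in different rounds.
  rw [← card_filter_eq_on (zPrefix_subset s i) z, ← smul_eq_mul, ← Finset.sum_const]
  refine le_trans (Finset.sum_le_sum fun z' _ => tObs_le z') ?_
  unfold countObs
  rw [← Finset.card_biUnion]
  · refine Finset.card_le_card fun j hj => ?_
    simp only [Finset.mem_biUnion, Finset.mem_filter, Finset.mem_univ, true_and] at hj ⊢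
    obtain ⟨z', hz', hj, hm⟩ := hj
    refine ⟨hj, ?_⟩
    have e := zDep_histMatch a s i z' z hz'
    simp only at e
    rw [← e]
    exact fun p hp => hm p (List.mem_of_mem_take hp)
  · intro z₁ _ z₂ _ hne
    rw [Function.onFun, Finset.disjoint_left]
    intro j h1 h2
    apply hne
    simp only [Finset.mem_filter] at h1 h2
    have h1' : histMatch a s z₁ (s.take s.length) (O j) := by rw [List.take_length]; exact h1.2
    have h2' : histMatch a s z₂ (s.take s.length) (O j) := by rw [List.take_length]; exact h2.2
    rw [histMatch_iff, zPrefix_length, zMatch_iff] at h1' h2'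
    ext x
    rw [h1'.2 x x.2, h2'.2 x x.2]

end Empirical

end PlugIn

/-! ### Deviations of the observational estimate -/

section Deviation

open scoped Classical

set_option linter.unusedSectionVars false

variable {X U : Type} [Fintype X] [DecidableEq X] {H : U → Type} [∀ u, MeasurableSpace (H u)]
  [∀ u, Nonempty (H u)] {M : CausalModel X U H} {a : Intervention X} {s : AdmSeq X}

lemma integral_ite_eq_setIntegral (ν : Measure (Obs X)) (Q : Obs X → Prop)
    [DecidablePred Q] (f : Obs X → ℝ) :
    ∫ o, (if Q o then f o else 0) ∂ν = ∫ o in {o | Q o}, f o ∂ν := by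
  rw [← integral_indicator (measurableSet_obs _)]
  congr 1
  ext o
  by_cases h : Q o <;> simp [h]

lemma integral_ite_const (ν : Measure (Obs X)) [IsFiniteMeasure ν] (Q : Obs X → Prop)
    [DecidablePred Q] (c : ℝ) :
    ∫ o, (if Q o then c else 0) ∂ν = c * ν.real {o | Q o} := by
  rw [integral_ite_eq_setIntegral ν Q fun _ => c, setIntegral_const, smul_eq_mul, mul_comm]

/-- The counterpart of the empirical sum for a measure. The measure is arbitrary so that it can also
be the interventional law restricted to Y = 1. -/
lemma zWeight_mul_sum_measureReal (ν : Measure (Obs X)) [IsFiniteMeasure ν] {G : ZVal s → ℝ}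
    (i : Fin s.length) (hG : ZDep (zPrefix s (i + 1)) G) (z : ZVal s) :
    zWeight s (i + 1) * ∑ z' : ZVal s, (if ∀ x, x.1 ∈ zPrefix s i → z' x = z x then
      G z' * ν.real {o | histMatch a s z' (s.take i) o ∧ zMatch s z' (s.get i).2 o} else 0) =
      ∫ o in {o | histMatch a s z (s.take i) o}, G (zOf s o) ∂ν := by
  rw [← integral_ite_eq_setIntegral]
  simp only [← zWeight_mul_sum_histMatch i hG z]
  rw [integral_const_mul, integral_finsetSum _ fun _ _ => Integrable.of_finite]
  congr 1
  refine Finset.sum_congr rfl fun z' _ => ?_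
  split_ifs
  · rw [integral_ite_const]
  · simp

/-- The probability that the reward is one is the mean. -/
lemma mean_eq_measureReal (a : Intervention X) :
    mean M a = (M.obsLaw a).real {o | o.2 = true} := by
  unfold mean rewardOf
  rw [integral_ite_const (M.obsLaw a) (fun o => o.2 = true) 1, one_mul]

lemma zDep_condReward (i : ℕ) : ZDep (zPrefix s i) (condReward M a s i) := by
  intro z z' h
  have e := zDep_histMatch a s i z z' h
  simp only at e
  unfold condReward
  rw [e]

lemma IsAdmissible.condReward_zero (h : IsAdmissible M a s) (z : ZVal s) :
    condReward M a s 0 z = mean M a := by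
  unfold condReward
  simp [histMatch, h.doOn_self, mean_eq_measureReal]

lemma IsAdmissible.condReward_mem_Icc (h : IsAdmissible M a s) (i : ℕ) (z : ZVal s) :
    condReward M a s i z ∈ Set.Icc (0 : ℝ) 1 := by
  unfold condReward
  constructor
  · positivity
  · refine div_le_one_of_le₀ ?_ measureReal_nonneg
    rw [measureReal_def, measureReal_def, ← h.obsLaw_histMatch i z]
    exact ENNReal.toReal_mono (by simp) (measure_mono fun o ho => ho.1)

/-- A null history causes no exception: the interventional numerator is bounded by the probability
of the history, so it vanishes too. -/
lemma condReward_mul (h : IsAdmissible M a s) (i : ℕ) (z : ZVal s) :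
    condReward M a s i z * (M.obsLaw (nullDo X)).real {o | histMatch a s z (s.take i) o} =
      (M.obsLaw (doOn a (s.drop i))).real {o | histMatch a s z (s.take i) o ∧ o.2 = true} := by
  unfold condReward
  by_cases h0 : (M.obsLaw (nullDo X)).real {o | histMatch a s z (s.take i) o} = 0
  · rw [h0, mul_zero]
    refine (le_antisymm ?_ measureReal_nonneg).symm
    rw [← h0, measureReal_def, measureReal_def, ← h.obsLaw_histMatch i z]
    exact ENNReal.toReal_mono (by simp) (measure_mono fun o ho => ho.1)
  · rw [div_mul_cancel₀ _ h0]

/-- The conditional rewards form a martingale along the sequence. -/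
lemma IsAdmissible.setIntegral_condReward (h : IsAdmissible M a s)
    (hpos : ∀ i, ∀ z : ZVal s,
      (M.obsLaw (nullDo X)).real {o | histMatch a s z (s.take i) o} ≠ 0)
    (i : Fin s.length) (z : ZVal s) :
    ∫ o in {o | histMatch a s z (s.take i) o}, condReward M a s (i + 1) (zOf s o)
        ∂(M.obsLaw (nullDo X)) =
      condReward M a s i z * (M.obsLaw (nullDo X)).real {o | histMatch a s z (s.take i) o} := by
  rw [← zWeight_mul_sum_measureReal _ i (zDep_condReward _), condReward_mul h]
  simp only [h.condReward_succ_mul i _ (hpos _ _)]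
  -- After the exchange at each z, summing over the next Z only marginalizes it under the
  -- intervention, jointly with Y = 1.
  have key := zWeight_mul_sum_measureReal (a := a)
    ((M.obsLaw (doOn a (s.drop i))).restrict {o | o.2 = true}) i (G := fun _ => 1)
    (fun _ _ _ => rfl) z
  simp only [measureReal_restrict_apply (measurableSet_obs _), one_mul] at key
  refine key.trans ?_
  rw [setIntegral_const, smul_eq_mul, mul_one, measureReal_restrict_apply (measurableSet_obs _)]
  rfl

/-- Deviation of the empirical means given the histories of length `i`. -/
lemma playLaw_exists_history_le {i : ℕ} (f : Obs X → ℝ) (hf : ∀ o, f o ∈ Set.Icc (0 : ℝ) 1)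
    {v : ZVal s → ℝ} (hvd : ZDep (zPrefix s i) v)
    (hv : ∀ z, ∫ o in {o | histMatch a s z (s.take i) o}, f o ∂(M.obsLaw (nullDo X)) =
      v z * (M.obsLaw (nullDo X)).real {o | histMatch a s z (s.take i) o})
    {σ : ℝ} (hσ : σ = 1 ∨ σ = -1) {d n₀ : ℝ} (hd : 0 ≤ d) (hn₀ : 0 < n₀) (t : ℕ) :
    (playLaw M).real {ω | ∃ z : ZVal s,
      n₀ ≤ countObs (observations ω) t (histMatch a s z (s.take i)) ∧
      d ≤ σ * (empMean (observations ω) t a s i f z - v z)} ≤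
      2 ^ (zPrefix s i).card * Real.exp (-(2 * n₀ * d ^ 2)) := by
  -- The event depends on z through the prefix only, so the union bound runs over the z that are
  -- `false` elsewhere.
  have hcard : (Finset.univ.filter fun z : ZVal s =>
      ∀ x, x.1 ∈ zUnion s \ zPrefix s i → z x = false).card = 2 ^ (zPrefix s i).card := by
    rw [card_filter_eq_on Finset.sdiff_subset fun _ => false,
      Finset.card_sdiff_of_subset (zPrefix_subset s i)]
    have := Finset.card_le_card (zPrefix_subset s i)
    congr 1; omega
  -- For σ = -1 the function is reflected to 1 - f, which keeps it in [0, 1] and makes the upper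
  -- tail bound serve both signs.
  let f' : Obs X → ℝ := fun o => if σ = 1 then f o else 1 - f o
  let v' : ZVal s → ℝ := fun z => if σ = 1 then v z else 1 - v z
  have hf' : ∀ o, f' o ∈ Set.Icc (0 : ℝ) 1 := by
    intro o
    have := hf o
    simp only [f', Set.mem_Icc] at this ⊢
    split_ifs <;> constructor <;> linarith
  have hfv : ∀ o z, f' o - v' z = σ * (f o - v z) := by
    intro o z
    rcases hσ with rfl | rfl
    · simp [f', v']
    · norm_num [f', v']
  have hv' : ∀ z, ∫ o in {o | histMatch a s z (s.take i) o}, f' o ∂(M.obsLaw (nullDo X)) =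
      v' z * (M.obsLaw (nullDo X)).real {o | histMatch a s z (s.take i) o} := by
    intro z
    simp only [f', v']
    split_ifs
    · exact hv z
    · rw [integral_sub (integrable_const _) Integrable.of_finite, hv z, setIntegral_const]
      simp; ring
  have hB := fun z : ZVal s => playLaw_hoeffding M (nullDo X) (e := id) Function.injective_id
    (histMatch a s z (s.take i)) hf' (hv' z) (δ := d) (n₀ := n₀) hd
  have hcardR := congrArg (Nat.cast (R := ℝ)) hcard.symm
  rw [Nat.cast_pow, Nat.cast_ofNat] at hcardR
  rw [hcardR, ← nsmul_eq_mul, ← Finset.sum_const]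
  refine le_trans (measureReal_mono ?_ (by simp)) (le_trans
    (measureReal_biUnion_finset_le _ _) (Finset.sum_le_sum fun z _ => hB z))
  rintro ω ⟨z, h1, h2⟩
  let z₀ : ZVal s := fun x => if x.1 ∈ zPrefix s i then z x else false
  have hz : ∀ x : {x // x ∈ zUnion s}, x.1 ∈ zPrefix s i → z x = z₀ x := by
    intro x hx; simp [z₀, hx]
  have e := zDep_histMatch a s i z z₀ hz
  simp only at e
  simp only [Set.mem_iUnion, Set.mem_ofPred_eq, Finset.mem_filter, Finset.mem_univ, true_and]
  refine ⟨z₀, ?_, t, ?_, ?_⟩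
  · intro x hx
    simp [z₀, (Finset.mem_sdiff.1 hx).2]
  · rw [← e]; exact h1
  · unfold empMean at h2
    rw [hvd z z₀ hz, e] at h2
    have hpos : (0 : ℝ) < countObs (observations ω) t (histMatch a s z₀ (s.take i)) := by
      rw [← e]; exact hn₀.trans_le h1
    have h3 := mul_le_mul_of_nonneg_right h2 hpos.le
    rw [mul_assoc, sub_mul, div_mul_cancel₀ _ hpos.ne'] at h3
    refine h3.trans (le_of_eq ?_)
    rw [countObs_eq_sum, Finset.mul_sum _ _ (v z₀), ← Finset.sum_sub_distrib, Finset.mul_sum]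
    refine Finset.sum_congr rfl fun j _ => ?_
    change σ * ((if histMatch a s z₀ (s.take i) (observations ω j) then _ else _) - _) =
      if histMatch a s z₀ (s.take i) (observations ω j) then f' (observations ω j) - _ else 0
    split_ifs
    · rw [hfv]; ring
    · ring

/-- Deviation up to the `i`-th variable of the sequence. -/
lemma IsAdmissible.exists_bad_set (h : IsAdmissible M a s)
    (hpos : ∀ i, ∀ z : ZVal s,
      (M.obsLaw (nullDo X)).real {o | histMatch a s z (s.take i) o} ≠ 0)
    {σ : ℝ} (hσ : σ = 1 ∨ σ = -1) {δ τ : ℝ} (hδ : 0 ≤ δ) (hτ : 0 < τ) (t : ℕ) (i : ℕ)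
    (hi : i ≤ s.length) :
    ∃ B : Set (Outcomes X),
      (playLaw M).real B ≤ (2 ^ (zPrefix s i).card - 1) * Real.exp (-(2 * τ * δ ^ 2)) ∧
      ∀ ω ∉ B, τ ≤ tObs a (observations ω) t (some s) →
        σ * (zAvg (observations ω) t a s i (condReward M a s i) - mean M a) ≤
          δ * ∑ p ∈ Finset.range (zPrefix s i).card, (5 / 7 : ℝ) ^ ((zUnion s).card - p) := by
  induction i with
  | zero =>
    have h0 : zPrefix s 0 = ∅ := by simp [zPrefix, zUnion]
    refine ⟨∅, by simp [h0], fun ω _ _ => ?_⟩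
    have : condReward M a s 0 = fun _ => mean M a := by
      ext z; exact h.condReward_zero z
    rw [this, zAvg_zero]
    simp [h0]
  | succ i ih =>
    obtain ⟨B, hB, hdev⟩ := ih (Nat.le_of_succ_le hi)
    have hcnt : ∀ ω : Outcomes X, τ ≤ tObs a (observations ω) t (some s) →
        ∀ (j : ℕ) (z : ZVal s), 2 ^ ((zUnion s).card - (zPrefix s j).card) * τ ≤
          countObs (observations ω) t (histMatch a s z (s.take j)) := by
      intro ω hω j z
      have h2 := pow_mul_tObs_le (a := a) (O := observations ω) (t := t) j z
      have h3 : ((2 ^ ((zUnion s).card - (zPrefix s j).card) *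
        tObs a (observations ω) t (some s) : ℕ) : ℝ) ≤
          countObs (observations ω) t (histMatch a s z (s.take j)) := by exact_mod_cast h2
      refine le_trans ?_ h3
      push_cast
      gcongr
    have hcnt' : ∀ ω : Outcomes X, τ ≤ tObs a (observations ω) t (some s) →
        ∀ (j : ℕ) (z : ZVal s), countObs (observations ω) t (histMatch a s z (s.take j)) ≠ 0 := by
      intro ω hω j z h0
      have := hcnt ω hω j z
      rw [h0] at this
      have h2 : (0 : ℝ) < 2 ^ ((zUnion s).card - (zPrefix s j).card) * τ := by positivity
      push_cast at this
      linarith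
    have hint := h.setIntegral_condReward hpos ⟨i, hi⟩
    simp only at hint
    -- If no new variable enters Z, the next V equals the present one exactly, so the level costs
    -- neither deviation nor probability. This is needed because both bounds count variables, not
    -- levels.
    by_cases hP : zPrefix s (i + 1) = zPrefix s i
    · refine ⟨B, by rwa [hP], fun ω hω hτω => ?_⟩
      have hV : condReward M a s i = condReward M a s (i + 1) := by
        ext z
        refine (mul_right_cancel₀ (hpos i z) ?_).symm
        rw [← hint z]
        rw [setIntegral_congr_fun (g := fun _ => condReward M a s (i + 1) z)
          (measurableSet_obs _), setIntegral_const, smul_eq_mul, mul_comm]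
        intro o ho
        refine zDep_condReward (i + 1) _ _ fun x hx => ?_
        have ho' : histMatch a s z (s.take i) o := ho
        rw [histMatch_iff, zMatch_iff] at ho'
        exact (ho'.2 x (hP ▸ hx)).symm
      rw [hP, zAvg_succ ⟨i, hi⟩ (zDep_condReward _)]
      have hE : empMean (observations ω) t a s i (fun o => condReward M a s (i + 1) (zOf s o)) =
          condReward M a s i := by
        ext z
        unfold empMean
        rw [div_eq_iff (by exact_mod_cast hcnt' ω hτω i z), countObs_eq_sum, Finset.mul_sum]
        refine Finset.sum_congr rfl fun j _ => ?_
        split_ifs with ho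
        · rw [hV, mul_one]
          refine zDep_condReward (i + 1) _ _ fun x hx => ?_
          rw [histMatch_iff, zMatch_iff] at ho
          exact (ho.2 x (hP ▸ hx)).symm
        · simp
      simp only
      rw [hE]
      exact hdev ω hω hτω
    · have hcard : (zPrefix s i).card + 1 ≤ (zPrefix s (i + 1)).card :=
        Finset.card_lt_card (lt_of_le_of_ne (zPrefix_mono_succ ⟨i, hi⟩) fun h => hP h.symm)
      have hcardle := Finset.card_le_card (zPrefix_subset s i)
      set r := (zUnion s).card - (zPrefix s i).card with hr
      have hL := playLaw_exists_history_le (M := M) (a := a) (s := s) (i := i)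
        (fun o => condReward M a s (i + 1) (zOf s o)) (fun o => h.condReward_mem_Icc _ _)
        (zDep_condReward i) hint hσ (d := δ * (5 / 7) ^ r) (n₀ := 2 ^ r * τ) (by positivity)
        (by positivity) t
      refine ⟨B ∪ _, le_trans (measureReal_union_le _ _) (le_trans (add_le_add hB hL) ?_),
        fun ω hω hτω => ?_⟩
      · have h1 : Real.exp (-(2 * (2 ^ r * τ) * (δ * (5 / 7) ^ r) ^ 2)) ≤
            Real.exp (-(2 * τ * δ ^ 2)) := by
          rw [Real.exp_le_exp, neg_le_neg_iff]
          -- The 2^r-fold sample outweighs the smaller deviation, as 2 (5/7)^2 = 50/49.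
          have h2 : (1 : ℝ) ≤ (2 * (5 / 7) ^ 2) ^ r := one_le_pow₀ (by norm_num)
          have h3 : 2 * (2 ^ r * τ) * (δ * (5 / 7) ^ r) ^ 2 =
              2 * τ * δ ^ 2 * (2 * (5 / 7 : ℝ) ^ 2) ^ r := by
            rw [mul_pow, mul_pow, ← pow_mul, ← pow_mul, mul_comm r 2]; ring
          rw [h3]
          exact le_mul_of_one_le_right (by positivity) h2
        -- At least one variable is new, so (2^p - 1) + 2^p fits below 2^{p'} - 1 for the new number
        -- p' of variables.
        have h4 : (2 : ℝ) ^ (zPrefix s i).card * 2 ≤ 2 ^ (zPrefix s (i + 1)).card := by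
          rw [← pow_succ]
          exact pow_le_pow_right₀ (by norm_num) hcard
        calc _ ≤ (2 ^ (zPrefix s i).card - 1) * Real.exp (-(2 * τ * δ ^ 2)) +
              2 ^ (zPrefix s i).card * Real.exp (-(2 * τ * δ ^ 2)) := by gcongr
          _ = (2 ^ (zPrefix s i).card * 2 - 1) * Real.exp (-(2 * τ * δ ^ 2)) := by ring
          _ ≤ _ := by gcongr
      · rw [Set.mem_union, not_or] at hω
        have hd := hdev ω hω.1 hτω
        have hlev : ∀ z : ZVal s, σ * (empMean (observations ω) t a s i
            (fun o => condReward M a s (i + 1) (zOf s o)) z - condReward M a s i z) ≤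
              δ * (5 / 7) ^ r := by
          intro z
          by_contra hcon
          exact hω.2 ⟨z, hcnt ω hτω i z, (not_le.1 hcon).le⟩
        have hsucc := zAvg_succ (O := observations ω) (t := t) (a := a) ⟨i, hi⟩
          (zDep_condReward (M := M) (a := a) (s := s) (i + 1))
        simp only at hsucc
        -- Averaging the deviations of level i and using the tower property yields the difference of
        -- two consecutive averages in the telescope.
        have h5 := zAvg_mono (O := observations ω) (t := t) (a := a) (i := i) hlev
        rw [zAvg_const_mul, ← zAvg_sub, ← hsucc] at h5
        have h6 := zAvg_const_mul (O := observations ω) (t := t) (a := a) (s := s) (i := i)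
          (δ * (5 / 7) ^ r) (fun _ => 1)
        rw [zAvg_one (Nat.le_of_succ_le hi) (fun j _ z => hcnt' ω hτω j z), mul_one] at h6
        rw [h6] at h5
        have h7 : ∑ p ∈ Finset.range ((zPrefix s i).card + 1),
            (5 / 7 : ℝ) ^ ((zUnion s).card - p) ≤
            ∑ p ∈ Finset.range (zPrefix s (i + 1)).card, (5 / 7 : ℝ) ^ ((zUnion s).card - p) :=
          Finset.sum_le_sum_of_subset_of_nonneg (Finset.range_mono hcard)
            fun _ _ _ => by positivity
        rw [Finset.sum_range_succ] at h7
        have h8 := mul_le_mul_of_nonneg_left h7 hδ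
        rw [← hr] at h8
        linarith

/-- The geometric series with ratio 5/7 has total 5/2. The remainder makes the finite sum strictly
smaller, and this strictness is what contradicts a deviation of exactly 7δ/2. -/
lemma sum_pow_sub_lt (n : ℕ) :
    ∑ p ∈ Finset.range n, (5 / 7 : ℝ) ^ (n - p) + 5 / 2 * (5 / 7) ^ n = 5 / 2 := by
  induction n with
  | zero => simp
  | succ n ih =>
    rw [Finset.sum_range_succ']
    have : ∑ p ∈ Finset.range n, (5 / 7 : ℝ) ^ (n + 1 - (p + 1)) =
        ∑ p ∈ Finset.range n, (5 / 7 : ℝ) ^ (n - p) :=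
      Finset.sum_congr rfl fun p _ => by congr 1; omega
    rw [this, Nat.sub_zero, pow_succ]
    linarith

/-- The deviation inequality for the observational estimate. -/
theorem IsAdmissible.playLaw_muObs_le (h : IsAdmissible M a s) {σ : ℝ} (hσ : σ = 1 ∨ σ = -1)
    {δ τ : ℝ} (hδ : 0 < δ) (hτ : 0 < τ) (t : ℕ) :
    (playLaw M).real {ω | τ ≤ tObs a (observations ω) t (some s) ∧
      7 / 2 * δ ≤ σ * (muObs a (observations ω) t (some s) - mean M a)} ≤
      2 * 2 ^ (zUnion s).card * Real.exp (-(2 * τ * δ ^ 2)) := by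
  by_cases hpos : ∀ z : ZVal s, (M.obsLaw (nullDo X)).real {o | histMatch a s z s o} ≠ 0
  · have hpos' : ∀ i, ∀ z : ZVal s,
        (M.obsLaw (nullDo X)).real {o | histMatch a s z (s.take i) o} ≠ 0 := by
      intro i z h0
      refine hpos z (le_antisymm ?_ measureReal_nonneg)
      rw [← h0]
      exact measureReal_mono (fun o ho p hp => ho p (List.mem_of_mem_take hp)) (by simp)
    obtain ⟨B, hB, hdev⟩ := h.exists_bad_set hpos' hσ hδ.le hτ t s.length le_rfl
    have hf : ∀ o : Obs X, (if o.2 = true then (1 : ℝ) else 0) ∈ Set.Icc (0 : ℝ) 1 := by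
      intro o; split_ifs <;> simp
    have hint : ∀ z : ZVal s, ∫ o in {o | histMatch a s z (s.take s.length) o},
        (if o.2 = true then (1 : ℝ) else 0) ∂(M.obsLaw (nullDo X)) =
        condReward M a s s.length z *
          (M.obsLaw (nullDo X)).real {o | histMatch a s z (s.take s.length) o} := by
      intro z
      rw [condReward_mul h, List.drop_length, doOn_nil, ← integral_ite_eq_setIntegral]
      simp only [← ite_and]
      rw [integral_ite_const, one_mul]
    have hL := playLaw_exists_history_le (M := M) (a := a) (s := s) (i := s.length)
      (fun o => if o.2 = true then (1 : ℝ) else 0) hf (zDep_condReward s.length) hint hσ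
      (d := δ) (n₀ := τ) hδ.le hτ t
    rw [zPrefix_length] at hB hL
    refine le_trans (measureReal_mono (fun ω hω => ?_) (by simp))
      (le_trans (measureReal_union_le B _) (le_trans (add_le_add hB hL) ?_))
    · by_contra hcon
      rw [Set.mem_union, not_or] at hcon
      obtain ⟨hτω, hω⟩ := hω
      have hd := hdev ω hcon.1 hτω
      have hcnt : ∀ (j : ℕ) (z : ZVal s), τ ≤
          countObs (observations ω) t (histMatch a s z (s.take j)) := by
        intro j z
        have h2 := pow_mul_tObs_le (a := a) (O := observations ω) (t := t) j z
        have h3 : tObs a (observations ω) t (some s) ≤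
          countObs (observations ω) t (histMatch a s z (s.take j)) :=
          le_trans (Nat.le_mul_of_pos_left _ (by positivity)) h2
        exact hτω.trans (by exact_mod_cast h3)
      have hlev : ∀ z : ZVal s, σ * (empMean (observations ω) t a s s.length
          (fun o => if o.2 = true then (1 : ℝ) else 0) z - condReward M a s s.length z) ≤ δ := by
        intro z
        by_contra hc
        exact hcon.2 ⟨z, hcnt _ z, (not_le.1 hc).le⟩
      have h5 := zAvg_mono (O := observations ω) (t := t) (a := a) (i := s.length) hlev
      rw [zAvg_const_mul, ← zAvg_sub, ← muObs_some] at h5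
      have h6 := zAvg_const_mul (O := observations ω) (t := t) (a := a) (s := s) (i := s.length)
        δ (fun _ => 1)
      rw [zAvg_one le_rfl (fun j _ z h0 => ?_), mul_one] at h6
      · rw [h6] at h5
        rw [zPrefix_length] at hd
        have h7 := sum_pow_sub_lt (zUnion s).card
        have h8 : 0 < 5 / 2 * (5 / 7 : ℝ) ^ (zUnion s).card := by positivity
        have h9 : δ * ∑ p ∈ Finset.range (zUnion s).card, (5 / 7 : ℝ) ^ ((zUnion s).card - p) <
            δ * (5 / 2) := mul_lt_mul_of_pos_left (by linarith) hδ
        linarith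
      · have := hcnt j z
        rw [h0] at this
        push_cast at this
        linarith
    · have : 0 < Real.exp (-(2 * τ * δ ^ 2)) := Real.exp_pos _
      nlinarith
  -- Some full history has probability zero. Almost surely it is never observed, so T_a = 0 and the
  -- event is null.
  · push Not at hpos
    obtain ⟨z, hz⟩ := hpos
    rw [measureReal_eq_zero_iff] at hz
    have h0 : playLaw M {ω | τ ≤ tObs a (observations ω) t (some s) ∧
        7 / 2 * δ ≤ σ * (muObs a (observations ω) t (some s) - mean M a)} = 0 := by
      refine measure_mono_null (t := ⋃ j : ℕ, {ω | histMatch a s z s (ω (nullDo X, j))}) ?_ ?_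
      · rintro ω ⟨hτω, -⟩
        have h1 : 0 < tObs a (observations ω) t (some s) := by
          have : (0 : ℝ) < tObs a (observations ω) t (some s) := hτ.trans_le hτω
          exact_mod_cast this
        have h2 := h1.trans_le (tObs_le z)
        obtain ⟨j, hj⟩ := Finset.card_pos.1 h2
        exact Set.mem_iUnion.2 ⟨j, (Finset.mem_filter.1 hj).2⟩
      · refine measure_iUnion_null fun j => ?_
        have hmp := measurePreserving_eval_infinitePi
          (fun i : Intervention X × ℕ => M.obsLaw i.1) (nullDo X, j)
        have := hmp.measure_preimage (measurableSet_obs {o | histMatch a s z s o}).nullMeasurableSet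
        rw [hz] at this
        exact this
    rw [measureReal_def, h0]
    simp only [ENNReal.toReal_zero]
    positivity

end Deviation

/-! ### The phases of the algorithm -/

section Schedule

/-- The real number `(N + 1 - k) (n_k - n_{k-1})` that is rounded to the number of plays. -/
noncomputable def pullsReal (T N k : ℕ) : ℝ :=
  ((N : ℝ) + 1 - k) * (nPhase T N k - nPhase T N (k - 1))

/-- The constant `(T/2 - N) / logBar N`. -/
noncomputable def budget (T N : ℕ) : ℝ := ((T : ℝ) / 2 - N) / logBar N

lemma one_le_logBar {N : ℕ} (hN : 2 ≤ N) : 1 ≤ logBar N := by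
  unfold logBar
  have : (1 : ℝ) / (2 : ℕ) ≤ ∑ i ∈ Finset.Icc 2 N, (1 : ℝ) / i :=
    Finset.single_le_sum (f := fun i : ℕ => (1 : ℝ) / i) (fun i _ => by positivity)
      (Finset.mem_Icc.2 ⟨le_rfl, hN⟩)
  push_cast at this
  linarith

lemma logBar_eq {N : ℕ} (hN : 2 ≤ N) : logBar N = 1 + ∑ i ∈ Finset.Icc 3 N, (1 : ℝ) / i := by
  unfold logBar
  rw [← Finset.add_sum_Ioc_eq_sum_Icc hN]
  have : Finset.Ioc 2 N = Finset.Icc 3 N := by ext; simp; omega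
  rw [this]; push_cast; ring

lemma one_add_sum_le_logBar {N i : ℕ} (hN : 2 ≤ N) (hi : 2 ≤ i) :
    1 + ∑ j ∈ Finset.Icc (i + 1) N, (1 : ℝ) / j ≤ logBar N := by
  rw [logBar_eq hN]
  gcongr
  omega

lemma budget_mul_logBar (T : ℕ) {N : ℕ} (hN : 2 ≤ N) :
    budget T N * logBar N = (T : ℝ) / 2 - N :=
  div_mul_cancel₀ _ (by linarith [one_le_logBar hN])

lemma nPhase_eq {T N k : ℕ} (hk : k ≠ 0) : nPhase T N k = budget T N / ((N : ℝ) + 1 - k) := by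
  rw [nPhase, if_neg hk, budget, div_div]

lemma pullsReal_one {T N : ℕ} (hN : 2 ≤ N) : pullsReal T N 1 = budget T N := by
  have : (N : ℝ) ≠ 0 := by positivity
  rw [pullsReal, nPhase_eq one_ne_zero]
  simp only [nPhase, Nat.sub_self, if_true, Nat.cast_one, add_sub_cancel_right, sub_zero]
  field_simp

/-- With k = j + 2, the product (N + 1 - k)(1/(N + 1 - k) - 1/(N + 2 - k)) is 1/(N + 2 - k). -/
lemma pullsReal_add_two {T N j : ℕ} (hj : j + 2 < N) :
    pullsReal T N (j + 2) = budget T N / ((N - j : ℕ) : ℝ) := by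
  have h1 : ((j : ℝ) + 2 < N) := by exact_mod_cast hj
  have e : j + 2 - 1 = j + 1 := rfl
  rw [pullsReal, e, nPhase_eq (by omega), nPhase_eq (by omega), Nat.cast_sub (by omega)]
  push_cast
  have h2 : (N : ℝ) + 1 - (j + 2) ≠ 0 := by linarith
  have h3 : (N : ℝ) + 1 - (j + 1) ≠ 0 := by linarith
  have h4 : (N : ℝ) - j ≠ 0 := by linarith
  field_simp
  ring

lemma sum_pullsReal {T N : ℕ} (hN : 2 ≤ N) (j : ℕ) (hj : j + 1 < N) :
    ∑ k ∈ Finset.range (j + 1), pullsReal T N (k + 1) =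
      budget T N * (1 + ∑ x ∈ Finset.Icc (N - j + 1) N, (1 : ℝ) / x) := by
  induction j with
  | zero => simp [pullsReal_one hN]
  | succ j ih =>
    rw [Finset.sum_range_succ, ih (by omega), pullsReal_add_two (by omega)]
    have e : Finset.Icc (N - (j + 1) + 1) N = insert (N - j) (Finset.Icc (N - j + 1) N) := by
      ext x; simp only [Finset.mem_Icc, Finset.mem_insert]; omega
    rw [e, Finset.sum_insert (by simp)]
    ring

/-- The algorithm respects its budget. -/
theorem rounds_le {T N : ℕ} (hN : 2 ≤ N) : rounds T N ≤ T := by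
  have hT : ((T / 2 : ℕ) : ℝ) ≤ T / 2 := Nat.cast_div_le
  have hsum : ∑ k ∈ Finset.Icc 1 (N - 1), pulls T N k =
      ∑ k ∈ Finset.range (N - 2 + 1), pulls T N (k + 1) := by
    rw [Finset.range_eq_Ico, Finset.sum_Ico_add' (fun k => pulls T N k) 0 _ 1]
    congr 1
    ext; simp; omega
  have key : (∑ k ∈ Finset.range (N - 2 + 1), pulls T N (k + 1) : ℝ) ≤ T / 2 := by
    rcases le_or_gt 0 (budget T N) with hb | hb
    · have hle : ∀ k ∈ Finset.range (N - 2 + 1),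
          (pulls T N (k + 1) : ℝ) ≤ pullsReal T N (k + 1) + 1 := by
        intro k hk
        refine (Nat.ceil_lt_add_one ?_).le
        change 0 ≤ pullsReal T N (k + 1)
        rcases k with _ | k
        · rw [pullsReal_one hN]; exact hb
        · rw [pullsReal_add_two (by rw [Finset.mem_range] at hk; omega)]; positivity
      refine (Finset.sum_le_sum hle).trans ?_
      rw [Finset.sum_add_distrib, sum_pullsReal hN _ (by omega)]
      have e : N - (N - 2) + 1 = 3 := by omega
      rw [e, ← logBar_eq hN, budget_mul_logBar T hN]
      have e2 : N - 2 + 1 = N - 1 := by omega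
      simp only [Finset.sum_const, Finset.card_range, nsmul_eq_mul, mul_one, e2]
      rw [Nat.cast_sub (by omega)]
      push_cast; linarith
    · have hle : ∀ k ∈ Finset.range (N - 2 + 1), (pulls T N (k + 1) : ℝ) ≤ 0 := by
        intro k hk
        rw [Nat.cast_nonpos]
        refine Nat.ceil_eq_zero.2 ?_
        change pullsReal T N (k + 1) ≤ 0
        rcases k with _ | k
        · rw [pullsReal_one hN]; exact hb.le
        · rw [pullsReal_add_two (by rw [Finset.mem_range] at hk; omega)]
          exact div_nonpos_of_nonpos_of_nonneg hb.le (Nat.cast_nonneg _)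
      refine (Finset.sum_le_sum hle).trans ?_
      simp only [Finset.sum_const_zero]
      positivity
  have : (rounds T N : ℝ) ≤ T := by
    rw [rounds, hsum]
    push_cast
    linarith
  exact_mod_cast this

end Schedule

/-! ### Invariants of playing a least sampled arm -/

section Phases

set_option linter.unusedSectionVars false

variable {ι : Type} [DecidableEq ι]

/-- The least value `w` on `A` satisfies `|A| g ≤ ∑ min (val a) (w + 1)`. -/
def LevelGe (A : Finset ι) (val : ι → ℕ) (g : ℝ) : Prop :=
  ∀ b ∈ A, (∀ c ∈ A, val b ≤ val c) → A.card * g ≤ ∑ c ∈ A, (min (val c) (val b + 1) : ℕ)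

variable {A : Finset ι} {val : ι → ℕ} {g : ℝ}

lemma LevelGe.mono {g' : ℝ} (h : LevelGe A val g) (hg : g' ≤ g) : LevelGe A val g' :=
  fun b hb hmin => le_trans (by gcongr) (h b hb hmin)

/-- Capping at one above the minimum keeps the average within one of the minimum, so the fractional
level g is read off with a loss of one only here and not in every phase. -/
lemma LevelGe.le (h : LevelGe A val g) {c : ι} (hc : c ∈ A) : g ≤ val c + 1 := by
  obtain ⟨b, hb, hmin⟩ := A.exists_min_image val ⟨c, hc⟩
  have h1 := h b hb hmin
  have h2 : (∑ c ∈ A, ((min (val c) (val b + 1) : ℕ) : ℝ)) ≤ ∑ _c ∈ A, ((val c : ℝ) + 1) := by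
    refine Finset.sum_le_sum fun d _ => ?_
    have h3 : (min (val d) (val b + 1) : ℕ) ≤ val c + 1 :=
      (min_le_right _ _).trans (Nat.succ_le_succ (hmin c hc))
    exact_mod_cast h3
  rw [Finset.sum_const, nsmul_eq_mul] at h2
  push_cast at h1 h2
  have hA : (0 : ℝ) < A.card := by exact_mod_cast Finset.card_pos.2 ⟨c, hc⟩
  exact le_of_mul_le_mul_left (h1.trans h2) hA

lemma levelGe_of_le (h : ∀ c ∈ A, g ≤ val c) : LevelGe A val g := by
  intro b hb _
  rw [← nsmul_eq_mul, ← Finset.sum_const]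
  push_cast
  refine Finset.sum_le_sum fun c hc => le_min (h c hc) ?_
  linarith [h b hb]

/-- The play raises the capped value of a minimal arm by a full unit, and no other capped value
drops. -/
lemma LevelGe.pull (h : LevelGe A val g) {b : ι} (hb : b ∈ A) (hmin : ∀ c ∈ A, val b ≤ val c) :
    LevelGe A (Function.update val b (val b + 1)) (g + 1 / A.card) := by
  intro b' hb' hmin'
  have hA : (0 : ℝ) < A.card := by exact_mod_cast Finset.card_pos.2 ⟨b, hb⟩
  have h1 := h b hb hmin
  have hbb' : val b ≤ Function.update val b (val b + 1) b' := by
    by_cases e : b' = b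
    · subst e; simp
    · rw [Function.update_of_ne e]; exact hmin b' hb'
  have h2 : ∑ c ∈ A, min (val c) (val b + 1) + 1 ≤ ∑ c ∈ A,
      min (Function.update val b (val b + 1) c) (Function.update val b (val b + 1) b' + 1) := by
    rw [← Finset.add_sum_erase A _ hb, ← Finset.add_sum_erase A (fun c => min
      (Function.update val b (val b + 1) c) (Function.update val b (val b + 1) b' + 1)) hb]
    have h3 : ∑ c ∈ A.erase b, min (val c) (val b + 1) ≤ ∑ c ∈ A.erase b,
        min (Function.update val b (val b + 1) c) (Function.update val b (val b + 1) b' + 1) := by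
      refine Finset.sum_le_sum fun c hc => ?_
      rw [Function.update_of_ne (Finset.ne_of_mem_erase hc)]
      exact min_le_min le_rfl (by omega)
    rw [Function.update_self]
    have h4 : min (val b) (val b + 1) = val b := by omega
    have h5 : min (val b + 1) (Function.update val b (val b + 1) b' + 1) = val b + 1 := by omega
    omega
  have h2' : ((∑ c ∈ A, min (val c) (val b + 1) : ℕ) : ℝ) + 1 ≤ ((∑ c ∈ A,
      min (Function.update val b (val b + 1) c)
        (Function.update val b (val b + 1) b' + 1) : ℕ) : ℝ) := by exact_mod_cast h2
  rw [mul_add, mul_one_div_cancel hA.ne']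
  linarith

lemma LevelGe.erase (h : LevelGe A val g) (a : ι) (ha : a ∈ A) (hcard : 2 ≤ A.card) :
    LevelGe (A.erase a) val (g - 1 / (A.erase a).card) := by
  intro b' hb' hmin'
  have hc : ((A.erase a).card : ℝ) = A.card - 1 := by
    rw [Finset.card_erase_of_mem ha, Nat.cast_sub (by omega)]; simp
  have hpos : (0 : ℝ) < (A.erase a).card := by exact_mod_cast Finset.card_pos.2 ⟨b', hb'⟩
  obtain ⟨b, hb, hmin⟩ := A.exists_min_image val ⟨a, ha⟩
  have h1 := h b hb hmin
  have hbb' := hmin b' (Finset.mem_of_mem_erase hb')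
  have h2 : ∑ c ∈ A, min (val c) (val b + 1) ≤
      ∑ c ∈ A.erase a, min (val c) (val b' + 1) + (val b + 1) := by
    rw [← Finset.sum_erase_add A _ ha]
    refine add_le_add (Finset.sum_le_sum fun c _ => min_le_min le_rfl (by omega))
      (min_le_right _ _)
  have h3 : (A.erase a).card * val b ≤ ∑ c ∈ A.erase a, min (val c) (val b' + 1) := by
    rw [← smul_eq_mul, ← Finset.sum_const]
    refine Finset.sum_le_sum fun c hc => le_min (hmin c (Finset.mem_of_mem_erase hc)) (by omega)
  have h2' : ((∑ c ∈ A, min (val c) (val b + 1) : ℕ) : ℝ) ≤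
      ((∑ c ∈ A.erase a, min (val c) (val b' + 1) : ℕ) : ℝ) + (val b + 1) := by exact_mod_cast h2
  have h3' : ((A.erase a).card : ℝ) * val b ≤
      ((∑ c ∈ A.erase a, min (val c) (val b' + 1) : ℕ) : ℝ) := by exact_mod_cast h3
  rw [mul_sub, mul_one_div_cancel hpos.ne']
  -- If g is at most the minimum, the remaining arms alone carry it. Otherwise the removed arm
  -- contributed at most val b + 1 < g + 1, so beyond its own share g it takes away less than one.
  rcases le_or_gt g (val b) with hg | hg
  · nlinarith [mul_le_mul_of_nonneg_left hg hpos.le]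
  · have h4 : (A.card : ℝ) = (A.erase a).card + 1 := by linarith
    rw [h4, add_mul, one_mul] at h1
    linarith

/-- All arms that were played have at most one more than the remaining ones, in total `B` plays. -/
structure Balanced (arms A : Finset ι) (τ n : ι → ℕ) (B : ℕ) : Prop where
  sum_eq : ∑ a ∈ arms, n a = B
  le : ∀ a ∈ arms, n a ≠ 0 → ∀ c ∈ A, τ a + n a ≤ τ c + n c + 1

/-- The played arm was minimal, so it ends at most one above every remaining arm. -/
lemma Balanced.pull {arms : Finset ι} {τ n : ι → ℕ} {B : ℕ} (h : Balanced arms A τ n B) {b : ι}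
    (hA : A ⊆ arms) (hb : b ∈ A) (hmin : ∀ c ∈ A, τ b + n b ≤ τ c + n c) :
    Balanced arms A τ (Function.update n b (n b + 1)) (B + 1) where
  sum_eq := by
    rw [Finset.sum_update_of_mem (hA hb), ← h.sum_eq, ← Finset.add_sum_erase arms n (hA hb),
      Finset.sdiff_singleton_eq_erase]
    ring
  le := by
    have hge : ∀ c, n c ≤ Function.update n b (n b + 1) c := by
      intro c
      by_cases e : c = b
      · subst e; simp
      · rw [Function.update_of_ne e]
    intro a ha hna c hc
    have h1 := hge c
    by_cases e : a = b
    · subst e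
      rw [Function.update_self]
      have := hmin c hc
      omega
    · rw [Function.update_of_ne e] at hna ⊢
      have := h.le a ha hna c hc
      omega

lemma Balanced.mono {arms A' : Finset ι} {τ n : ι → ℕ} {B : ℕ} (h : Balanced arms A τ n B)
    (hA : A' ⊆ A) : Balanced arms A' τ n B :=
  ⟨h.sum_eq, fun a ha hn c hc => h.le a ha hn c (hA hc)⟩

/-- If all but at most `m` arms have more than `K` observations, then the least number of plays and
observations is at least `K` or is at least the average of the plays over `m` arms. -/
lemma Balanced.le_or_le {arms : Finset ι} {τ n : ι → ℕ} {B : ℕ} (h : Balanced arms A τ n B)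
    {low : Finset ι} {m : ℕ} (hlow : low.card ≤ m) (hsub : low ⊆ arms) {K : ℝ}
    (hhigh : ∀ a ∈ arms, a ∉ low → K ≤ τ a) {c : ι} (hc : c ∈ A) :
    K ≤ τ c + n c ∨ (B : ℝ) ≤ m * ((τ c + n c : ℕ) + 1) := by
  by_contra hcon
  push Not at hcon
  obtain ⟨h1, h2⟩ := hcon
  refine absurd h2 (not_lt.2 ?_)
  -- While some remaining arm is below K, an arm outside `low` cannot have been played: balance
  -- would put its observations below K. So `low` received all B plays.
  have h3 : ∑ a ∈ arms, n a = ∑ a ∈ low, n a := by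
    refine (Finset.sum_subset hsub fun a ha hal => ?_).symm
    by_contra hn
    have h4 := h.le a ha hn c hc
    have h5 : τ a ≤ τ c + n c := by omega
    have h6 : (τ a : ℝ) ≤ τ c + n c := by exact_mod_cast h5
    exact absurd (hhigh a ha hal) (not_le.2 (h6.trans_lt h1))
  have h7 : B ≤ m * ((τ c + n c) + 1) := by
    rw [← h.sum_eq, h3]
    calc ∑ a ∈ low, n a ≤ ∑ _a ∈ low, (τ c + n c + 1) := by
          refine Finset.sum_le_sum fun a ha => ?_
          by_cases hn : n a = 0
          · omega
          · have := h.le a (hsub ha) hn c hc; omega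
      _ = low.card * (τ c + n c + 1) := by rw [Finset.sum_const, smul_eq_mul]
      _ ≤ _ := Nat.mul_le_mul_right _ hlow
  exact_mod_cast h7

end Phases

/-! ### The invariants along a run of the algorithm -/

section Run

set_option linter.unusedSectionVars false

variable {X : Type} [Fintype X] [DecidableEq X] {arms : Finset (Intervention X)}
  {adm : Intervention X → Option (AdmSeq X)} {tie : TieRule X} {T : ℕ} {ω : Outcomes X}

lemma mem_argminSet {α β : Type} [LinearOrder β] {A : Finset α} {f : α → β} {b : α} :
    b ∈ argminSet A f ↔ b ∈ A ∧ ∀ c ∈ A, f b ≤ f c := Finset.mem_filter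

lemma argminSet_nonempty {α β : Type} [LinearOrder β] {A : Finset α} (hA : A.Nonempty)
    (f : α → β) : (argminSet A f).Nonempty := by
  obtain ⟨b, hb, hmin⟩ := A.exists_min_image f hA
  exact ⟨b, mem_argminSet.2 ⟨hb, hmin⟩⟩

lemma pullStep_eq (htie : ∀ ω n (A : Finset (Intervention X)), A.Nonempty → tie ω n A ∈ A)
    {A : Finset (Intervention X)} (hA : A.Nonempty) (n : Intervention X → ℕ) :
    ∃ b ∈ A, (∀ c ∈ A, tObs b (observations ω) (T / 2) (adm b) + n b ≤
        tObs c (observations ω) (T / 2) (adm c) + n c) ∧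
      pullStep adm tie T ω A n = Function.update n b (n b + 1) := by
  have h := htie ω n _ (argminSet_nonempty hA
    fun a => tObs a (observations ω) (T / 2) (adm a) + n a)
  obtain ⟨h1, h2⟩ := mem_argminSet.1 h
  exact ⟨_, h1, h2, rfl⟩

lemma balanced_iterate (htie : ∀ ω n (A : Finset (Intervention X)), A.Nonempty → tie ω n A ∈ A)
    {A : Finset (Intervention X)} (hA : A.Nonempty) (hsub : A ⊆ arms) {n : Intervention X → ℕ}
    {B : ℕ} (h : Balanced arms A (fun a => tObs a (observations ω) (T / 2) (adm a)) n B) (p : ℕ) :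
    Balanced arms A (fun a => tObs a (observations ω) (T / 2) (adm a))
      ((pullStep adm tie T ω A)^[p] n) (B + p) := by
  induction p with
  | zero => exact h
  | succ p ih =>
    rw [Function.iterate_succ_apply', ← add_assoc]
    obtain ⟨b, hb, hmin, e⟩ := pullStep_eq (adm := adm) (T := T) (ω := ω) htie hA
      ((pullStep adm tie T ω A)^[p] n)
    rw [e]
    exact ih.pull hsub hb hmin

lemma levelGe_iterate (htie : ∀ ω n (A : Finset (Intervention X)), A.Nonempty → tie ω n A ∈ A)
    {A : Finset (Intervention X)} (hA : A.Nonempty) {n : Intervention X → ℕ} {g : ℝ}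
    (h : LevelGe A (fun a => tObs a (observations ω) (T / 2) (adm a) + n a) g) (p : ℕ) :
    LevelGe A (fun a => tObs a (observations ω) (T / 2) (adm a) +
      (pullStep adm tie T ω A)^[p] n a) (g + p / A.card) := by
  induction p with
  | zero => simpa using h
  | succ p ih =>
    rw [Function.iterate_succ_apply']
    obtain ⟨b, hb, hmin, e⟩ := pullStep_eq (adm := adm) (T := T) (ω := ω) htie hA
      ((pullStep adm tie T ω A)^[p] n)
    rw [e]
    have h1 := ih.pull hb hmin
    have h2 : (fun a => tObs a (observations ω) (T / 2) (adm a) +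
        Function.update ((pullStep adm tie T ω A)^[p] n) b ((pullStep adm tie T ω A)^[p] n b + 1) a)
        = Function.update (fun a => tObs a (observations ω) (T / 2) (adm a) +
          (pullStep adm tie T ω A)^[p] n a) b (tObs b (observations ω) (T / 2) (adm b) +
          (pullStep adm tie T ω A)^[p] n b + 1) := by
      ext a
      by_cases ha : a = b
      · subst ha; simp [add_assoc]
      · simp [ha]
    rw [h2]
    refine h1.mono (le_of_eq ?_)
    push_cast; ring

lemma state_succ (k : ℕ) : state arms adm tie T ω (k + 1) =
    ((state arms adm tie T ω k).1.erase (tie ω (state arms adm tie T ω (k + 1)).2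
      (argminSet (state arms adm tie T ω k).1
        fun a => muHat adm T ω a ((state arms adm tie T ω (k + 1)).2 a))),
     (pullStep adm tie T ω (state arms adm tie T ω k).1)^[pulls T arms.card (k + 1)]
      (state arms adm tie T ω k).2) := rfl

lemma state_succ_snd (k : ℕ) : (state arms adm tie T ω (k + 1)).2 =
    (pullStep adm tie T ω (state arms adm tie T ω k).1)^[pulls T arms.card (k + 1)]
      (state arms adm tie T ω k).2 := rfl

/-- Each phase removes an arm with the least estimate. -/
lemma exists_state_succ_fst
    (htie : ∀ ω n (A : Finset (Intervention X)), A.Nonempty → tie ω n A ∈ A) {k : ℕ}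
    (hA : (state arms adm tie T ω k).1.Nonempty) :
    ∃ b ∈ (state arms adm tie T ω k).1,
      (∀ c ∈ (state arms adm tie T ω k).1,
        muHat adm T ω b ((state arms adm tie T ω (k + 1)).2 b) ≤
          muHat adm T ω c ((state arms adm tie T ω (k + 1)).2 c)) ∧
      (state arms adm tie T ω (k + 1)).1 = (state arms adm tie T ω k).1.erase b := by
  have h := htie ω (state arms adm tie T ω (k + 1)).2 _ (argminSet_nonempty hA
    fun a => muHat adm T ω a ((state arms adm tie T ω (k + 1)).2 a))
  obtain ⟨h1, h2⟩ := mem_argminSet.1 h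
  exact ⟨_, h1, h2, congrArg Prod.fst (state_succ k)⟩

lemma state_fst_subset_card
    (htie : ∀ ω n (A : Finset (Intervention X)), A.Nonempty → tie ω n A ∈ A) {k : ℕ}
    (hk : k < arms.card) :
    (state arms adm tie T ω k).1 ⊆ arms ∧ (state arms adm tie T ω k).1.card = arms.card - k := by
  induction k with
  | zero => exact ⟨subset_rfl, rfl⟩
  | succ k ih =>
    obtain ⟨h1, h2⟩ := ih (by omega)
    obtain ⟨b, hb, -, e⟩ := exists_state_succ_fst (adm := adm) (T := T) (ω := ω) htie
      (k := k) (arms := arms) (Finset.card_pos.1 (by omega))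
    rw [e]
    exact ⟨(Finset.erase_subset _ _).trans h1, by rw [Finset.card_erase_of_mem hb, h2]; omega⟩

lemma state_nonempty (htie : ∀ ω n (A : Finset (Intervention X)), A.Nonempty → tie ω n A ∈ A)
    {k : ℕ} (hk : k < arms.card) : (state arms adm tie T ω k).1.Nonempty :=
  Finset.card_pos.1 (by
    have := (state_fst_subset_card (adm := adm) (T := T) (ω := ω) htie hk).2
    omega)

/-- Removing an arm weakens the condition on the remaining arms, while the sum still counts plays of
removed arms. The counts are those after phase k + 1, the arms those before its elimination. -/
lemma balanced_state (htie : ∀ ω n (A : Finset (Intervention X)), A.Nonempty → tie ω n A ∈ A)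
    {k : ℕ} (hk : k < arms.card) :
    Balanced arms (state arms adm tie T ω k).1 (fun a => tObs a (observations ω) (T / 2) (adm a))
      (state arms adm tie T ω (k + 1)).2
      (∑ j ∈ Finset.range (k + 1), pulls T arms.card (j + 1)) := by
  have key : Balanced arms (state arms adm tie T ω k).1
      (fun a => tObs a (observations ω) (T / 2) (adm a)) (state arms adm tie T ω k).2
      (∑ j ∈ Finset.range k, pulls T arms.card (j + 1)) := by
    induction k with
    | zero => exact ⟨by simp [state], fun a _ h => absurd rfl h⟩
    | succ k ih =>
      have hne := state_nonempty (adm := adm) (T := T) (ω := ω) (arms := arms) htie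
        (k := k) (by omega)
      have hs := (state_fst_subset_card (adm := adm) (T := T) (ω := ω) (arms := arms) htie
        (k := k) (by omega)).1
      obtain ⟨b, hb, -, e⟩ := exists_state_succ_fst (adm := adm) (T := T) (ω := ω) htie hne
      rw [Finset.sum_range_succ, state_succ_snd]
      exact (balanced_iterate htie hne hs (ih (by omega)) _).mono
        (e ▸ Finset.erase_subset _ _)
  rw [Finset.sum_range_succ, state_succ_snd]
  exact balanced_iterate htie (state_nonempty htie hk)
    (state_fst_subset_card htie hk).1 key _

/-- The algorithm returns exactly one arm. -/
theorem exists_returned_eq (htie : ∀ ω n (A : Finset (Intervention X)), A.Nonempty → tie ω n A ∈ A)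
    (hcard : 2 ≤ arms.card) (ω : Outcomes X) : ∃ a ∈ arms, returned arms adm tie T ω = {a} := by
  obtain ⟨h1, h2⟩ := state_fst_subset_card (adm := adm) (T := T) (ω := ω) (arms := arms) htie
    (k := arms.card - 1) (by omega)
  obtain ⟨a, ha⟩ := Finset.card_eq_one.1 (h2.trans (by omega))
  exact ⟨a, h1 (by rw [ha]; simp), ha⟩

end Run

/-! ### Sample sizes in the phases -/

section SampleSize

lemma alpha_of_le {N m k : ℕ} (hm : 0 < m) (hk : m ≤ k) :
    alpha N m k = (1 + ∑ i ∈ Finset.Icc (k + 1) N, (1 : ℝ) / i) / m := by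
  rcases hk.lt_or_eq with h | rfl
  · rw [alpha, if_pos h]
  · have : (m : ℝ) ≠ 0 := by positivity
    rw [alpha, if_neg (lt_irrefl _)]
    ring

lemma alpha_of_ge {N m k : ℕ} (hk : k ≤ m) :
    alpha N m k = alpha N m m + 1 / k - 1 / m := by
  rw [alpha, if_neg (not_lt.2 hk), alpha, if_neg (lt_irrefl _)]
  ring

lemma budget_mul_alpha_le {T N m k : ℕ} (hb : 0 ≤ budget T N) (hN : 2 ≤ N) (hm : 0 < m)
    (hk : 2 ≤ k) (hmk : m ≤ k) : budget T N * alpha N m k ≤ ((T : ℝ) / 2 - N) / m := by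
  rw [alpha_of_le hm hmk, ← mul_div_assoc, ← budget_mul_logBar T hN]
  gcongr
  exact one_add_sum_le_logBar hN hk

lemma half_sub_le_natCast_half {T N : ℕ} (hN : 2 ≤ N) :
    (T : ℝ) / 2 - N ≤ ((T / 2 : ℕ) : ℝ) := by
  have h : T ≤ 2 * (T / 2) + 1 := by omega
  have h' : (T : ℝ) ≤ 2 * ((T / 2 : ℕ) : ℝ) + 1 := by exact_mod_cast h
  have h2 : (2 : ℝ) ≤ N := by exact_mod_cast hN
  linarith

/-- Going from i + 1 to i arms costs 1/i and the plays return p/i. For c/i > 4 one has c/(i + 1) ≥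
2, and the net gain (p - 1)/i covers half of c/i - c/(i + 1). For smaller c the left side is zero
and p ≥ 1 suffices. -/
lemma levelGain_le {c p : ℝ} {i : ℕ} (hi : 1 ≤ i) (hp1 : 1 ≤ p) (hp : c / ((i + 1 : ℕ) : ℝ) ≤ p) :
    max 0 (c / i - 4) / 2 ≤ max 0 (c / ((i + 1 : ℕ) : ℝ) - 4) / 2 - 1 / i + p / i := by
  have hi' : (1 : ℝ) ≤ i := by exact_mod_cast hi
  have hi0 : (0 : ℝ) < i := by linarith
  have e : -1 / (i : ℝ) + p / i = (p - 1) / i := by ring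
  have h0 := le_max_left 0 (c / ((i + 1 : ℕ) : ℝ) - 4)
  have h1 := le_max_right 0 (c / ((i + 1 : ℕ) : ℝ) - 4)
  rcases le_or_gt (c / i) 4 with h | h
  · rw [max_eq_left (by linarith)]
    have : 0 ≤ (p - 1) / i := div_nonneg (by linarith) hi0.le
    have e2 : (p - 1) / (i : ℝ) = p / i - 1 / i := by ring
    linarith
  · rw [max_eq_right (by linarith)]
    have hc : 4 * (i : ℝ) < c := (lt_div_iff₀ hi0).1 h
    push_cast at hp h1 ⊢
    have h2 : 2 ≤ c / ((i : ℝ) + 1) := by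
      rw [le_div_iff₀ (by linarith)]; linarith
    have h3 : c / (i : ℝ) = c / ((i : ℝ) + 1) + c / ((i : ℝ) + 1) / i := by
      have : (i : ℝ) + 1 ≠ 0 := by linarith
      field_simp
    have h4 : c / ((i : ℝ) + 1) / i / 2 ≤ (p - 1) / i := by
      rw [div_div, div_div, mul_comm (i : ℝ) 2, ← div_div, ← div_div]
      rw [div_le_div_iff_of_pos_right hi0, ]
      linarith
    have e2 : (p - 1) / (i : ℝ) = p / i - 1 / i := by ring
    linarith

variable {X : Type} [Fintype X] [DecidableEq X] {arms : Finset (Intervention X)}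
  {adm : Intervention X → Option (AdmSeq X)} {tie : TieRule X} {T : ℕ} {ω : Outcomes X}

/-- The least number of plays and observations while at least `m` arms remain. -/
lemma half_budget_mul_alpha_le
    (htie : ∀ ω n (A : Finset (Intervention X)), A.Nonempty → tie ω n A ∈ A)
    (hcard : 2 ≤ arms.card) (hb : 0 ≤ budget T arms.card) {low : Finset (Intervention X)} {m : ℕ}
    (hm : 0 < m) (hlow : low.card ≤ m) (hsub : low ⊆ arms)
    (hhigh : ∀ a ∈ arms, a ∉ low →
      ((T / 2 : ℕ) : ℝ) / (2 * m) ≤ tObs a (observations ω) (T / 2) (adm a))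
    {j : ℕ} (hj : j + 1 < arms.card) (hmj : m ≤ arms.card - j) {b : Intervention X}
    (hbA : b ∈ (state arms adm tie T ω j).1) :
    budget T arms.card * alpha arms.card m (arms.card - j) / 2 ≤
      tObs b (observations ω) (T / 2) (adm b) + (state arms adm tie T ω (j + 1)).2 b + 1 := by
  have hm' : (0 : ℝ) < m := by exact_mod_cast hm
  have hval : (0 : ℝ) ≤ (tObs b (observations ω) (T / 2) (adm b) : ℝ) +
      (state arms adm tie T ω (j + 1)).2 b + 1 := by positivity
  -- Either the observations already give half of (T/2 - N)/m, or the plays so far, at least budget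
  -- · m · α, were spread over at most m arms.
  rcases (balanced_state (adm := adm) (T := T) (ω := ω) htie (k := j) (by omega)).le_or_le hlow hsub
    hhigh hbA with h | h
  · have h1 := budget_mul_alpha_le (T := T) hb hcard hm (k := arms.card - j) (by omega) hmj
    have h2 : ((T : ℝ) / 2 - arms.card) / m ≤ ((T / 2 : ℕ) : ℝ) / m := by
      gcongr
      exact half_sub_le_natCast_half hcard
    have h3 : ((T / 2 : ℕ) : ℝ) / (2 * m) = ((T / 2 : ℕ) : ℝ) / m / 2 := by ring
    linarith
  · have h1 : ∑ k ∈ Finset.range (j + 1), pullsReal T arms.card (k + 1) ≤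
        ((∑ k ∈ Finset.range (j + 1), pulls T arms.card (k + 1) : ℕ) : ℝ) := by
      push_cast
      exact Finset.sum_le_sum fun k _ => Nat.le_ceil _
    rw [sum_pullsReal hcard j hj] at h1
    have h2 : budget T arms.card * alpha arms.card m (arms.card - j) ≤
        (tObs b (observations ω) (T / 2) (adm b) : ℝ) +
          (state arms adm tie T ω (j + 1)).2 b + 1 := by
      rw [alpha_of_le hm hmj, ← mul_div_assoc, div_le_iff₀ hm']
      push_cast at h1 h
      linarith
    linarith

/-- The level of the remaining arms when at most `m` arms remain. -/
lemma levelGe_state (htie : ∀ ω n (A : Finset (Intervention X)), A.Nonempty → tie ω n A ∈ A)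
    (hcard : 2 ≤ arms.card) (hb : 0 < budget T arms.card) {low : Finset (Intervention X)} {m : ℕ}
    (hm : 0 < m) (hmN : m ≤ arms.card) (hlow : low.card ≤ m) (hsub : low ⊆ arms)
    (hhigh : ∀ a ∈ arms, a ∉ low →
      ((T / 2 : ℕ) : ℝ) / (2 * m) ≤ tObs a (observations ω) (T / 2) (adm a))
    (d : ℕ) (hd : d + 2 ≤ m) :
    LevelGe (state arms adm tie T ω (arms.card - m + d)).1
      (fun a => tObs a (observations ω) (T / 2) (adm a) +
        (state arms adm tie T ω (arms.card - m + d + 1)).2 a)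
      (budget T arms.card * alpha arms.card m m / 2 - 1 +
        max 0 (budget T arms.card / ((m - d : ℕ) : ℝ) - 4) / 2 -
        max 0 (budget T arms.card / (m : ℝ) - 4) / 2) := by
  induction d with
  | zero =>
    refine levelGe_of_le fun c hc => ?_
    have h := half_budget_mul_alpha_le (adm := adm) (T := T) (ω := ω) htie hcard hb.le hm hlow hsub
      hhigh (j := arms.card - m) (by omega) (by omega) hc
    rw [Nat.sub_sub_self hmN] at h
    simp only [Nat.sub_zero, add_zero]
    push_cast
    linarith
  | succ d ih =>
    have h0 := ih (by omega)
    set j := arms.card - m + d with hj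
    obtain ⟨b, hbA, -, e⟩ := exists_state_succ_fst (adm := adm) (T := T) (ω := ω) (arms := arms)
      htie (k := j) (state_nonempty htie (by omega))
    have hcj := (state_fst_subset_card (adm := adm) (T := T) (ω := ω) (arms := arms) htie
      (k := j) (by omega)).2
    have hcj1 := (state_fst_subset_card (adm := adm) (T := T) (ω := ω) (arms := arms) htie
      (k := j + 1) (by omega)).2
    have h1 := h0.erase b hbA (by omega)
    rw [← e] at h1
    have h2 := levelGe_iterate htie (state_nonempty htie (by omega)) h1 (pulls T arms.card (j + 2))
    rw [← state_succ_snd] at h2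
    refine h2.mono ?_
    rw [hcj1]
    have e1 : arms.card - (j + 1) = m - (d + 1) := by omega
    have e2 : m - d = m - (d + 1) + 1 := by omega
    have e3 : arms.card - j = m - (d + 1) + 1 := by omega
    have hp : pullsReal T arms.card (j + 2) ≤ (pulls T arms.card (j + 2) : ℝ) := Nat.le_ceil _
    have hpos : 0 < pullsReal T arms.card (j + 2) := by
      rw [pullsReal_add_two (by omega), e3]; positivity
    -- A positive real number rounds up to at least one play, which repays the elimination even when
    -- the budget per phase is tiny.
    have hp1 : (1 : ℝ) ≤ (pulls T arms.card (j + 2) : ℝ) := by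
      exact_mod_cast Nat.one_le_iff_ne_zero.2 (by
        intro h; rw [h] at hp; push_cast at hp; linarith)
    rw [pullsReal_add_two (by omega), e3] at hp
    have h3 := levelGain_le (i := m - (d + 1)) (by omega) hp1 hp
    rw [e1, e2]
    linarith

/-- All remaining arms are played or observed in proportion to the weights `α`. -/
theorem budget_mul_alpha_le_tObs_add
    (htie : ∀ ω n (A : Finset (Intervention X)), A.Nonempty → tie ω n A ∈ A)
    (hcard : 2 ≤ arms.card) (hb : 0 < budget T arms.card) {low : Finset (Intervention X)} {m : ℕ}
    (hm : 0 < m) (hmN : m ≤ arms.card) (hlow : low.card ≤ m) (hsub : low ⊆ arms)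
    (hhigh : ∀ a ∈ arms, a ∉ low →
      ((T / 2 : ℕ) : ℝ) / (2 * m) ≤ tObs a (observations ω) (T / 2) (adm a))
    {j : ℕ} (hj : j + 1 < arms.card)
    (h30 : 30 ≤ budget T arms.card * alpha arms.card m (arms.card - j)) {b : Intervention X}
    (hbA : b ∈ (state arms adm tie T ω j).1) :
    2 / 5 * (budget T arms.card * alpha arms.card m (arms.card - j)) ≤
      tObs b (observations ω) (T / 2) (adm b) + (state arms adm tie T ω (j + 1)).2 b + 1 := by
  rcases le_or_gt m (arms.card - j) with h | h
  · have := half_budget_mul_alpha_le (adm := adm) (T := T) (ω := ω) htie hcard hb.le hm hlow hsub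
      hhigh hj h hbA
    linarith
  · have h1 := levelGe_state (adm := adm) (T := T) (ω := ω) htie hcard hb hm hmN hlow hsub hhigh
      (m - (arms.card - j)) (by omega)
    have e1 : arms.card - m + (m - (arms.card - j)) = j := by omega
    have e2 : m - (m - (arms.card - j)) = arms.card - j := by omega
    rw [e1, e2] at h1
    have h2 := h1.le hbA
    rw [alpha_of_ge h.le] at h30 ⊢
    have h3 := le_max_right 0 (budget T arms.card / ((arms.card - j : ℕ) : ℝ) - 4)
    have h4 : max 0 (budget T arms.card / (m : ℝ) - 4) ≤ budget T arms.card / m :=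
      max_le (by positivity) (by linarith)
    have h5 : budget T arms.card * (alpha arms.card m m + 1 / ((arms.card - j : ℕ) : ℝ) - 1 / m) =
        budget T arms.card * alpha arms.card m m + budget T arms.card / ((arms.card - j : ℕ) : ℝ) -
          budget T arms.card / m := by ring
    rw [h5] at h30 ⊢
    push_cast at h2
    -- The level is at least half of budget · α minus 3, and this exceeds 2/5 of it by `h30`.
    linarith

end SampleSize

/-! ### Sorted gaps and the complexity measure -/

section Complexity

set_option linter.unusedSectionVars false

variable {X : Type} [Fintype X] [DecidableEq X] {arms A : Finset (Intervention X)}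
  {μ q : Intervention X → ℝ} {best : Intervention X} {ε : ℝ}

lemma countP_lt_getD_le {L : List ℝ} (hL : L.Pairwise (· ≤ ·)) {i : ℕ} (hi : i < L.length) :
    L.countP (fun x => decide (x < L.getD i 0)) ≤ i := by
  rw [List.getD_eq_getElem _ _ hi]
  conv_lhs => arg 2; rw [← List.take_append_drop i L]
  rw [List.countP_append]
  have h1 : (L.drop i).countP (fun x => decide (x < L[i])) = 0 := by
    rw [List.countP_eq_zero]
    intro x hx
    obtain ⟨k, hk, rfl⟩ := List.mem_iff_getElem.1 hx
    rw [List.getElem_drop]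
    have h2 : L[i] ≤ L[i + k]'(by rw [List.length_drop] at hk; omega) := by
      rcases Nat.eq_zero_or_pos k with rfl | hk0
      · simp
      · exact List.pairwise_iff_getElem.1 hL _ _ _ _ (by omega)
    simpa using h2
  rw [h1, add_zero]
  exact (List.countP_le_length).trans (by simp)

/-- Among any `i` arms there is one whose gap is at least the `i`-th smallest. -/
lemma exists_sortedGap_le (hA : A ⊆ arms) (hne : A.Nonempty) :
    ∃ a ∈ A, sortedGap arms μ best A.card ≤ gap arms μ best a := by
  by_contra! hcon
  have hpos := hne.card_pos
  set L := (arms.val.map (gap arms μ best)).sort (· ≤ ·) with hLdef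
  have hLs : (L : Multiset ℝ) = arms.val.map (gap arms μ best) := Multiset.sort_eq _ _
  have hlen : L.length = arms.card := by simp [hLdef]
  have hle := Finset.card_le_card hA
  have h1 := countP_lt_getD_le (L := L) (Multiset.pairwise_sort _ _) (i := A.card - 1) (by omega)
  have h2 : A.card ≤ L.countP (fun x => decide (x < L.getD (A.card - 1) 0)) := by
    have e : L.countP (fun x => decide (x < L.getD (A.card - 1) 0)) =
        Multiset.countP (fun x => x < L.getD (A.card - 1) 0) (L : Multiset ℝ) :=
      (Multiset.coe_countP _ _).symm
    rw [e, hLs, Multiset.countP_map]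
    change A.card ≤ (arms.filter fun a => gap arms μ best a < L.getD (A.card - 1) 0).card
    exact Finset.card_le_card fun a ha => Finset.mem_filter.2 ⟨hA ha, hcon a ha⟩
  omega

/-- Among any `i ≥ 2` arms that contain the optimal one, some arm is worse than the optimal one
by the `i`-th smallest gap. -/
lemma exists_sortedGap_le_sub (hA : A ⊆ arms) (hbest : best ∈ A) (hcard : 2 ≤ A.card) :
    ∃ b ∈ A, b ≠ best ∧ sortedGap arms μ best A.card ≤ μ best - μ b := by
  obtain ⟨a, ha, hgap⟩ := exists_sortedGap_le (μ := μ) (best := best) hA ⟨best, hbest⟩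
  -- The gap of the optimal arm is its distance to the second best mean, so any other arm of A is at
  -- least that much worse.
  by_cases hab : a = best
  · obtain ⟨b, hb, hne⟩ := Finset.exists_mem_ne (s := A) (by omega) best
    refine ⟨b, hb, hne, hgap.trans ?_⟩
    rw [gap, if_pos hab]
    have hfin : (μ '' {b | b ∈ arms ∧ b ≠ best}).Finite := Set.toFinite _
    linarith [le_csSup hfin.bddAbove ⟨b, ⟨hA hb, hne⟩, rfl⟩]
  · exact ⟨a, ha, hab, by rwa [gap, if_neg hab] at hgap⟩

lemma obsThreshold_spec (hcard : 1 ≤ arms.card) :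
    1 ≤ obsThreshold arms q ∧ obsThreshold arms q ≤ arms.card ∧
      (arms.filter (fun a => q a < 1 / (obsThreshold arms q : ℝ))).card ≤ obsThreshold arms q :=
  Nat.sInf_mem (s := {τ : ℕ | 1 ≤ τ ∧ τ ≤ arms.card ∧
    (arms.filter (fun a => q a < 1 / (τ : ℝ))).card ≤ τ})
    ⟨arms.card, hcard, le_rfl, Finset.card_filter_le _ _⟩

lemma alpha_pos {N m k : ℕ} (hm : 0 < m) (hk : 0 < k) : 0 < alpha N m k := by
  unfold alpha
  split_ifs <;> positivity

lemma alpha_self {N m : ℕ} (hm : 0 < m) (hmN : m ≤ N) : alpha N m N = 1 / m := by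
  rw [alpha_of_le hm hmN]
  simp

/-- Inverting one term of the maximum. For an infinite complexity the left side is 0, which is the
convention for the exponent. -/
lemma toReal_inv_H3_le (hε : 0 ≤ ε) {k : ℕ} (hk : k ∈ Finset.Icc 1 arms.card) :
    ((H3 arms μ q best ε)⁻¹).toReal ≤
      alpha arms.card (obsThreshold arms q) k * max (sortedGap arms μ best k) ε ^ 2 := by
  obtain ⟨hk1, hk2⟩ := Finset.mem_Icc.1 hk
  have hα : 0 < alpha arms.card (obsThreshold arms q) k :=
    alpha_pos (obsThreshold_spec (hk1.trans hk2)).1 hk1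
  have hD : 0 ≤ max (sortedGap arms μ best k) ε := hε.trans (le_max_right _ _)
  have h1 : (ENNReal.ofReal (alpha arms.card (obsThreshold arms q) k))⁻¹ *
      (ENNReal.ofReal (max (sortedGap arms μ best k) ε) ^ 2)⁻¹ ≤ H3 arms μ q best ε :=
    Finset.le_sup (f := fun k => (ENNReal.ofReal (alpha arms.card (obsThreshold arms q) k))⁻¹ *
      (ENNReal.ofReal (max (sortedGap arms μ best k) ε) ^ 2)⁻¹) hk
  have h2 := ENNReal.inv_le_inv.2 h1
  rw [ENNReal.mul_inv (Or.inl (ENNReal.inv_ne_zero.2 ENNReal.ofReal_ne_top))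
    (Or.inl (ENNReal.inv_ne_top.2 (by simpa using hα))), inv_inv, inv_inv,
    ← ENNReal.ofReal_pow hD, ← ENNReal.ofReal_mul hα.le] at h2
  refine (ENNReal.toReal_mono ENNReal.ofReal_ne_top h2).trans ?_
  rw [ENNReal.toReal_ofReal (by positivity)]

end Complexity

/-! ### Deviations of the estimates -/

section Deviation

set_option linter.unusedSectionVars false

variable {X U : Type} [Fintype X] [DecidableEq X] {H : U → Type}
  [∀ u, MeasurableSpace (H u)] [∀ u, Nonempty (H u)] {M : CausalModel X U H}

lemma mean_mem_Icc (M : CausalModel X U H) (a : Intervention X) : mean M a ∈ Set.Icc (0 : ℝ) 1 := by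
  rw [mean_eq_measureReal]
  exact ⟨measureReal_nonneg, measureReal_le_one⟩

lemma rewardOf_mem_Icc (o : Obs X) : rewardOf o ∈ Set.Icc (0 : ℝ) 1 := by
  unfold rewardOf
  split_ifs <;> simp

lemma one_le_iCard (o : Option (AdmSeq X)) : 1 ≤ iCard o := by
  cases o with
  | none => exact le_rfl
  | some s => exact Nat.one_le_two_pow

/-- An arm is observed about as often as expected. -/
lemma playLaw_tObs_lt_le (a : Intervention X) (o : Option (AdmSeq X)) {r : ℝ} (hr : 0 < r)
    (hq : r ≤ qObs M a o) (t : ℕ) :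
    (playLaw M).real {ω | (tObs a (observations ω) t o : ℝ) < t * r / 2} ≤
      iCard o * Real.exp (-(t * r / 8)) := by
  cases o with
  | none => exact absurd hq (not_le.2 hr)
  | some s =>
    have hsub : {ω : Outcomes X | (tObs a (observations ω) t (some s) : ℝ) < t * r / 2} ⊆
        ⋃ z ∈ (Finset.univ : Finset (ZVal s)), {ω : Outcomes X |
          (countObs (fun j => ω (nullDo X, j)) t (histMatch a s z s) : ℝ) ≤ t * r / 2} := by
      intro ω hω
      obtain ⟨z, hz⟩ := exists_eq_ciInf_of_finite
        (f := fun z : ZVal s => countObs (observations ω) t (histMatch a s z s))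
      simp only [Finset.mem_univ, Set.iUnion_true, Set.mem_iUnion]
      refine ⟨z, ?_⟩
      have hω' : ((⨅ z : ZVal s, countObs (observations ω) t (histMatch a s z s) : ℕ) : ℝ) <
        t * r / 2 := hω
      rw [← hz] at hω'
      exact hω'.le
    refine (measureReal_mono hsub (measure_ne_top _ _)).trans ((measureReal_biUnion_finset_le _ _).trans ?_)
    have hz : ∀ z ∈ (Finset.univ : Finset (ZVal s)), (playLaw M).real {ω : Outcomes X |
        (countObs (fun j => ω (nullDo X, j)) t (histMatch a s z s) : ℝ) ≤ t * r / 2} ≤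
          Real.exp (-(t * r / 8)) := fun z _ =>
      playLaw_countObs_le M (nullDo X) (e := fun j => j) Function.injective_id _ hr.le
        (hq.trans (ciInf_le (Set.finite_range _).bddBelow z)) t
    refine (Finset.sum_le_sum hz).trans (le_of_eq ?_)
    simp [iCard]

/-- Deviations of the observational estimate. -/
lemma playLaw_le_tObs_muObs_le {a : Intervention X} {o : Option (AdmSeq X)}
    (h : ∀ s, o = some s → IsAdmissible M a s) {σ : ℝ} (hσ : σ = 1 ∨ σ = -1)
    {δ τ : ℝ} (hδ : 0 < δ) (hτ : 0 < τ) (t : ℕ) :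
    (playLaw M).real {ω | τ ≤ tObs a (observations ω) t o ∧
      δ ≤ σ * (muObs a (observations ω) t o - mean M a)} ≤
      2 * iCard o * Real.exp (-(2 * τ * (2 / 7 * δ) ^ 2)) := by
  cases o with
  | none =>
    have e : {ω : Outcomes X | τ ≤ tObs a (observations ω) t none ∧
      δ ≤ σ * (muObs a (observations ω) t none - mean M a)} = ∅ := by
      ext ω
      simp only [tObs, Nat.cast_zero, Set.mem_ofPred_eq, Set.mem_empty_iff_false, iff_false]
      exact fun h => absurd h.1 (not_le.2 hτ)
    rw [e, measureReal_empty]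
    positivity
  | some s =>
    have h1 := (h s rfl).playLaw_muObs_le hσ (by positivity : 0 < 2 / 7 * δ) hτ t
    rw [show 7 / 2 * (2 / 7 * δ) = δ by ring] at h1
    refine h1.trans (le_of_eq ?_)
    simp [iCard]

/-- Deviations of the interventional estimate. -/
lemma playLaw_muInt_le (a : Intervention X) (T : ℕ) {σ : ℝ} (hσ : σ = 1 ∨ σ = -1)
    {δ n₀ : ℝ} (hδ : 0 ≤ δ) (hn : 0 < n₀) :
    (playLaw M).real {ω | ∃ n : ℕ, n₀ ≤ n ∧ δ ≤ σ * (muInt T ω a n - mean M a)} ≤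
      Real.exp (-(2 * n₀ * δ ^ 2)) := by
  -- The phase plays of `do()` follow its T/2 observation rounds. Injectivity is all that
  -- independence needs.
  set e : ℕ → ℕ := fun j => if a = nullDo X then T / 2 + j else j with he
  have hinj : Function.Injective e := by
    intro i j hij
    simp only [he] at hij
    split_ifs at hij <;> omega
  set f : Obs X → ℝ := fun o => (1 - σ) / 2 + σ * rewardOf o with hf
  have hf01 : ∀ o, f o ∈ Set.Icc (0 : ℝ) 1 := by
    intro o
    obtain ⟨h1, h2⟩ := rewardOf_mem_Icc o
    rcases hσ with rfl | rfl <;> simp only [hf, Set.mem_Icc] <;> constructor <;> linarith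
  have hint : Integrable (fun o : Obs X => rewardOf o) (M.obsLaw a) :=
    Integrable.of_finite
  have hv : ∫ o in {o : Obs X | (fun _ => True) o}, f o ∂(M.obsLaw a) =
      ((1 - σ) / 2 + σ * mean M a) * (M.obsLaw a).real {o : Obs X | (fun _ => True) o} := by
    simp only [Set.ofPred_true, Measure.restrict_univ, probReal_univ, mul_one, hf]
    rw [integral_add (integrable_const _) (hint.const_mul _), integral_const_mul]
    simp [mean]
  refine le_trans (measureReal_mono ?_) (playLaw_hoeffding M a hinj (fun _ => True) hf01 hv hδ)
  rintro ω ⟨n, hn1, hn2⟩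
  have hc : (countObs (fun j => ω (a, e j)) n fun _ => True) = n := by simp [countObs]
  refine ⟨n, by rw [hc]; exact hn1, ?_⟩
  simp only [hc, if_true]
  have hn0 : (0 : ℝ) < n := hn.trans_le hn1
  have e1 : ∑ j ∈ Finset.range n, (f (ω (a, e j)) - ((1 - σ) / 2 + σ * mean M a)) =
      σ * (muInt T ω a n - mean M a) * n := by
    simp only [hf, add_sub_add_left_eq_sub]
    rw [Finset.sum_sub_distrib, ← Finset.mul_sum, Finset.sum_const, Finset.card_range, nsmul_eq_mul]
    have e2 : muInt T ω a n * n = ∑ j ∈ Finset.range n, rewardOf (ω (a, e j)) :=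
      div_mul_cancel₀ _ hn0.ne'
    rw [← e2]; ring
  rw [e1]
  exact mul_le_mul_of_nonneg_right hn2 hn0.le

end Deviation

/-! ### The error probability -/

section Error

set_option linter.unusedSectionVars false

variable {X U : Type} [Fintype X] [DecidableEq X] {H : U → Type}
  [∀ u, MeasurableSpace (H u)] [∀ u, Nonempty (H u)] {M : CausalModel X U H}
  {arms : Finset (Intervention X)} {adm : Intervention X → Option (AdmSeq X)} {tie : TieRule X}
  {best : Intervention X} {T : ℕ}

/-- The sign of the deviations that favour suboptimal arms. -/
def devSign (best b : Intervention X) : ℝ := if b = best then -1 else 1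

lemma devSign_eq (best b : Intervention X) : devSign best b = 1 ∨ devSign best b = -1 := by
  unfold devSign
  split_ifs <;> simp

/-- If the algorithm fails then in some phase an estimate of a remaining arm deviates. -/
lemma exists_devSign_mul_le {μ : Intervention X → ℝ} {ω : Outcomes X} {ε : ℝ}
    (htie : ∀ ω n (A : Finset (Intervention X)), A.Nonempty → tie ω n A ∈ A)
    (hcard : 2 ≤ arms.card) (hbest : best ∈ arms) {a : Intervention X}
    (ha : a ∈ returned arms adm tie T ω) (hε : 0 ≤ ε) (hbad : μ a < μ best - ε) :
    ∃ j, j + 1 < arms.card ∧ ∃ b ∈ (state arms adm tie T ω j).1, ∃ c ∈ arms,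
      max (sortedGap arms μ best (arms.card - j)) ε ≤ μ best - μ c ∧
      max (sortedGap arms μ best (arms.card - j)) ε / 2 ≤
        devSign best b * (muHat adm T ω b ((state arms adm tie T ω (j + 1)).2 b) - μ b) := by
  -- The phase that eliminates the best arm.
  have hex : ∃ j, j + 1 < arms.card ∧ best ∈ (state arms adm tie T ω j).1 ∧
      best ∉ (state arms adm tie T ω (j + 1)).1 := by
    by_contra! hcon
    have hall : ∀ j, j < arms.card → best ∈ (state arms adm tie T ω j).1 := by
      intro j
      induction j with
      | zero => exact fun _ => hbest
      | succ j ih => exact fun hj => hcon j hj (ih (by omega))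
    obtain ⟨a', -, e⟩ := exists_returned_eq (adm := adm) (T := T) htie hcard ω
    have h1 : best ∈ returned arms adm tie T ω := hall _ (by omega)
    rw [e, Finset.mem_singleton] at ha h1
    rw [ha, h1] at hbad
    linarith
  obtain ⟨j, hj, hbj, hbj1⟩ := hex
  obtain ⟨hsub, hcardj⟩ := state_fst_subset_card (adm := adm) (T := T) (ω := ω) (arms := arms) htie
    (k := j) (by omega)
  obtain ⟨b, hb, hmin, e⟩ := exists_state_succ_fst (adm := adm) (T := T) (ω := ω) (arms := arms)
    htie (k := j) ⟨best, hbj⟩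
  have hb_eq : b = best := by
    by_contra hne
    exact hbj1 (e ▸ Finset.mem_erase.2 ⟨Ne.symm hne, hbj⟩)
  subst hb_eq
  have haj : a ∈ (state arms adm tie T ω j).1 := by
    have hanti : ∀ d, j + d < arms.card →
        (state arms adm tie T ω (j + d)).1 ⊆ (state arms adm tie T ω j).1 := by
      intro d
      induction d with
      | zero => exact fun _ => subset_rfl
      | succ d ih =>
        intro hd
        obtain ⟨b', -, -, e'⟩ := exists_state_succ_fst (adm := adm) (T := T) (ω := ω)
          (arms := arms) htie (k := j + d) (state_nonempty htie (by omega))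
        rw [← add_assoc, e']
        exact (Finset.erase_subset _ _).trans (ih (by omega))
    have h1 := hanti (arms.card - 1 - j) (by omega)
    rw [show j + (arms.card - 1 - j) = arms.card - 1 by omega] at h1
    exact h1 ha
  -- If ε dominates, the returned arm serves as c, since it was still present. Otherwise one of the
  -- N - j remaining arms has the required gap.
  have hc : ∃ c ∈ (state arms adm tie T ω j).1, c ≠ b ∧
      max (sortedGap arms μ b (arms.card - j)) ε ≤ μ b - μ c := by
    rcases le_total (sortedGap arms μ b (arms.card - j)) ε with h | h
    · refine ⟨a, haj, ?_, ?_⟩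
      · rintro rfl
        linarith
      · rw [max_eq_right h]; linarith
    · rw [max_eq_left h, ← hcardj]
      exact exists_sortedGap_le_sub hsub hbj (by omega)
  obtain ⟨c, hc, hcb, hgap⟩ := hc
  have hm := hmin c hc
  -- The best arm had the least estimate, so either c is overestimated or the best arm
  -- underestimated by half of the gap.
  rcases le_or_gt (max (sortedGap arms μ b (arms.card - j)) ε / 2)
    (muHat adm T ω c ((state arms adm tie T ω (j + 1)).2 c) - μ c) with h | h
  · refine ⟨j, hj, c, hc, c, hsub hc, hgap, ?_⟩
    rw [devSign, if_neg hcb]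
    linarith
  · refine ⟨j, hj, b, hb, c, hsub hc, hgap, ?_⟩
    rw [devSign, if_pos rfl]
    linarith

/-- A deviation of the estimate is a deviation of the observational or of the interventional
estimate, with a large enough sample. -/
lemma muHat_cases {ω : Outcomes X} {b : Intervention X} {n : ℕ} {f σ ν d : ℝ} (hf : 20 ≤ f)
    (hn : 2 / 5 * f ≤ tObs b (observations ω) (T / 2) (adm b) + n + 1)
    (h : d ≤ σ * (muHat adm T ω b n - ν)) :
    (f / 5 ≤ tObs b (observations ω) (T / 2) (adm b) ∧
      d ≤ σ * (muObs b (observations ω) (T / 2) (adm b) - ν)) ∨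
    ∃ n : ℕ, 3 / 20 * f ≤ n ∧ d ≤ σ * (muInt T ω b n - ν) := by
  unfold muHat at h
  -- The estimator with the larger sample is used, so it has about half of the total. The additive
  -- one is absorbed by `hf`, or by the strict inequality in the observational case.
  split_ifs at h with hle
  · refine Or.inr ⟨n, ?_, h⟩
    have : (tObs b (observations ω) (T / 2) (adm b) : ℝ) ≤ n := by exact_mod_cast hle
    linarith
  · refine Or.inl ⟨?_, h⟩
    have : (n : ℝ) + 1 ≤ tObs b (observations ω) (T / 2) (adm b) := by
      exact_mod_cast Nat.lt_of_not_le hle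
    linarith

/-- The error probability, in terms of a lower bound for the weighted squared gaps. -/
theorem playLaw_returned_le_of_forall_le (hcard : 2 ≤ arms.card)
    (hadm : ∀ a ∈ arms, ∀ s, adm a = some s → IsAdmissible M a s)
    (htie : ∀ ω n (A : Finset (Intervention X)), A.Nonempty → tie ω n A ∈ A)
    (hbest : best ∈ arms) {ε : ℝ} (hε : 0 ≤ ε) (hε1 : ε < 1) {m : ℕ} (hm : 0 < m) (hmN : m ≤ arms.card)
    (hlow : (arms.filter fun a => qObs M a (adm a) < 1 / (m : ℝ)).card ≤ m)
    (hb : 0 < budget T arms.card) {E : ℝ} (hE : 1 < E)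
    (hgap : ∀ k ∈ Finset.Icc 1 arms.card, 128 * E ≤ budget T arms.card * alpha arms.card m k *
      max (sortedGap arms (mean M) best k) ε ^ 2) :
    (playLaw M).real {ω | ∃ a ∈ returned arms adm tie T ω, mean M a < mean M best - ε} ≤
      4 * ((arms.sup fun a => iCard (adm a) : ℕ) : ℝ) * (arms.card : ℝ) ^ 2 * Real.exp (-E) := by
  classical
  set I : ℕ := arms.sup fun a => iCard (adm a) with hI
  set N := arms.card with hN
  set D : ℕ → ℝ := fun k => max (sortedGap arms (mean M) best k) ε with hD
  set f : ℕ → ℝ := fun k => budget T N * alpha N m k with hf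
  have hm' : (0 : ℝ) < m := by exact_mod_cast hm
  have hIle : ∀ a ∈ arms, (iCard (adm a) : ℝ) ≤ I := fun a ha => by
    exact_mod_cast Finset.le_sup (f := fun a => iCard (adm a)) ha
  have hI1 : (1 : ℝ) ≤ I := le_trans (by exact_mod_cast one_le_iCard _) (hIle best hbest)
  have hDnn : ∀ k, 0 ≤ D k := fun k => hε.trans (le_max_right _ _)
  have hfpos : ∀ k ∈ Finset.Icc 1 N, 0 < f k := fun k hk =>
    mul_pos hb (alpha_pos hm (Finset.mem_Icc.1 hk).1)
  have hDpos : ∀ k ∈ Finset.Icc 1 N, 0 < D k := fun k hk => by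
    refine (hDnn k).lt_of_ne fun h => ?_
    have h1 : 128 * E ≤ f k * D k ^ 2 := hgap k hk
    rw [← h] at h1
    norm_num at h1
    linarith
  have hf_ge : ∀ k ∈ Finset.Icc 1 N, D k ≤ 1 → 128 * E ≤ f k := fun k hk h1 => by
    refine (hgap k hk).trans ?_
    have h2 : D k ^ 2 ≤ 1 := pow_le_one₀ (hDnn k) h1
    exact mul_le_of_le_one_right (hfpos k hk).le h2
  have hmean := fun a => mean_mem_Icc M a
  have hDN : D N ≤ 1 := by
    obtain ⟨c, -, -, hc⟩ := exists_sortedGap_le_sub (μ := mean M) (subset_refl arms) hbest hcard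
    exact max_le (hc.trans (by linarith [(hmean best).2, (hmean c).1])) hε1.le
  -- Since α_N = 1/m, the term k = N alone controls the events in which an arm is observed too
  -- rarely.
  have hcm : 128 * E ≤ budget T N / m := by
    have h := hf_ge N (Finset.mem_Icc.2 ⟨by omega, le_rfl⟩) hDN
    simp only [hf, alpha_self hm hmN] at h
    rwa [mul_one_div] at h
  set low := arms.filter fun a => qObs M a (adm a) < 1 / (m : ℝ) with hlowdef
  let rare : Intervention X → Set (Outcomes X) := fun a =>
    {ω | (tObs a (observations ω) (T / 2) (adm a) : ℝ) < ((T / 2 : ℕ) : ℝ) * (1 / m) / 2}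
  let devObs : ℕ × Intervention X → Set (Outcomes X) := fun p =>
    {ω | f (N - p.1) / 5 ≤ tObs p.2 (observations ω) (T / 2) (adm p.2) ∧ D (N - p.1) / 2 ≤
      devSign best p.2 * (muObs p.2 (observations ω) (T / 2) (adm p.2) - mean M p.2)}
  let devInt : ℕ × Intervention X → Set (Outcomes X) := fun p =>
    {ω | ∃ n : ℕ, 3 / 20 * f (N - p.1) ≤ n ∧ D (N - p.1) / 2 ≤
      devSign best p.2 * (muInt T ω p.2 n - mean M p.2)}
  have hrare : ∀ a ∈ arms \ low, (playLaw M).real (rare a) ≤ I * Real.exp (-E) := by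
    intro a ha
    obtain ⟨ha1, ha2⟩ := Finset.mem_sdiff.1 ha
    have hq : 1 / (m : ℝ) ≤ qObs M a (adm a) := by
      by_contra hlt
      exact ha2 (Finset.mem_filter.2 ⟨ha1, not_le.1 hlt⟩)
    refine (playLaw_tObs_lt_le a (adm a) (by positivity) hq (T / 2)).trans ?_
    gcongr
    · exact Nat.cast_le.1 (hIle a ha1)
    · have h1 := half_sub_le_natCast_half (T := T) hcard
      rw [← budget_mul_logBar T hcard] at h1
      have h2 : budget T N ≤ ((T / 2 : ℕ) : ℝ) :=
        (le_mul_of_one_le_right hb.le (one_le_logBar hcard)).trans h1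
      have h3 : budget T N / m ≤ ((T / 2 : ℕ) : ℝ) / m := by gcongr
      rw [mul_one_div]
      linarith
  have hphase : ∀ p ∈ Finset.range (N - 1) ×ˢ arms, N - p.1 ∈ Finset.Icc 1 N ∧ p.2 ∈ arms := by
    intro p hp
    obtain ⟨h1, h2⟩ := Finset.mem_product.1 hp
    exact ⟨Finset.mem_Icc.2 ⟨by have := Finset.mem_range.1 h1; omega, Nat.sub_le _ _⟩, h2⟩
  have hdevObs : ∀ p ∈ Finset.range (N - 1) ×ˢ arms,
      (playLaw M).real (devObs p) ≤ 2 * I * Real.exp (-E) := by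
    intro p hp
    obtain ⟨hk, hpa⟩ := hphase p hp
    refine (playLaw_le_tObs_muObs_le (hadm p.2 hpa) (devSign_eq best p.2)
      (half_pos (hDpos _ hk)) (by have := hfpos _ hk; positivity) (T / 2)).trans ?_
    gcongr
    · exact Nat.cast_le.1 (hIle _ hpa)
    · have h1 : 128 * E ≤ f (N - p.1) * D (N - p.1) ^ 2 := hgap _ hk
      -- This term decides the constant 128: 128 · 2/245 just exceeds 1.
      have e : 2 * (f (N - p.1) / 5) * (2 / 7 * (D (N - p.1) / 2)) ^ 2 =
        f (N - p.1) * D (N - p.1) ^ 2 * (2 / 245) := by ring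
      rw [e]
      linarith
  have hdevInt : ∀ p ∈ Finset.range (N - 1) ×ˢ arms,
      (playLaw M).real (devInt p) ≤ Real.exp (-E) := by
    intro p hp
    obtain ⟨hk, hpa⟩ := hphase p hp
    refine (playLaw_muInt_le p.2 T (devSign_eq best p.2)
      (half_pos (hDpos _ hk)).le (by have := hfpos _ hk; positivity)).trans ?_
    gcongr
    have h1 : 128 * E ≤ f (N - p.1) * D (N - p.1) ^ 2 := hgap _ hk
    have e : 2 * (3 / 20 * f (N - p.1)) * (D (N - p.1) / 2) ^ 2 =
      f (N - p.1) * D (N - p.1) ^ 2 * (3 / 40) := by ring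
    rw [e]
    linarith
  have hsub : {ω | ∃ a ∈ returned arms adm tie T ω, mean M a < mean M best - ε} ⊆
      (⋃ a ∈ arms \ low, rare a) ∪ ((⋃ p ∈ Finset.range (N - 1) ×ˢ arms, devObs p) ∪
        ⋃ p ∈ Finset.range (N - 1) ×ˢ arms, devInt p) := by
    rintro ω ⟨a, ha, hbad⟩
    by_cases hω : ω ∈ ⋃ a ∈ arms \ low, rare a
    · exact Or.inl hω
    refine Or.inr ?_
    have hhigh : ∀ a ∈ arms, a ∉ low →
        ((T / 2 : ℕ) : ℝ) / (2 * m) ≤ tObs a (observations ω) (T / 2) (adm a) := by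
      intro a ha hal
      by_contra hlt
      refine hω (Set.mem_biUnion (Finset.mem_coe.2 (Finset.mem_sdiff.2 ⟨ha, hal⟩)) ?_)
      have e : ((T / 2 : ℕ) : ℝ) / (2 * m) = ((T / 2 : ℕ) : ℝ) * (1 / m) / 2 := by ring
      exact (not_le.1 hlt).trans_eq e
    obtain ⟨j, hj, b, hbA, c, -, hc1, hdev⟩ :=
      exists_devSign_mul_le htie hcard hbest ha hε hbad
    have hk : N - j ∈ Finset.Icc 1 N := Finset.mem_Icc.2 ⟨by omega, Nat.sub_le _ _⟩
    -- The arm c shows that the threshold is at most 1, so the sample size is at least 128 E > 30.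
    have hfk := hf_ge _ hk (hc1.trans (by linarith [(hmean best).2, (hmean c).1]))
    have hsize := budget_mul_alpha_le_tObs_add htie hcard hb hm hmN hlow
      (Finset.filter_subset _ _) hhigh hj (by simp only [hf] at hfk; linarith) hbA
    have hmem : (j, b) ∈ Finset.range (N - 1) ×ˢ arms :=
      Finset.mem_product.2 ⟨Finset.mem_range.2 (by omega),
        (state_fst_subset_card htie (by omega)).1 hbA⟩
    rcases muHat_cases (by linarith : 20 ≤ f (N - j)) hsize hdev with h | h
    · exact Or.inl (Set.mem_biUnion (Finset.mem_coe.2 hmem) h)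
    · exact Or.inr (Set.mem_biUnion (Finset.mem_coe.2 hmem) h)
  have hunion : (playLaw M).real
      {ω | ∃ a ∈ returned arms adm tie T ω, mean M a < mean M best - ε} ≤
      ∑ a ∈ arms \ low, I * Real.exp (-E) +
        (∑ p ∈ Finset.range (N - 1) ×ˢ arms, 2 * I * Real.exp (-E) +
          ∑ p ∈ Finset.range (N - 1) ×ˢ arms, Real.exp (-E)) := by
    refine (measureReal_mono hsub (measure_ne_top _ _)).trans ?_
    refine (measureReal_union_le _ _).trans (add_le_add ?_ ((measureReal_union_le _ _).trans
      (add_le_add ?_ ?_)))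
    · exact (measureReal_biUnion_finset_le _ _).trans (Finset.sum_le_sum hrare)
    · exact (measureReal_biUnion_finset_le _ _).trans (Finset.sum_le_sum hdevObs)
    · exact (measureReal_biUnion_finset_le _ _).trans (Finset.sum_le_sum hdevInt)
  refine hunion.trans ?_
  simp only [Finset.sum_const, nsmul_eq_mul, Finset.card_product, Finset.card_range]
  have hx := Real.exp_pos (-E)
  have h1 : ((arms \ low).card : ℝ) ≤ N := by
    exact_mod_cast Finset.card_le_card Finset.sdiff_subset
  have h2 : (((N - 1) * N : ℕ) : ℝ) = ((N : ℝ) - 1) * N := by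
    rw [Nat.cast_mul, Nat.cast_sub (by omega)]; simp
  have hN2 : (2 : ℝ) ≤ N := by exact_mod_cast hcard
  rw [← hN, h2]
  have h3 : ((arms \ low).card : ℝ) * (I * Real.exp (-E)) ≤ N * (I * Real.exp (-E)) := by gcongr
  have h4 : ((N : ℝ) - 1) * N * Real.exp (-E) ≤ ((N : ℝ) - 1) * N * (I * Real.exp (-E)) := by
    refine mul_le_mul_of_nonneg_left (le_mul_of_one_le_left hx.le hI1)
      (mul_nonneg (by linarith) (by linarith))
  have h5 : 0 ≤ (N : ℝ) * (I * Real.exp (-E)) := by positivity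
  have h6 : 0 ≤ (N : ℝ) * N * (I * Real.exp (-E)) := by positivity
  -- In units of I exp(-E) the three sums are at most N, 2N(N - 1) and N(N - 1), together below 4N².
  nlinarith

end Error

end CausalBandit
-- The theorem
open CausalBandit MeasureTheory in
theorem mainTheorem4 {X U : Type} [Fintype X] [DecidableEq X] {H : U → Type}
    [∀ u, MeasurableSpace (H u)] [∀ u, Nonempty (H u)] (M : CausalModel X U H)
    (arms : Finset (Intervention X)) (hnull_mem : nullDo X ∈ arms) (hcard : 2 ≤ arms.card)
    (adm : Intervention X → Option (AdmSeq X)) (hnull : adm (nullDo X) = some [])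
    (hadm : ∀ a ∈ arms, ∀ s, adm a = some s → IsAdmissible M a s)
    (tie : TieRule X) (htie : ∀ ω n (A : Finset (Intervention X)), A.Nonempty → tie ω n A ∈ A)
    (best : Intervention X) (hbest_mem : best ∈ arms) (hbest : ∀ a ∈ arms, mean M a ≤ mean M best)
    (T : ℕ) (ε : ℝ) (hε0 : 0 ≤ ε) (hε1 : ε < 1) :
    rounds T arms.card ≤ T ∧
    (∀ ω, ∃ a ∈ arms, returned arms adm tie T ω = {a}) ∧
    (playLaw M).real {ω | ∃ a ∈ returned arms adm tie T ω, mean M a < mean M best - ε} ≤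
      4 * ((arms.sup fun a => iCard (adm a) : ℕ) : ℝ) * (arms.card : ℝ) ^ 2 *
        Real.exp (-(((T : ℝ) / 2 - arms.card) / (128 * logBar arms.card) *
          ((H3 arms (mean M) (fun a => qObs M a (adm a)) best ε)⁻¹).toReal)) := by
  have hN2 : (2 : ℝ) ≤ arms.card := by exact_mod_cast hcard
  refine ⟨rounds_le hcard, exists_returned_eq htie hcard, ?_⟩
  set E : ℝ := ((T : ℝ) / 2 - arms.card) / (128 * logBar arms.card) *
    ((H3 arms (mean M) (fun a => qObs M a (adm a)) best ε)⁻¹).toReal with hE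
  have hE' : 128 * E = budget T arms.card *
      ((H3 arms (mean M) (fun a => qObs M a (adm a)) best ε)⁻¹).toReal := by
    have : logBar arms.card ≠ 0 := by linarith [one_le_logBar hcard]
    rw [hE, budget]
    field_simp
  -- For E ≤ 1 the bound is trivial, as 4 I N² ≥ 16 > e. For E > 1 the budget must be positive.
  rcases le_or_gt E 1 with h | h
  · have hI : (1 : ℝ) ≤ ((arms.sup fun a => iCard (adm a) : ℕ) : ℝ) := by
      exact_mod_cast (one_le_iCard _).trans
        (Finset.le_sup (f := fun a => iCard (adm a)) hnull_mem)
    have hexp : Real.exp (-1) ≤ Real.exp (-E) := Real.exp_le_exp.2 (by linarith)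
    have h1 : 1 ≤ 16 * Real.exp (-E) := by linarith [Real.exp_neg_one_gt_d9]
    refine measureReal_le_one.trans (h1.trans ?_)
    gcongr
    nlinarith [mul_le_mul hI (mul_le_mul hN2 hN2 (by norm_num) (by linarith)) (by norm_num)
      (by linarith)]
  · obtain ⟨hm, hmN, hlow⟩ := obsThreshold_spec (arms := arms)
      (q := fun a => qObs M a (adm a)) (by omega)
    have hb : 0 < budget T arms.card := by
      by_contra hle
      linarith [mul_nonpos_of_nonpos_of_nonneg (not_lt.1 hle) (ENNReal.toReal_nonneg
        (a := (H3 arms (mean M) (fun a => qObs M a (adm a)) best ε)⁻¹))]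
    refine playLaw_returned_le_of_forall_le hcard hadm htie hbest_mem hε0 hε1 hm hmN hlow hb h
      fun k hk => ?_
    rw [hE', mul_assoc]
    exact mul_le_mul_of_nonneg_left (toReal_inv_H3_le hε0 hk) hb.le
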